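/- Everything is of class $C^\infty$. Let $M$ be a (finite-dimensional, Hausdorff) manifold, $\iota: N\hookrightarrow M$ an embedded submanifold, and $\nu N$ a normalization of $N$, i.e. a smooth subbundle of $TM|_N$ with $TM|_N = TN\oplus\nu N$. A vector field $X$ on $M$ is called normal if $X|_N$ takes values in $\nu N$. Let $\mathrm{ann}(\nu N)\subseteq T^*M|_N$ be the annihilator of $\nu N$. A $k$-form $\kappa$ on $M$ is *soldered* to $(N,\nu N)$ if $\iota^*[i(X)\kappa]=0$ and $\iota^*[L_X\kappa]=0$ for every normal vector field $X$ on $M$ (for $k=0$ the first condition is void). Let $\Omega^k(M,N,\nu N)$ be the space of soldered $k$-forms, and $C^\infty(M,N,\nu N)=\Omega^0(M,N,\nu N)$ the algebra of soldered functions. A $k$-vector field $Q\in\mathcal V^k(M)=\Gamma(\wedge^kTM)$ is *soldered* to $(N,\nu N)$ if (i) at each point of $N$, the vector $i(\lambda)Q$ is tangent to $N$ for every $\lambda\in\wedge^{k-1}\mathrm{ann}(\nu N)$ (no condition if $k=0$), and (ii) for every normal vector field $X$ on $M$, $L_XQ$ vanishes along $N$ when it is evaluated on $\wedge^k\mathrm{ann}(\nu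 N)$. Let $\mathcal V^k(M,N,\nu N)$ be the space of soldered $k$-vector fields. **Proposition.** 1. $\mathcal V^1(M,N,\nu N)$ is closed under the Lie bracket of vector fields and, with this bracket, the pointwise product $fX$ and the action $X(f)=df(X)$ on functions, it is a Lie–Rinehart algebra over $(\mathbb R, C^\infty(M,N,\nu N))$. 2. The soldered forms are stable under the exterior derivative $d$ and under the contractions $i(Y)$ with $Y\in\mathcal V^1(M,N,\nu N)$, and $(\bigoplus_k\Omega^k(M,N,\nu N),d)$ with these contractions is a complex over the Lie algebra $\mathcal V^1(M,N,\nu N)$; that is, $i(Y)$ is $\mathbb R$-linear in $Y$, $d^2=0$, $i(Y)i(Z)+i(Z)i(Y)=0$ and $[L_Y,i(Z)]=i([Y,Z])$, where $L_Y=i(Y)d+d\,i(Y)$. 3. $\bigoplus_k\mathcal V^k(M,N,\nu N)$ is closed under the wedge product and under the Schouten–Nijenhuis bracket, which in local coordinates $(x^i)$ is $$[P,Q]=\sum_i\Big((P\lfloor dx^i)\wedge\partial_iQ-\partial_iP\wedge(dx^i\rfloor Q)\Big),$$ where $\partial_i$ differentiates the components, and $\lfloor$, $\rfloor$ are the contractions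 from the right and from the left, $(P\wedge v)\lfloor\alpha=\alpha(v)P-(P\lfloor\alpha)\wedge v$ and $\alpha\rfloor(v\wedge Q)=\alpha(v)Q-v\wedge(\alpha\rfloor Q)$. With these operations it is a Gerstenhaber algebra: for $P,Q,R$ homogeneous of degrees $p,q,r$, * $P\wedge Q=(-1)^{pq}Q\wedge P$, the wedge product is associative with unit $1$ and of degree $0$, and the bracket is $\mathbb R$-bilinear of degree $-1$; * $[P,Q]=-(-1)^{(p-1)(q-1)}[Q,P]$; * $[P,[Q,R]]=[[P,Q],R]+(-1)^{(p-1)(q-1)}[Q,[P,R]]$; * $[P,Q\wedge R]=[P,Q]\wedge R+(-1)^{(p-1)q}Q\wedge[P,R]$. -/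

import Mathlib

open scoped Manifold ContDiff Topology

set_option linter.unusedSectionVars false

noncomputable section

namespace Soldered

/-! ### Vector fields, differential forms and multivector fields on a manifold `M` modelled on `E` -/

/-- The space of smooth vector fields on `M`. -/
abbrev VField (E M : Type*) [NormedAddCommGroup E] [NormedSpace ℝ E] [TopologicalSpace M]
    [ChartedSpace E M] [IsManifold 𝓘(ℝ, E) ∞ M] :=
  Cₛ^∞⟮𝓘(ℝ, E); E, (TangentSpace 𝓘(ℝ, E) : M → Type _)⟯

/-- Not necessarily smooth `k`-forms on `M`: an alternating form on every tangent space. -/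
abbrev FormField (E M : Type*) [NormedAddCommGroup E] [NormedSpace ℝ E] [TopologicalSpace M]
    [ChartedSpace E M] (k : ℕ) :=
  (x : M) → TangentSpace 𝓘(ℝ, E) x [⋀^Fin k]→L[ℝ] ℝ

/-- Not necessarily smooth sections of the full exterior algebra bundle `⋀ TM`. -/
abbrev MultiField (E M : Type*) [NormedAddCommGroup E] [NormedSpace ℝ E] [TopologicalSpace M]
    [ChartedSpace E M] :=
  (x : M) → ExteriorAlgebra ℝ (TangentSpace 𝓘(ℝ, E) x)

section Charts

variable {E M : Type*} [NormedAddCommGroup E] [NormedSpace ℝ E] [TopologicalSpace M]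
  [ChartedSpace E M]

/-- The differential at `y` of the inverse of the preferred chart at `x₀`. -/
def chartInvDeriv (x₀ : M) (y : E) :
    E →L[ℝ] TangentSpace 𝓘(ℝ, E) ((extChartAt 𝓘(ℝ, E) x₀).symm y) :=
  mfderiv 𝓘(ℝ, E) 𝓘(ℝ, E) (extChartAt 𝓘(ℝ, E) x₀).symm y

/-- The differential at `x₀` of the preferred chart at `x₀`. -/
def chartDeriv (x₀ : M) : TangentSpace 𝓘(ℝ, E) x₀ →L[ℝ] E :=
  mfderiv 𝓘(ℝ, E) 𝓘(ℝ, E) (extChartAt 𝓘(ℝ, E) x₀) x₀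

/-- A vector field read in the preferred chart at `x₀`. -/
def chartVField (X : (x : M) → TangentSpace 𝓘(ℝ, E) x) (x₀ : M) (y : E) : E :=
  (chartInvDeriv x₀ y).inverse (X ((extChartAt 𝓘(ℝ, E) x₀).symm y))

/-- A differential form read in the preferred chart at `x₀`. -/
def chartForm {k : ℕ} (κ : FormField E M k) (x₀ : M) (y : E) : E [⋀^Fin k]→L[ℝ] ℝ :=
  (κ ((extChartAt 𝓘(ℝ, E) x₀).symm y)).compContinuousLinearMap (chartInvDeriv x₀ y)

/-- A section of `⋀ TM` read in the preferred chart at `x₀`. -/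
def chartMulti (Q : MultiField E M) (x₀ : M) (y : E) : ExteriorAlgebra ℝ E :=
  ExteriorAlgebra.map (chartInvDeriv x₀ y).inverse.toLinearMap
    (Q ((extChartAt 𝓘(ℝ, E) x₀).symm y))

/-- A `k`-form is smooth if its expression in every preferred chart is smooth. -/
def IsSmoothForm {k : ℕ} (κ : FormField E M k) : Prop :=
  ∀ x₀ : M, ContDiffOn ℝ ∞ (chartForm κ x₀) (extChartAt 𝓘(ℝ, E) x₀).target

/-- A section of `⋀ TM` is smooth if, in every preferred chart, all its components (equivalently,
all linear functionals of it) are smooth functions. -/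
def IsSmoothMulti (Q : MultiField E M) : Prop :=
  ∀ (x₀ : M) (l : Module.Dual ℝ (ExteriorAlgebra ℝ E)),
    ContDiffOn ℝ ∞ (fun y => l (chartMulti Q x₀ y)) (extChartAt 𝓘(ℝ, E) x₀).target

/-- The exterior derivative of a differential form. -/
def formD {k : ℕ} (κ : FormField E M k) : FormField E M (k + 1) := fun x =>
  (extDeriv (chartForm κ x) (extChartAt 𝓘(ℝ, E) x x)).compContinuousLinearMap (chartDeriv x)

/-- The contraction `i(X)κ = κ(X, …)`. -/
def formI {k : ℕ} (X : (x : M) → TangentSpace 𝓘(ℝ, E) x) (κ : FormField E M (k + 1)) :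
    FormField E M k := fun x =>
  ContinuousAlternatingMap.curryLeft (E := E) (κ x) (X x)

/-- The Lie derivative of a differential form, `L_X = i(X) d + d i(X)`
(with `i(X) = 0` on functions). -/
def formLie (X : (x : M) → TangentSpace 𝓘(ℝ, E) x) : {k : ℕ} → FormField E M k → FormField E M k
  | 0, κ => formI X (formD κ)
  | _ + 1, κ => formI X (formD κ) + formD (formI X κ)

/-- A function regarded as a `0`-form. -/
def funForm (f : M → ℝ) : FormField E M 0 := fun x =>
  ContinuousAlternatingMap.constOfIsEmpty ℝ (TangentSpace 𝓘(ℝ, E) x) (Fin 0) (f x)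

/-- A vector field regarded as a section of `⋀ TM` (of degree one). -/
def vfieldMulti (X : (x : M) → TangentSpace 𝓘(ℝ, E) x) : MultiField E M := fun x =>
  ExteriorAlgebra.ι ℝ (X x)

end Charts

section Multi

variable {E M : Type*} [NormedAddCommGroup E] [NormedSpace ℝ E] [FiniteDimensional ℝ E]
  [TopologicalSpace M] [ChartedSpace E M]

/-- The derivative at `y`, in the direction `v`, of a function with values in the (finite
dimensional) vector space `⋀ E`, taken componentwise in the basis `e_I` of `⋀ E` which is induced
by a basis `e_i` of `E`. -/
def dirDeriv (Q : E → ExteriorAlgebra ℝ E) (y v : E) : ExteriorAlgebra ℝ E :=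
  ∑ I, fderiv ℝ (fun z => (Module.finBasis ℝ E).ExteriorAlgebra.repr (Q z) I) y v •
    (Module.finBasis ℝ E).ExteriorAlgebra I

/-- The Lie derivative of a multivector field `Q` on the vector space `E` with respect to a vector
field `X`, `L_X Q = X^i ∂_i Q - ∑_i (∂_i X) ∧ i(dx^i) Q`. -/
def flatLie (X : E → E) (Q : E → ExteriorAlgebra ℝ E) (y : E) : ExteriorAlgebra ℝ E :=
  dirDeriv Q y (X y) - ∑ i, ExteriorAlgebra.ι ℝ (fderiv ℝ X y (Module.finBasis ℝ E i)) *
    CliffordAlgebra.contractLeft ((Module.finBasis ℝ E).coord i) (Q y)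

/-- The Schouten-Nijenhuis bracket of multivector fields on the vector space `E`,
`[P, Q] = ∑_i (P ⌊ dx^i) ∧ ∂_i Q - ∂_i P ∧ (dx^i ⌋ Q)`.

Here `⌊` and `⌋` are the contractions from the right and from the left, which are determined by
`(P ∧ v) ⌊ α = α(v) P - (P ⌊ α) ∧ v` and `α ⌋ (v ∧ Q) = α(v) Q - v ∧ (α ⌋ Q)`. -/
def flatSchouten (P Q : E → ExteriorAlgebra ℝ E) (y : E) : ExteriorAlgebra ℝ E :=
  ∑ i, (CliffordAlgebra.contractRight (P y) ((Module.finBasis ℝ E).coord i) *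
      dirDeriv Q y (Module.finBasis ℝ E i) -
    dirDeriv P y (Module.finBasis ℝ E i) *
      CliffordAlgebra.contractLeft ((Module.finBasis ℝ E).coord i) (Q y))

/-- The Lie derivative of a multivector field on `M`. -/
def multiLie (X : (x : M) → TangentSpace 𝓘(ℝ, E) x) (Q : MultiField E M) : MultiField E M :=
  fun x => ExteriorAlgebra.map (chartDeriv x).inverse.toLinearMap
    (flatLie (chartVField X x) (chartMulti Q x) (extChartAt 𝓘(ℝ, E) x x))

/-- The Schouten-Nijenhuis bracket of multivector fields on `M`. -/
def schouten (P Q : MultiField E M) : MultiField E M :=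
  fun x => ExteriorAlgebra.map (chartDeriv x).inverse.toLinearMap
    (flatSchouten (chartMulti P x) (chartMulti Q x) (extChartAt 𝓘(ℝ, E) x x))

end Multi

/-- The contraction `i(λ)Q` of `Q ∈ ⋀ V` with `λ ∈ ⋀ V*`, with
`i(α₁ ∧ ⋯ ∧ α_l)Q = α₁ ⌋ (⋯ ⌋ (α_l ⌋ Q))`. -/
def multiContract {V : Type*} [AddCommGroup V] [Module ℝ V] :
    ExteriorAlgebra ℝ (Module.Dual ℝ V) →ₐ[ℝ] Module.End ℝ (ExteriorAlgebra ℝ V) :=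
  ExteriorAlgebra.lift ℝ ⟨CliffordAlgebra.contractLeft, fun α =>
    LinearMap.ext fun Q => CliffordAlgebra.contractLeft_contractLeft α Q⟩

/-! ### Normalized submanifolds -/

/-- A normalized (embedded) submanifold `N` of `M`: the embedding `ι`, and a smooth subbundle `ν`
of `TM|_N` (given by its fibres, and having local smooth frames) which is a complement of `TN`. -/
structure NormalizedSubmanifold (E M F N : Type*) [NormedAddCommGroup E] [NormedSpace ℝ E]
    [TopologicalSpace M] [ChartedSpace E M] [IsManifold 𝓘(ℝ, E) ∞ M]
    [NormedAddCommGroup F] [NormedSpace ℝ F] [TopologicalSpace N] [ChartedSpace F N]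
    [IsManifold 𝓘(ℝ, F) ∞ N] where
  incl : N → M
  isSmoothEmbedding : Manifold.IsSmoothEmbedding 𝓘(ℝ, F) 𝓘(ℝ, E) ∞ incl
  normal : (y : N) → Submodule ℝ (TangentSpace 𝓘(ℝ, E) (incl y))
  isCompl : ∀ y, IsCompl (LinearMap.range (mfderiv 𝓘(ℝ, F) 𝓘(ℝ, E) incl y).toLinearMap) (normal y)
  smooth : ∀ y₀ : N, ∃ (r : ℕ) (s : Fin r → (y : N) → TangentSpace 𝓘(ℝ, E) (incl y)),
    ∃ U ∈ 𝓝 y₀,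
      (∀ i, ContMDiffOn 𝓘(ℝ, F) 𝓘(ℝ, E).tangent ∞
        (fun y => (⟨incl y, s i y⟩ : TangentBundle 𝓘(ℝ, E) M)) U) ∧
      ∀ y ∈ U, LinearIndependent ℝ (fun i => s i y) ∧
        Submodule.span ℝ (Set.range fun i => s i y) = normal y

variable {E M F N : Type*} [NormedAddCommGroup E] [NormedSpace ℝ E]
  [TopologicalSpace M] [ChartedSpace E M] [IsManifold 𝓘(ℝ, E) ∞ M]
  [NormedAddCommGroup F] [NormedSpace ℝ F] [TopologicalSpace N] [ChartedSpace F N]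
  [IsManifold 𝓘(ℝ, F) ∞ N]

namespace NormalizedSubmanifold

variable (S : NormalizedSubmanifold E M F N)

/-- The differential of the embedding. -/
def dIncl (y : N) : TangentSpace 𝓘(ℝ, F) y →L[ℝ] TangentSpace 𝓘(ℝ, E) (S.incl y) :=
  mfderiv 𝓘(ℝ, F) 𝓘(ℝ, E) S.incl y

/-- The tangent space of `N`, as a subspace of the tangent space of `M`. -/
def tangent (y : N) : Submodule ℝ (TangentSpace 𝓘(ℝ, E) (S.incl y)) :=
  LinearMap.range (S.dIncl y).toLinearMap

/-- The vector field `X` of `M` is normal to `N`. -/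
def IsNormal (X : VField E M) : Prop := ∀ y, X (S.incl y) ∈ S.normal y

/-- The pullback to `N` of a differential form of `M`. -/
def pullback {k : ℕ} (κ : FormField E M k) : FormField F N k := fun y =>
  (κ (S.incl y)).compContinuousLinearMap (S.dIncl y)

/-- The soldering conditions for a form `κ`: `ι^*[i(X)κ] = 0` and `ι^*[L_X κ] = 0` for all vector
fields `X` of `M` which are normal to `N`. (The first condition is void for functions.) -/
def IsSolderedForm : {k : ℕ} → FormField E M k → Prop
  | 0, κ => ∀ X : VField E M, S.IsNormal X → S.pullback (formLie X κ) = 0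
  | _ + 1, κ => ∀ X : VField E M, S.IsNormal X →
      S.pullback (formI X κ) = 0 ∧ S.pullback (formLie X κ) = 0

/-- `⋀^l ann(νN)` at `y`, as a subspace of `⋀ T^*M`. -/
def annPower (l : ℕ) (y : N) :
    Submodule ℝ (ExteriorAlgebra ℝ (Module.Dual ℝ (TangentSpace 𝓘(ℝ, E) (S.incl y)))) :=
  (⋀[ℝ]^l (S.normal y).dualAnnihilator).map
    (ExteriorAlgebra.map (S.normal y).dualAnnihilator.subtype).toLinearMap

/-- The soldering conditions for a `k`-vector field `Q`: i) for `λ ∈ ⋀^{k-1} ann(νN)`, the vector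
`i(λ)Q` is tangent to `N` (no condition if `k = 0`); ii) for all vector fields `X` of `M` which are
normal to `N`, `L_X Q` vanishes on `ann(νN)`. -/
def IsSolderedMulti [FiniteDimensional ℝ E] (k : ℕ) (Q : MultiField E M) : Prop :=
  (∀ (y : N) (l : ℕ), k = l + 1 → ∀ a ∈ S.annPower l y,
    multiContract a (Q (S.incl y)) ∈ (S.tangent y).map (ExteriorAlgebra.ι ℝ)) ∧
  (∀ X : VField E M, S.IsNormal X → ∀ (y : N), ∀ a ∈ S.annPower k y,
    multiContract a (multiLie X Q (S.incl y)) = 0)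

end NormalizedSubmanifold


/-! ### The Lie algebra of vector fields -/

theorem VField.mdiff (X : VField E M) (x : M) :
    MDifferentiableAt 𝓘(ℝ, E) 𝓘(ℝ, E).tangent
      (fun x => (⟨x, X x⟩ : TangentBundle 𝓘(ℝ, E) M)) x :=
  (X.contMDiff x).mdifferentiableAt (by simp)

instance vfieldLieRing [FiniteDimensional ℝ E] : LieRing (VField E M) where
  bracket X Y := ⟨VectorField.mlieBracket 𝓘(ℝ, E) X Y, by
    have : IsManifold 𝓘(ℝ, E) (((⊤ : ℕ∞) : WithTop ℕ∞) + 1) M := by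
      simpa using (inferInstance : IsManifold 𝓘(ℝ, E) ∞ M)
    have : IsManifold 𝓘(ℝ, E) (minSmoothness ℝ 2) M := by simp; infer_instance
    have : CompleteSpace E := FiniteDimensional.complete ℝ E
    exact ContDiff.mlieBracket_vectorField (m := ⊤) (n := ⊤) X.contMDiff Y.contMDiff (by simp)⟩
  add_lie X Y Z := by
    have : CompleteSpace E := FiniteDimensional.complete ℝ E
    ext x
    exact VectorField.mlieBracket_add_left (X.mdiff x) (Y.mdiff x)
  lie_add X Y Z := by
    have : CompleteSpace E := FiniteDimensional.complete ℝ E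
    ext x
    exact VectorField.mlieBracket_add_right (Y.mdiff x) (Z.mdiff x)
  lie_self X := by
    ext x
    exact congrFun (VectorField.mlieBracket_self (V := X)) x
  leibniz_lie X Y Z := by
    have : CompleteSpace E := FiniteDimensional.complete ℝ E
    have : IsManifold 𝓘(ℝ, E) (minSmoothness ℝ 3) M := by simp; infer_instance
    have h : ∀ (W : VField E M) (x : M), ContMDiffAt 𝓘(ℝ, E) 𝓘(ℝ, E).tangent (minSmoothness ℝ 2)
        (fun x => (⟨x, W x⟩ : TangentBundle 𝓘(ℝ, E) M)) x := fun W x => by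
      refine (W.contMDiff x).of_le ?_
      rw [minSmoothness_of_isRCLikeNormedField]
      exact WithTop.coe_le_coe.2 (le_top : (2 : ℕ∞) ≤ ⊤)
    ext x
    exact VectorField.leibniz_identity_mlieBracket_apply (h X x) (h Y x) (h Z x)

instance vfieldLieAlgebra [FiniteDimensional ℝ E] : LieAlgebra ℝ (VField E M) where
  lie_smul c X Y := by
    have : CompleteSpace E := FiniteDimensional.complete ℝ E
    ext x
    exact VectorField.mlieBracket_const_smul_right (Y.mdiff x)

/-! ### Linearity of the operations on forms and multivector fields -/

section Linear

theorem target_mem (x : M) :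
    (extChartAt 𝓘(ℝ, E) x).target ∈ 𝓝 (extChartAt 𝓘(ℝ, E) x x) :=
  (isOpen_extChartAt_target x).mem_nhds (mem_extChartAt_target x)

theorem IsSmoothForm.diffAt {k : ℕ} {κ : FormField E M k} (h : IsSmoothForm κ) (x : M) :
    DifferentiableAt ℝ (chartForm κ x) (extChartAt 𝓘(ℝ, E) x x) :=
  ((h x).contDiffAt (target_mem x)).differentiableAt (by simp)

theorem chartVField_diffAt [CompleteSpace E] (X : VField E M) (x : M) :
    DifferentiableAt ℝ (chartVField X x) (extChartAt 𝓘(ℝ, E) x x) := by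
  have := (mdifferentiableWithinAt_univ.2
    (X.mdiff x)).differentiableWithinAt_mpullbackWithin_vectorField
  simp only [modelWithCornersSelf_coe, Set.range_id, Set.preimage_univ, Set.inter_univ,
    VectorField.mpullbackWithin_univ] at this
  exact differentiableWithinAt_univ.1 this

theorem chartInvDeriv_inv (x : M) {y : E} (hy : y ∈ (extChartAt 𝓘(ℝ, E) x).target) :
    (chartInvDeriv x y).IsInvertible := by
  have := isInvertible_mfderivWithin_extChartAt_symm (I := 𝓘(ℝ, E)) hy
  simpa using! this

theorem chartForm_formI {k : ℕ} (X : VField E M) (κ : FormField E M (k + 1)) (x : M)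
    {y : E} (hy : y ∈ (extChartAt 𝓘(ℝ, E) x).target) :
    chartForm (formI X κ) x y =
      (ContinuousAlternatingMap.curryLeft (chartForm κ x y)) (chartVField X x y) := by
  ext v
  have h := (chartInvDeriv_inv x hy).self_apply_inverse (X ((extChartAt 𝓘(ℝ, E) x).symm y))
  refine Eq.trans ?_ (congrArg (fun w => κ ((extChartAt 𝓘(ℝ, E) x).symm y)
    (Matrix.vecCons w (fun i => chartInvDeriv x y (v i)))) h).symm |>.trans ?_
  · rfl
  · refine congrArg (κ ((extChartAt 𝓘(ℝ, E) x).symm y)) (funext fun i => ?_)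
    refine Fin.cases ?_ (fun j => ?_) i <;> rfl

theorem formI_diffAt [CompleteSpace E] {k : ℕ} (X : VField E M) {κ : FormField E M (k + 1)}
    (h : IsSmoothForm κ) (x : M) :
    DifferentiableAt ℝ (chartForm (formI X κ) x) (extChartAt 𝓘(ℝ, E) x x) := by
  have h1 : chartForm (formI X κ) x =ᶠ[𝓝 (extChartAt 𝓘(ℝ, E) x x)] fun y =>
      (ContinuousAlternatingMap.curryLeft (chartForm κ x y)) (chartVField X x y) := by
    filter_upwards [target_mem x] with y hy using chartForm_formI X κ x hy
  refine DifferentiableAt.congr_of_eventuallyEq ?_ h1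
  have h2 : DifferentiableAt ℝ (fun y => ContinuousAlternatingMap.curryLeft (chartForm κ x y))
      (extChartAt 𝓘(ℝ, E) x x) :=
    DifferentiableAt.comp (g := fun w : E [⋀^Fin (k + 1)]→L[ℝ] ℝ =>
      ContinuousAlternatingMap.curryLeft w) _ (ContinuousLinearMap.differentiableAt
      (ContinuousAlternatingMap.curryLeftLI (𝕜 := ℝ) (E := E) (F := ℝ)
        (n := k)).toContinuousLinearMap) (h.diffAt x)
  exact h2.clm_apply (chartVField_diffAt X x)

theorem formD_add {k : ℕ} {κ₁ κ₂ : FormField E M k} {x : M}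
    (h₁ : DifferentiableAt ℝ (chartForm κ₁ x) (extChartAt 𝓘(ℝ, E) x x))
    (h₂ : DifferentiableAt ℝ (chartForm κ₂ x) (extChartAt 𝓘(ℝ, E) x x)) :
    formD (κ₁ + κ₂) x = formD κ₁ x + formD κ₂ x := by
  have : chartForm (κ₁ + κ₂) x = chartForm κ₁ x + chartForm κ₂ x := rfl
  simp only [formD, this, extDeriv_add h₁ h₂]
  rfl

theorem formD_smul {k : ℕ} (c : ℝ) (κ : FormField E M k) :
    formD (c • κ) = c • formD κ := by
  ext1 x
  have : chartForm (c • κ) x = c • chartForm κ x := rfl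
  simp only [formD, this, extDeriv_smul]
  rfl

theorem formLie_add [CompleteSpace E] (X : VField E M) {k : ℕ} {κ₁ κ₂ : FormField E M k}
    (h₁ : IsSmoothForm κ₁) (h₂ : IsSmoothForm κ₂) :
    formLie X (κ₁ + κ₂) = formLie X κ₁ + formLie X κ₂ := by
  have hd : formD (κ₁ + κ₂) = formD κ₁ + formD κ₂ :=
    funext fun x => formD_add (h₁.diffAt x) (h₂.diffAt x)
  cases k with
  | zero => simp only [formLie, hd]; rfl
  | succ k =>
    have hi : formI X (κ₁ + κ₂) = formI X κ₁ + formI X κ₂ := rfl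
    have hd' : formD (formI X κ₁ + formI X κ₂) = formD (formI X κ₁) + formD (formI X κ₂) :=
      funext fun x => formD_add (formI_diffAt X h₁ x) (formI_diffAt X h₂ x)
    have hi' : formI X (formD κ₁ + formD κ₂) = formI X (formD κ₁) + formI X (formD κ₂) := rfl
    simp only [formLie, hd, hi, hd', hi']
    abel

theorem formLie_smul (X : VField E M) {k : ℕ} (c : ℝ) (κ : FormField E M k) :
    formLie X (c • κ) = c • formLie X κ := by
  cases k with
  | zero => simp only [formLie, formD_smul]; rfl
  | succ k =>
    have hi : formI X (c • κ) = c • formI X κ := rfl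
    have hi' : formI X (c • formD κ) = c • formI X (formD κ) := rfl
    simp only [formLie, formD_smul, hi, hi', smul_add]

theorem IsSmoothMulti.comp_diffAt [FiniteDimensional ℝ E] {Q : MultiField E M}
    (h : IsSmoothMulti Q) (x : M) (I : Finset (Fin (Module.finrank ℝ E))) :
    DifferentiableAt ℝ
      (fun z => (Module.finBasis ℝ E).ExteriorAlgebra.repr (chartMulti Q x z) I)
      (extChartAt 𝓘(ℝ, E) x x) :=
  ((h x ((Module.finBasis ℝ E).ExteriorAlgebra.coord I)).contDiffAt
    (target_mem x)).differentiableAt (by simp)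

theorem chartMulti_add (P Q : MultiField E M) (x : M) :
    chartMulti (P + Q) x = chartMulti P x + chartMulti Q x := by
  ext1 y; exact map_add _ _ _

theorem chartMulti_smul (c : ℝ) (Q : MultiField E M) (x : M) :
    chartMulti (c • Q) x = c • chartMulti Q x := by
  ext1 y; exact map_smul (ExteriorAlgebra.map (chartInvDeriv x y).inverse.toLinearMap) c _

theorem multiLie_add [FiniteDimensional ℝ E] (X : VField E M) {P Q : MultiField E M}
    (hP : IsSmoothMulti P) (hQ : IsSmoothMulti Q) :
    multiLie X (P + Q) = multiLie X P + multiLie X Q := by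
  ext1 x
  have hd : dirDeriv (chartMulti P x + chartMulti Q x) (extChartAt 𝓘(ℝ, E) x x) =
      dirDeriv (chartMulti P x) (extChartAt 𝓘(ℝ, E) x x) +
      dirDeriv (chartMulti Q x) (extChartAt 𝓘(ℝ, E) x x) := by
    ext1 v
    simp only [dirDeriv, Pi.add_apply, ← Finset.sum_add_distrib, ← add_smul]
    refine Finset.sum_congr rfl fun I _ => ?_
    congr 1
    have := fderiv_add (hP.comp_diffAt x I) (hQ.comp_diffAt x I)
    rw [← add_apply, ← this]
    congr 2
    ext z
    simp
  simp only [multiLie, flatLie, chartMulti_add, hd, Pi.add_apply, map_add, mul_add,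
    Finset.sum_add_distrib]
  rw [← map_add]
  congr 1
  abel

theorem multiLie_smul [FiniteDimensional ℝ E] (X : VField E M) (c : ℝ)
    (Q : MultiField E M) : multiLie X (c • Q) = c • multiLie X Q := by
  ext1 x
  have hd : dirDeriv (c • chartMulti Q x) (extChartAt 𝓘(ℝ, E) x x) =
      c • dirDeriv (chartMulti Q x) (extChartAt 𝓘(ℝ, E) x x) := by
    ext1 v
    simp only [dirDeriv, Pi.smul_apply, Finset.smul_sum, ← smul_assoc]
    refine Finset.sum_congr rfl fun I _ => ?_
    congr 1
    have := fderiv_const_smul_field (𝕜 := ℝ) c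
      (f := fun z => (Module.finBasis ℝ E).ExteriorAlgebra.repr (chartMulti Q x z) I)
    rw [← smul_apply, ← Pi.smul_apply, ← this]
    congr 2
    ext z
    simp
  simp only [multiLie, flatLie, chartMulti_smul, hd, Pi.smul_apply, map_smul, mul_smul_comm,
    ← Finset.smul_sum, ← smul_sub]

theorem funForm_lie (X : VField E M) {f : M → ℝ} (hf : MDifferentiable 𝓘(ℝ, E) 𝓘(ℝ) f)
    (x : M) (v : Fin 0 → TangentSpace 𝓘(ℝ, E) x) :
    formLie X (funForm f) x v = mfderiv 𝓘(ℝ, E) 𝓘(ℝ) f x (X x) := by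
  set φ := extChartAt 𝓘(ℝ, E) x
  have h1 : chartForm (funForm f) x = fun y =>
      ContinuousAlternatingMap.constOfIsEmpty ℝ E (Fin 0) (f (φ.symm y)) := rfl
  have h2 : formLie X (funForm f) x v = fderiv ℝ (fun y => f (φ.symm y)) (φ x)
      (chartDeriv x (X x)) := by
    simp only [formLie, formI, formD, h1]
    rw [extDeriv_constOfIsEmpty]
    rfl
  rw [h2]
  have h3 : MDifferentiableAt 𝓘(ℝ, E) 𝓘(ℝ) (fun y => f (φ.symm y)) (φ x) := by
    have := (mdifferentiableOn_extChartAt_symm (I := 𝓘(ℝ, E)) (x := x)).mdifferentiableAt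
      (target_mem x)
    exact (hf _).comp _ this
  have h4 : MDifferentiableAt 𝓘(ℝ, E) 𝓘(ℝ, E) φ x :=
    mdifferentiableAt_extChartAt (mem_chart_source E x)
  have h5 : f =ᶠ[𝓝 x] (fun y => f (φ.symm y)) ∘ φ := by
    filter_upwards [extChartAt_source_mem_nhds (I := 𝓘(ℝ, E)) x] with z hz
    simp only [Function.comp_apply]
    rw [φ.left_inv hz]
  rw [h5.mfderiv_eq, mfderiv_comp x h3 h4, mfderiv_eq_fderiv]
  rfl

end Linear

/-! ### The spaces of soldered objects -/

namespace NormalizedSubmanifold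

variable (S : NormalizedSubmanifold E M F N)

/-- The space `Ω^k(M, N, νN)` of soldered `k`-forms. -/
def solderedForms [FiniteDimensional ℝ E] (k : ℕ) : Submodule ℝ (FormField E M k) where
  carrier := {κ | IsSmoothForm κ ∧ S.IsSolderedForm κ}
  zero_mem' := by
    have h0 : IsSmoothForm (0 : FormField E M k) := fun x₀ => by
      have : chartForm (0 : FormField E M k) x₀ = fun _ => 0 := rfl
      rw [this]
      exact contDiffOn_const
    have hL : ∀ X : VField E M, formLie X (0 : FormField E M k) = 0 := fun X => by
      simpa using formLie_smul X 0 (0 : FormField E M k)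
    refine ⟨h0, ?_⟩
    cases k with
    | zero => intro X _; rw [hL]; rfl
    | succ k => intro X _; rw [hL]; exact ⟨rfl, rfl⟩
  add_mem' := by
    have : CompleteSpace E := FiniteDimensional.complete ℝ E
    rintro κ₁ κ₂ ⟨h₁, h₁'⟩ ⟨h₂, h₂'⟩
    refine ⟨fun x₀ => (h₁ x₀).add (h₂ x₀), ?_⟩
    have hp : ∀ {l : ℕ} (a b : FormField E M l),
      S.pullback (a + b) = S.pullback a + S.pullback b := fun _ _ => rfl
    cases k with
    | zero =>
      intro X hX
      rw [formLie_add X h₁ h₂, hp, h₁' X hX, h₂' X hX, add_zero]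
    | succ k =>
      intro X hX
      have hi : formI X (κ₁ + κ₂) = formI X κ₁ + formI X κ₂ := rfl
      rw [formLie_add X h₁ h₂, hi, hp, hp, (h₁' X hX).1, (h₂' X hX).1, (h₁' X hX).2,
        (h₂' X hX).2]
      simp
  smul_mem' := by
    rintro c κ ⟨h, h'⟩
    refine ⟨fun x₀ => (h x₀).const_smul c, ?_⟩
    have hp : ∀ {l : ℕ} (a : FormField E M l), S.pullback (c • a) = c • S.pullback a :=
      fun _ => rfl
    cases k with
    | zero =>
      intro X hX
      rw [formLie_smul, hp, h' X hX, smul_zero]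
    | succ k =>
      intro X hX
      have hi : formI X (c • κ) = c • formI X κ := rfl
      rw [formLie_smul, hi, hp, hp, (h' X hX).1, (h' X hX).2]
      simp

theorem funForm_soldered_iff {f : M → ℝ} (hf : ContMDiff 𝓘(ℝ, E) 𝓘(ℝ) ∞ f) :
    S.IsSolderedForm (funForm f) ↔ ∀ X : VField E M, S.IsNormal X →
      ∀ y, mfderiv 𝓘(ℝ, E) 𝓘(ℝ) f (S.incl y) (X (S.incl y)) = 0 := by
  have hf' := hf.mdifferentiable (by simp)
  refine forall_congr' fun X => forall_congr' fun _ => ?_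
  rw [funext_iff]
  refine forall_congr' fun y => ?_
  constructor
  · intro h
    rw [← funForm_lie X hf' (S.incl y) (fun i => Fin.elim0 i)]
    have := congrArg (fun w => w (fun i => Fin.elim0 i)) h
    refine Eq.trans ?_ this
    refine congrArg (formLie X (funForm f) (S.incl y)) (funext fun i => Fin.elim0 i)
  · intro h
    ext v
    exact (funForm_lie X hf' (S.incl y) _).trans h

/-- The algebra `C^∞(M, N, νN)` of soldered functions, that is, of soldered `0`-forms. -/
def solderedFunctions : Subalgebra ℝ C^∞⟮𝓘(ℝ, E), M; ℝ⟯ where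
  carrier := {f | S.IsSolderedForm (funForm f)}
  add_mem' := by
    intro f g hf hg
    simp only [Set.mem_ofPred_eq, S.funForm_soldered_iff (ContMDiffMap.contMDiff _)] at *
    intro X hX y
    have h := ((f.contMDiff.mdifferentiable (by simp) (S.incl y)).hasMFDerivAt.add
      (g.contMDiff.mdifferentiable (by simp) (S.incl y)).hasMFDerivAt).mfderiv
    refine (congrArg (fun A => A (X (S.incl y))) h).trans ?_
    refine (congrArg₂ (fun a b : ℝ => a + b) (hf X hX y) (hg X hX y)).trans ?_
    exact add_zero (0 : ℝ)
  mul_mem' := by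
    intro f g hf hg
    simp only [Set.mem_ofPred_eq, S.funForm_soldered_iff (ContMDiffMap.contMDiff _)] at *
    intro X hX y
    have h := ((f.contMDiff.mdifferentiable (by simp) (S.incl y)).hasMFDerivAt.mul
      (g.contMDiff.mdifferentiable (by simp) (S.incl y)).hasMFDerivAt).mfderiv
    refine (congrArg (fun A => A (X (S.incl y))) h).trans ?_
    refine (congrArg₂ (fun a b : ℝ => f (S.incl y) * a + g (S.incl y) * b)
      (hg X hX y) (hf X hX y)).trans ?_
    change f (S.incl y) * (0 : ℝ) + g (S.incl y) * (0 : ℝ) = 0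
    rw [mul_zero, mul_zero, add_zero]
  algebraMap_mem' := by
    intro c
    simp only [Set.mem_ofPred_eq, S.funForm_soldered_iff (ContMDiffMap.contMDiff _)] at *
    intro X hX y
    have h : HasMFDerivAt 𝓘(ℝ, E) 𝓘(ℝ) (algebraMap ℝ C^∞⟮𝓘(ℝ, E), M; ℝ⟯ c) (S.incl y)
        (0 : TangentSpace 𝓘(ℝ, E) (S.incl y) →L[ℝ] ℝ) := hasMFDerivAt_const c (S.incl y)
    exact congrArg (fun A : E →L[ℝ] ℝ => A (X (S.incl y))) h.mfderiv

/-- The space `V^k(M, N, νN)` of soldered `k`-vector fields. -/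
def solderedMultis [FiniteDimensional ℝ E] (k : ℕ) : Submodule ℝ (MultiField E M) where
  carrier := {Q | IsSmoothMulti Q ∧ (∀ x, Q x ∈ ⋀[ℝ]^k (TangentSpace 𝓘(ℝ, E) x)) ∧
    S.IsSolderedMulti k Q}
  zero_mem' := by
    have hL : ∀ X : VField E M, multiLie X (0 : MultiField E M) = 0 := fun X => by
      simpa using multiLie_smul X 0 (0 : MultiField E M)
    refine ⟨fun x₀ l => ?_, fun x => Submodule.zero_mem _, ?_, ?_⟩
    · have : chartMulti (0 : MultiField E M) x₀ = 0 := by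
        simpa using chartMulti_smul 0 (0 : MultiField E M) x₀
      simp only [this, Pi.zero_apply, map_zero]
      exact contDiffOn_const
    · intro y l _ a _
      rw [Pi.zero_apply, map_zero]
      exact Submodule.zero_mem _
    · intro X _ y a _
      rw [hL, Pi.zero_apply, map_zero]
  add_mem' := by
    rintro P Q ⟨hP, hP1, hP2, hP3⟩ ⟨hQ, hQ1, hQ2, hQ3⟩
    refine ⟨fun x₀ l => ?_, fun x => Submodule.add_mem _ (hP1 x) (hQ1 x), ?_, ?_⟩
    · simp only [chartMulti_add, Pi.add_apply, map_add]
      exact (hP x₀ l).add (hQ x₀ l)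
    · intro y l hl a ha
      rw [Pi.add_apply, map_add]
      exact Submodule.add_mem _ (hP2 y l hl a ha) (hQ2 y l hl a ha)
    · intro X hX y a ha
      rw [multiLie_add X hP hQ, Pi.add_apply, map_add, hP3 X hX y a ha, hQ3 X hX y a ha, add_zero]
  smul_mem' := by
    rintro c Q ⟨hQ, hQ1, hQ2, hQ3⟩
    refine ⟨fun x₀ l => ?_, fun x => Submodule.smul_mem _ c (hQ1 x), ?_, ?_⟩
    · simp only [chartMulti_smul, Pi.smul_apply, map_smul]
      exact (hQ x₀ l).const_smul c
    · intro y l hl a ha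
      rw [Pi.smul_apply, map_smul]
      exact Submodule.smul_mem _ c (hQ2 y l hl a ha)
    · intro X hX y a ha
      rw [multiLie_smul, Pi.smul_apply, map_smul, hQ3 X hX y a ha, smul_zero]

end NormalizedSubmanifold

/-! ### Complexes over Lie algebras and Gerstenhaber algebras -/

/-- A sequence of vector spaces with operators `d` of degree `1` and operators `i a` of
degree `-1`, for `a` in `L` (where `i a` vanishes in degree `0`). -/
structure ContractionSequence (L : Type*) [AddCommGroup L] [Module ℝ L]
    (Ω : ℕ → Type*) [∀ k, AddCommGroup (Ω k)] [∀ k, Module ℝ (Ω k)] where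
  d : (k : ℕ) → Ω k →ₗ[ℝ] Ω (k + 1)
  i : (k : ℕ) → L →ₗ[ℝ] Ω (k + 1) →ₗ[ℝ] Ω k

/-- The operators `L_a = i_a d + d i_a`. -/
def ContractionSequence.lie {L : Type*} [AddCommGroup L] [Module ℝ L]
    {Ω : ℕ → Type*} [∀ k, AddCommGroup (Ω k)] [∀ k, Module ℝ (Ω k)]
    (C : ContractionSequence L Ω) (a : L) : (k : ℕ) → Ω k → Ω k
  | 0, w => C.i 0 a (C.d 0 w)
  | k + 1, w => C.i (k + 1) a (C.d (k + 1) w) + C.d k (C.i k a w)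

/-- A complex over a Lie algebra `L`: a cochain complex `(Ω, d)` with operators `i_a`, `a ∈ L`, of
degree `-1`, linear in `a`, such that `i_a i_b + i_b i_a = 0` and `[L_a, i_b] = i_{[a, b]}` where
`L_a = i_a d + d i_a`. -/
structure ComplexOverLieAlgebra (L : Type*) [LieRing L] [LieAlgebra ℝ L]
    (Ω : ℕ → Type*) [∀ k, AddCommGroup (Ω k)] [∀ k, Module ℝ (Ω k)] extends
    ContractionSequence L Ω where
  d_d : ∀ (k : ℕ) (w : Ω k), d (k + 1) (d k w) = 0
  i_i : ∀ (k : ℕ) (a b : L) (w : Ω (k + 2)), i k a (i (k + 1) b w) + i k b (i (k + 1) a w) = 0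
  lie_i : ∀ (k : ℕ) (a b : L) (w : Ω (k + 1)),
    toContractionSequence.lie a k (i k b w) - i k b (toContractionSequence.lie a (k + 1) w) =
      i k ⁅a, b⁆ w

/-- The structure of a Gerstenhaber algebra on a graded algebra `A = ⨁_k 𝒜_k` over `ℝ`: the
product is graded commutative, and there is a bilinear bracket of degree `-1` which is a graded Lie
bracket for the degrees shifted by one, and which is a graded derivation of the product. The signs `(-1)^((p+1)*(q+1))` and `(-1)^((p+1)*q)` are the usual `(-1)^((p-1)(q-1))` and
`(-1)^((p-1)q)`. -/
structure GerstenhaberAlgebra (A : Type*) [Ring A] [Algebra ℝ A] (𝒜 : ℕ → Submodule ℝ A)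
    [GradedAlgebra 𝒜] where
  bracket : A →ₗ[ℝ] A →ₗ[ℝ] A
  mul_comm : ∀ (p q : ℕ), ∀ a ∈ 𝒜 p, ∀ b ∈ 𝒜 q, a * b = (-1 : ℝ) ^ (p * q) • (b * a)
  bracket_mem : ∀ (p q r : ℕ), p + q = r + 1 → ∀ a ∈ 𝒜 p, ∀ b ∈ 𝒜 q, bracket a b ∈ 𝒜 r
  bracket_zero : ∀ a ∈ 𝒜 0, ∀ b ∈ 𝒜 0, bracket a b = 0
  skew : ∀ (p q : ℕ), ∀ a ∈ 𝒜 p, ∀ b ∈ 𝒜 q,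
    bracket a b = -((-1 : ℝ) ^ ((p + 1) * (q + 1)) • bracket b a)
  jacobi : ∀ (p q : ℕ), ∀ a ∈ 𝒜 p, ∀ b ∈ 𝒜 q, ∀ c : A,
    bracket a (bracket b c) =
      bracket (bracket a b) c + (-1 : ℝ) ^ ((p + 1) * (q + 1)) • bracket b (bracket a c)
  leibniz : ∀ (p q : ℕ), ∀ a ∈ 𝒜 p, ∀ b ∈ 𝒜 q, ∀ c : A,
    bracket a (b * c) = bracket a b * c + (-1 : ℝ) ^ ((p + 1) * q) • (b * bracket a c)

end Soldered

end

set_option linter.unusedSectionVars false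

noncomputable section

namespace Soldered

section

/-! ### Contractions in the exterior algebra -/

section ExteriorContraction

open CliffordAlgebra (contractLeft contractRight involute)

variable {V W : Type*} [AddCommGroup V] [Module ℝ V] [AddCommGroup W] [Module ℝ W]

/-! Along `N`, let p be the projection of TM onto TN with kernel νN. Call a multivector field R
vanishing (`IsVanishing`) if ⋀p kills R at every point of `N`. In degree k this means vanishing on
⋀^k ann(νN) (`map_projection_eq_zero_iff`), and since ⋀p is an algebra map, the vanishing fields
form an ideal for the wedge product.

The multivector part rests on a reformulation of soldering: Q is soldered iff [G, Q] is vanishing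
for every G that is either a function equal to zero on `N` or a normal vector field
(`isSolderedMulti_iff_vanishing`). Indeed [f, Q] = -df ⌋ Q, and at a point of `N` the differentials
of such functions exhaust ann(TN), which gives condition (i) by biduality; and [X, Q] = L_X Q gives
condition (ii). Closure under the wedge product is then the Leibniz rule. Closure under the bracket
is the Jacobi identity combined with one more fact: the bracket of a vanishing R with a soldered Q
is vanishing (`IsVanishing.schouten`). That fact is a computation in a single chart
(`map_flatSchouten_eq_zero`) with a smooth field K of idempotents that extends p off `N`; K is built
from local frames of TN ⊕ νN and a local retraction onto `N`.

The bracket on the manifold is defined at x through the chart at x, so its independence of the chart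
(`flatSchouten_map`) must be known before it can be iterated; it holds because second derivatives of
the transition maps are symmetric. Leibniz rule and skew symmetry are checked term by term. The
Jacobi identity comes from the divergence Δ = ∑ dxⁱ ⌋ ∂ᵢ: it satisfies Δ² = 0, and the bracket is,
up to sign, the failure of Δ to be a derivation, from which Jacobi follows formally
(`generatedBracket_jacobi`).

Functions and vector fields sit in degrees 0 and 1, compatibly with the Lie bracket and the action,
so the main Lie–Rinehart identities are cases of the Gerstenhaber ones. For forms, ι^* commutes with
d; hence, once ι^* i(X)κ = 0, the other condition reads ι^* i(X)dκ = 0 (`pullback_formI_formD`),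
which gives stability under d. A soldered Y is tangent to `N`, and [X, Y] is normal for every normal
X, so [L_X, i(Y)] = i([X, Y]) gives stability under i(Y) (`formI_mem_solderedForms`). -/

theorem exterior_induction {P : ExteriorAlgebra ℝ V → Prop}
    (scalar : ∀ r, P (algebraMap ℝ _ r)) (add : ∀ x y, P x → P y → P (x + y))
    (ι_mul : ∀ v x, P x → P (ExteriorAlgebra.ι ℝ v * x)) (x : ExteriorAlgebra ℝ V) : P x := by
  induction x using CliffordAlgebra.left_induction with
  | algebraMap r => exact scalar r
  | add x y hx hy => exact add x y hx hy
  | ι_mul x v h => exact ι_mul v x h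

theorem exteriorPower_zero_eq : ⋀[ℝ]^0 V = 1 := pow_zero _

theorem exteriorPower_one_eq : ⋀[ℝ]^1 V = LinearMap.range (ExteriorAlgebra.ι ℝ) := pow_one _

theorem ι_mem_exteriorPower (v : V) : ExteriorAlgebra.ι ℝ v ∈ ⋀[ℝ]^1 V := by
  rw [exteriorPower_one_eq]; exact ⟨v, rfl⟩

theorem mul_mem_exteriorPower {k l : ℕ} {x y : ExteriorAlgebra ℝ V} (hx : x ∈ ⋀[ℝ]^k V)
    (hy : y ∈ ⋀[ℝ]^l V) : x * y ∈ ⋀[ℝ]^(k + l) V :=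
  SetLike.mul_mem_graded hx hy

theorem algebraMap_mem_exteriorPower (r : ℝ) :
    algebraMap ℝ (ExteriorAlgebra ℝ V) r ∈ ⋀[ℝ]^0 V := by
  rw [exteriorPower_zero_eq]; exact Submodule.algebraMap_mem r

theorem exists_algebraMap_of_mem_zero {x : ExteriorAlgebra ℝ V} (hx : x ∈ ⋀[ℝ]^0 V) :
    ∃ r, x = algebraMap ℝ _ r := by
  rw [exteriorPower_zero_eq] at hx
  obtain ⟨r, rfl⟩ := Submodule.mem_one.1 hx
  exact ⟨r, rfl⟩

theorem exists_ι_of_mem_one {x : ExteriorAlgebra ℝ V} (hx : x ∈ ⋀[ℝ]^1 V) :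
    ∃ v, x = ExteriorAlgebra.ι ℝ v := by
  rw [exteriorPower_one_eq] at hx
  obtain ⟨r, rfl⟩ := hx
  exact ⟨r, rfl⟩

theorem exteriorPower_induction {P : (k : ℕ) → (x : ExteriorAlgebra ℝ V) → x ∈ ⋀[ℝ]^k V → Prop}
    (scalar : ∀ r, P 0 (algebraMap ℝ _ r) (algebraMap_mem_exteriorPower r))
    (add : ∀ k x y hx hy, P k x hx → P k y hy → P k (x + y) (Submodule.add_mem _ hx hy))
    (ι_mul : ∀ k v x hx h, P k x hx → P (k + 1) (ExteriorAlgebra.ι ℝ v * x) h)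
    {k : ℕ} {x : ExteriorAlgebra ℝ V} (hx : x ∈ ⋀[ℝ]^k V) : P k x hx := by
  induction hx using Submodule.pow_induction_on_left' with
  | algebraMap r => exact scalar r
  | add x y i hx hy h h' => exact add i x y hx hy h h'
  | mem_mul m hm i x hx h =>
    obtain ⟨v, rfl⟩ := hm
    exact ι_mul i v x hx _ h

theorem map_mem_exteriorPower (f : V →ₗ[ℝ] W) {k : ℕ} {x : ExteriorAlgebra ℝ V}
    (hx : x ∈ ⋀[ℝ]^k V) : ExteriorAlgebra.map f x ∈ ⋀[ℝ]^k W := by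
  induction hx using exteriorPower_induction with
  | scalar r => rw [AlgHom.commutes]; exact algebraMap_mem_exteriorPower r
  | add k x y _ _ hx hy => rw [map_add]; exact Submodule.add_mem _ hx hy
  | ι_mul k v x _ _ h =>
    rw [map_mul, ExteriorAlgebra.map_apply_ι, add_comm]
    exact mul_mem_exteriorPower (ι_mem_exteriorPower _) h

theorem contractLeft_ι_mul' (α : Module.Dual ℝ V) (v : V) (x : ExteriorAlgebra ℝ V) :
    contractLeft α (ExteriorAlgebra.ι ℝ v * x) =
      α v • x - ExteriorAlgebra.ι ℝ v * contractLeft α x :=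
  CliffordAlgebra.contractLeft_ι_mul α v x

theorem involute_ι' (v : V) :
    involute (ExteriorAlgebra.ι ℝ v) = -ExteriorAlgebra.ι ℝ v :=
  CliffordAlgebra.involute_ι v

/-- Contraction by a covector is an antiderivation; the grade involution carries the sign, so `x`
need not be homogeneous. -/
theorem contractLeft_mul (α : Module.Dual ℝ V) (x y : ExteriorAlgebra ℝ V) :
    contractLeft α (x * y) = contractLeft α x * y + involute x * contractLeft α y := by
  induction x using exterior_induction with
  | scalar r =>
    rw [CliffordAlgebra.contractLeft_algebraMap_mul, CliffordAlgebra.contractLeft_algebraMap,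
      AlgHom.commutes, zero_mul, zero_add]
  | add x x' h h' => simp only [add_mul, map_add, h, h']; abel
  | ι_mul v x h =>
    rw [mul_assoc, contractLeft_ι_mul', contractLeft_ι_mul', h, map_mul, involute_ι']
    simp only [mul_add, sub_mul, smul_mul_assoc, mul_assoc, neg_mul]
    abel

/-- The two contractions obey mirrored product rules, and the involution absorbs the difference in
sign. This lets right contractions be handled through left ones. -/
theorem contractRight_eq_involute (α : Module.Dual ℝ V) (x : ExteriorAlgebra ℝ V) :
    contractRight x α = involute (contractLeft α x) := by
  induction x using CliffordAlgebra.right_induction with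
  | algebraMap r => simp
  | add x x' h h' => simp only [map_add, LinearMap.add_apply, h, h']
  | mul_ι v x h =>
    rw [CliffordAlgebra.contractRight_mul_ι, contractLeft_mul, h, map_add, map_mul, map_mul,
      CliffordAlgebra.involute_ι, CliffordAlgebra.contractLeft_ι, AlgHom.commutes,
      CliffordAlgebra.involute_involute, ← Algebra.commutes, ← Algebra.smul_def, mul_neg]
    abel

theorem involute_of_mem {k : ℕ} {x : ExteriorAlgebra ℝ V} (hx : x ∈ ⋀[ℝ]^k V) :
    involute x = (-1 : ℝ) ^ k • x := by
  induction hx using exteriorPower_induction with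
  | scalar r => simp
  | add k x y _ _ hx hy => rw [map_add, hx, hy, smul_add]
  | ι_mul k v x _ _ h =>
    rw [map_mul, involute_ι', h, pow_succ, mul_smul_comm]
    simp

theorem contractLeft_of_mem_zero (α : Module.Dual ℝ V) {x : ExteriorAlgebra ℝ V}
    (hx : x ∈ ⋀[ℝ]^0 V) : contractLeft α x = 0 := by
  obtain ⟨r, rfl⟩ := exists_algebraMap_of_mem_zero hx
  exact CliffordAlgebra.contractLeft_algebraMap _ _ _

theorem contractLeft_mem (α : Module.Dual ℝ V) {k : ℕ} {x : ExteriorAlgebra ℝ V}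
    (hx : x ∈ ⋀[ℝ]^(k + 1) V) : contractLeft α x ∈ ⋀[ℝ]^k V := by
  -- The degree is freed from the shape `k + 1`, which the induction on the exterior power cannot
  -- use.
  suffices H : ∀ n x, x ∈ ⋀[ℝ]^n V → ∀ k, n = k + 1 → contractLeft α x ∈ ⋀[ℝ]^k V from
    H _ x hx _ rfl
  clear hx
  intro n x hn
  induction hn using exteriorPower_induction with
  | scalar r => intro k hk; omega
  | add n x y _ _ hx hy =>
    intro k hk; rw [map_add]; exact Submodule.add_mem _ (hx k hk) (hy k hk)
  | ι_mul n v x hx _ h =>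
    intro k hk
    obtain rfl : n = k := by omega
    rw [contractLeft_ι_mul']
    refine Submodule.sub_mem _ (Submodule.smul_mem _ _ hx) ?_
    cases n with
    | zero => rw [contractLeft_of_mem_zero α hx, mul_zero]; exact Submodule.zero_mem _
    | succ n =>
      rw [add_comm]
      exact mul_mem_exteriorPower (ι_mem_exteriorPower v) (h n rfl)

/-- The exponent `k + 1` stands for k - 1 without truncated subtraction; in degree zero both
contractions are zero and the sign is irrelevant. -/
theorem contractRight_of_mem (α : Module.Dual ℝ V) {k : ℕ} {x : ExteriorAlgebra ℝ V}
    (hx : x ∈ ⋀[ℝ]^k V) : contractRight x α = (-1 : ℝ) ^ (k + 1) • contractLeft α x := by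
  rw [contractRight_eq_involute]
  cases k with
  | zero => rw [contractLeft_of_mem_zero α hx, map_zero, smul_zero]
  | succ k => rw [involute_of_mem (contractLeft_mem α hx), pow_succ, pow_succ]; simp

theorem mul_ι_eq (x : ExteriorAlgebra ℝ V) (v : V) :
    x * ExteriorAlgebra.ι ℝ v = ExteriorAlgebra.ι ℝ v * involute x := by
  induction x using exterior_induction with
  | scalar r => rw [AlgHom.commutes, Algebra.commutes]
  | add x y hx hy => rw [add_mul, hx, hy, map_add, mul_add]
  | ι_mul w x h =>
    rw [mul_assoc, h, map_mul, involute_ι', ← mul_assoc, ← mul_assoc,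
      eq_neg_of_add_eq_zero_left (ExteriorAlgebra.ι_add_mul_swap w v)]
    simp

theorem mul_comm_of_mem {k l : ℕ} {x y : ExteriorAlgebra ℝ V} (hx : x ∈ ⋀[ℝ]^k V)
    (hy : y ∈ ⋀[ℝ]^l V) : x * y = (-1 : ℝ) ^ (k * l) • (y * x) := by
  induction hx using exteriorPower_induction with
  | scalar r => rw [Algebra.commutes]; simp
  | add k x x' _ _ h h' => rw [add_mul, h, h', mul_add, smul_add]
  | ι_mul k v x hx _ h =>
    have h2 : y * ExteriorAlgebra.ι ℝ v = (-1 : ℝ) ^ l • (ExteriorAlgebra.ι ℝ v * y) := by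
      rw [mul_ι_eq, involute_of_mem hy, mul_smul_comm]
    rw [mul_assoc, h, ← mul_assoc, h2, mul_smul_comm, smul_mul_assoc, smul_smul, add_mul, one_mul,
      pow_add, mul_assoc, mul_assoc, ← pow_add, Even.neg_one_pow ⟨l, rfl⟩, mul_one]

theorem contractLeft_map (f : V →ₗ[ℝ] W) (α : Module.Dual ℝ W) (x : ExteriorAlgebra ℝ V) :
    contractLeft α (ExteriorAlgebra.map f x) =
      ExteriorAlgebra.map f (contractLeft (α ∘ₗ f) x) := by
  induction x using exterior_induction with
  | scalar r => simp
  | add x x' h h' => simp only [map_add, h, h']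
  | ι_mul v x h =>
    rw [map_mul, ExteriorAlgebra.map_apply_ι, contractLeft_ι_mul', contractLeft_ι_mul', h,
      map_sub, map_smul, map_mul, ExteriorAlgebra.map_apply_ι]
    rfl

theorem involute_map (f : V →ₗ[ℝ] W) (x : ExteriorAlgebra ℝ V) :
    involute (ExteriorAlgebra.map f x) = ExteriorAlgebra.map f (involute x) := by
  induction x using exterior_induction with
  | scalar r => simp
  | add x x' h h' => simp only [map_add, h, h']
  | ι_mul v x h => simp only [map_mul, ExteriorAlgebra.map_apply_ι, involute_ι', h, map_neg]

theorem contractRight_map (f : V →ₗ[ℝ] W) (α : Module.Dual ℝ W) (x : ExteriorAlgebra ℝ V) :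
    contractRight (ExteriorAlgebra.map f x) α =
      ExteriorAlgebra.map f (contractRight x (α ∘ₗ f)) := by
  rw [contractRight_eq_involute, contractRight_eq_involute, contractLeft_map, involute_map]

theorem map_map_apply {U : Type*} [AddCommGroup U] [Module ℝ U] (f : V →ₗ[ℝ] W)
    (g : W →ₗ[ℝ] U) (x : ExteriorAlgebra ℝ V) :
    ExteriorAlgebra.map g (ExteriorAlgebra.map f x) = ExteriorAlgebra.map (g ∘ₗ f) x :=
  congrArg (fun h => h x) (ExteriorAlgebra.map_comp_map f g)

theorem map_id_apply (x : ExteriorAlgebra ℝ V) : ExteriorAlgebra.map LinearMap.id x = x :=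
  congrArg (fun h => h x) ExteriorAlgebra.map_id

end ExteriorContraction

/-! ### The extension of an endomorphism to a derivation of the exterior algebra -/

section ExteriorDerivation

open CliffordAlgebra (contractLeft contractRight involute)

variable {V : Type*} [AddCommGroup V] [Module ℝ V] {n : Type*} [Fintype n]

/-- The tensor ∑ bⁱ ⊗ bᵢ represents the identity of `V`, so an endomorphism can be moved from one
factor to the other. This serves both for changing coordinates in the bracket and for shifting the
projection p between its factors. -/
theorem sum_coord_comp {G : Type*} [AddCommGroup G] [Module ℝ G] (b : Module.Basis n ℝ V)
    (f : Module.Dual ℝ V →ₗ[ℝ] V →ₗ[ℝ] G) (A : V →ₗ[ℝ] V) :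
    ∑ i, f (b.coord i ∘ₗ A) (b i) = ∑ i, f (b.coord i) (A (b i)) := by
  classical
  have h1 : ∀ i, b.coord i ∘ₗ A = ∑ j, b.coord i (A (b j)) • b.coord j := fun i => by
    refine b.ext fun k => ?_
    simp [Finsupp.single_apply]
  have h2 : ∀ i, A (b i) = ∑ j, b.coord j (A (b i)) • b j := fun i => by
    simp
  calc ∑ i, f (b.coord i ∘ₗ A) (b i)
      = ∑ i, ∑ j, b.coord i (A (b j)) • f (b.coord j) (b i) := by
        refine Finset.sum_congr rfl fun i _ => ?_
        conv_lhs => rw [h1 i]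
        simp only [map_sum, map_smul, LinearMap.sum_apply, LinearMap.smul_apply]
    _ = ∑ j, ∑ i, b.coord i (A (b j)) • f (b.coord j) (b i) := Finset.sum_comm
    _ = ∑ j, f (b.coord j) (A (b j)) := by
        refine Finset.sum_congr rfl fun j _ => ?_
        conv_rhs => rw [h2 j]
        simp only [map_sum, map_smul]

/-- The derivation of degree zero of `⋀ V` which extends the endomorphism `B` of `V`. -/
def extDer (b : Module.Basis n ℝ V) (B : V →ₗ[ℝ] V) (x : ExteriorAlgebra ℝ V) :
    ExteriorAlgebra ℝ V :=
  ∑ i, ExteriorAlgebra.ι ℝ (B (b i)) * contractLeft (b.coord i) x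

variable (b : Module.Basis n ℝ V) (B : V →ₗ[ℝ] V)

theorem extDer_add (x y : ExteriorAlgebra ℝ V) :
    extDer b B (x + y) = extDer b B x + extDer b B y := by
  simp only [extDer, map_add, mul_add, Finset.sum_add_distrib]

theorem extDer_algebraMap (r : ℝ) : extDer b B (algebraMap ℝ _ r) = 0 := by
  simp [extDer]

theorem extDer_ι_mul (v : V) (x : ExteriorAlgebra ℝ V) :
    extDer b B (ExteriorAlgebra.ι ℝ v * x) =
      ExteriorAlgebra.ι ℝ (B v) * x + ExteriorAlgebra.ι ℝ v * extDer b B x := by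
  have hv : B v = ∑ i, b.coord i v • B (b i) := by
    conv_lhs => rw [← b.sum_repr v]
    simp only [map_sum, map_smul, Module.Basis.coord_apply]
  simp only [extDer, contractLeft_ι_mul', mul_sub, Finset.sum_sub_distrib, hv, map_sum, map_smul,
    Finset.sum_mul, Finset.mul_sum, mul_smul_comm, smul_mul_assoc]
  rw [sub_eq_add_neg, ← Finset.sum_neg_distrib]
  congr 1
  refine Finset.sum_congr rfl fun i _ => ?_
  rw [← mul_assoc, ← mul_assoc, eq_neg_of_add_eq_zero_left (ExteriorAlgebra.ι_add_mul_swap v _),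
    neg_mul]

theorem extDer_id_of_mem {k : ℕ} {x : ExteriorAlgebra ℝ V} (hx : x ∈ ⋀[ℝ]^k V) :
    extDer b LinearMap.id x = (k : ℝ) • x := by
  induction hx using exteriorPower_induction with
  | scalar r => rw [extDer_algebraMap]; simp
  | add k x y _ _ hx hy => rw [extDer_add, hx, hy, smul_add]
  | ι_mul k v x _ _ h =>
    rw [extDer_ι_mul, h, Nat.cast_succ, add_smul, one_smul, mul_smul_comm, add_comm]
    rfl

/-- By Euler's identity `extDer_id_of_mem`, the sum ∑ bᵢ ∧ (bⁱ ⌋ x) is the degree times `x`, and the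
degree is a nonzero real number. -/
theorem eq_zero_of_contractLeft_eq_zero [FiniteDimensional ℝ V] {k : ℕ} {x : ExteriorAlgebra ℝ V}
    (hx : x ∈ ⋀[ℝ]^(k + 1) V) (h : ∀ α : Module.Dual ℝ V, contractLeft α x = 0) : x = 0 := by
  have h1 := extDer_id_of_mem (Module.finBasis ℝ V) hx
  simp only [extDer, h, mul_zero, Finset.sum_const_zero] at h1
  refine (smul_eq_zero.1 h1.symm).resolve_left ?_
  positivity

end ExteriorDerivation

/-! ### Multivectors and a projection -/

section Projection

open CliffordAlgebra (contractLeft contractRight involute)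

variable {V : Type*} [AddCommGroup V] [Module ℝ V] [FiniteDimensional ℝ V]

/-- `⋀^l` of the annihilator of a subspace `ν` of `V`, as a subspace of `⋀ V^*`. -/
def annPow (ν : Submodule ℝ V) (l : ℕ) : Submodule ℝ (ExteriorAlgebra ℝ (Module.Dual ℝ V)) :=
  (⋀[ℝ]^l ν.dualAnnihilator).map (ExteriorAlgebra.map ν.dualAnnihilator.subtype).toLinearMap

theorem one_mem_annPow (ν : Submodule ℝ V) : 1 ∈ annPow ν 0 :=
  ⟨1, by rw [exteriorPower_zero_eq]; exact Submodule.one_le.1 le_rfl, by simp⟩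

theorem algebraMap_mem_annPow (ν : Submodule ℝ V) (r : ℝ) : algebraMap ℝ _ r ∈ annPow ν 0 := by
  rw [Algebra.algebraMap_eq_smul_one]; exact Submodule.smul_mem _ _ (one_mem_annPow ν)

theorem mul_ι_mem_annPow {ν : Submodule ℝ V} {α : Module.Dual ℝ V} (hα : α ∈ ν.dualAnnihilator)
    {l : ℕ} {a : ExteriorAlgebra ℝ (Module.Dual ℝ V)} (ha : a ∈ annPow ν l) :
    a * ExteriorAlgebra.ι ℝ α ∈ annPow ν (l + 1) := by
  obtain ⟨a, ha, rfl⟩ := ha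
  refine ⟨a * ExteriorAlgebra.ι ℝ ⟨α, hα⟩, mul_mem_exteriorPower ha (ι_mem_exteriorPower _), ?_⟩
  rw [AlgHom.toLinearMap_apply, map_mul, ExteriorAlgebra.map_apply_ι]; rfl

/-- Elements of `annPow ν l` are images of ⋀^l of the annihilator, and the induction runs on a
preimage; the covectors split off thus stay in the annihilator. -/
theorem annPow_induction {ν : Submodule ℝ V}
    {P : (l : ℕ) → (a : ExteriorAlgebra ℝ (Module.Dual ℝ V)) → a ∈ annPow ν l → Prop}
    (scalar : ∀ r, P 0 (algebraMap ℝ _ r) (algebraMap_mem_annPow ν r))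
    (add : ∀ k x y hx hy, P k x hx → P k y hy → P k (x + y) (Submodule.add_mem _ hx hy))
    (ι_mul : ∀ k, ∀ α ∈ ν.dualAnnihilator, ∀ a ha h, P k a ha →
      P (k + 1) (ExteriorAlgebra.ι ℝ α * a) h)
    {l : ℕ} {a : ExteriorAlgebra ℝ (Module.Dual ℝ V)} (ha : a ∈ annPow ν l) : P l a ha := by
  have hι : ∀ k, ∀ α ∈ ν.dualAnnihilator, ∀ a ∈ annPow ν k,
      ExteriorAlgebra.ι ℝ α * a ∈ annPow ν (k + 1) := by
    rintro k α hα _ ⟨a, ha, rfl⟩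
    refine ⟨ExteriorAlgebra.ι ℝ ⟨α, hα⟩ * a, ?_, ?_⟩
    · rw [add_comm]; exact mul_mem_exteriorPower (ι_mem_exteriorPower _) ha
    · rw [AlgHom.toLinearMap_apply, map_mul, ExteriorAlgebra.map_apply_ι]; rfl
  -- The motive mentions the membership proof, so that proof is carried along existentially.
  suffices H : ∀ b, b ∈ ⋀[ℝ]^l ν.dualAnnihilator →
      ∃ h, P l (ExteriorAlgebra.map ν.dualAnnihilator.subtype b) h by
    obtain ⟨b, hb, rfl⟩ := id ha
    exact (H b hb).2
  clear ha
  intro b hb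
  induction hb using exteriorPower_induction with
  | scalar r => rw [AlgHom.commutes]; exact ⟨_, scalar r⟩
  | add k x y _ _ hx hy =>
    rw [map_add]
    obtain ⟨hx, hx'⟩ := hx
    obtain ⟨hy, hy'⟩ := hy
    exact ⟨_, add k _ _ hx hy hx' hy'⟩
  | ι_mul k α a ha hm h =>
    rw [map_mul, ExteriorAlgebra.map_apply_ι]
    obtain ⟨h, h'⟩ := h
    exact ⟨_, ι_mul k _ α.2 _ h (hι k _ α.2 _ h) h'⟩

theorem multiContract_ι (α : Module.Dual ℝ V) :
    multiContract (ExteriorAlgebra.ι ℝ α) = contractLeft (Q := (0 : QuadraticForm ℝ V)) α := by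
  simp only [multiContract]
  exact ExteriorAlgebra.lift_ι_apply _ _ _ _

theorem multiContract_ι_mul (α : Module.Dual ℝ V) (a : ExteriorAlgebra ℝ (Module.Dual ℝ V))
    (x : ExteriorAlgebra ℝ V) :
    multiContract (ExteriorAlgebra.ι ℝ α * a) x = contractLeft α (multiContract a x) := by
  rw [map_mul, multiContract_ι]; rfl

theorem multiContract_mul_ι (α : Module.Dual ℝ V) (a : ExteriorAlgebra ℝ (Module.Dual ℝ V))
    (x : ExteriorAlgebra ℝ V) :
    multiContract (a * ExteriorAlgebra.ι ℝ α) x = multiContract a (contractLeft α x) := by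
  rw [map_mul, multiContract_ι]; rfl

theorem multiContract_algebraMap (r : ℝ) (x : ExteriorAlgebra ℝ V) :
    multiContract (algebraMap ℝ (ExteriorAlgebra ℝ (Module.Dual ℝ V)) r) x = r • x := by
  rw [AlgHom.commutes, Module.algebraMap_end_apply]

theorem multiContract_mem {ν : Submodule ℝ V} {l : ℕ}
    {a : ExteriorAlgebra ℝ (Module.Dual ℝ V)} (ha : a ∈ annPow ν l) {k : ℕ}
    {x : ExteriorAlgebra ℝ V} (hx : x ∈ ⋀[ℝ]^(k + l) V) : multiContract a x ∈ ⋀[ℝ]^k V := by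
  induction ha using annPow_induction generalizing k with
  | scalar r => rw [multiContract_algebraMap]; exact Submodule.smul_mem _ _ hx
  | add l a a' _ _ h h' =>
    rw [map_add]; exact Submodule.add_mem _ (h hx) (h' hx)
  | ι_mul l α hα a ha _ h =>
    rw [multiContract_ι_mul]
    refine contractLeft_mem α (h ?_)
    rwa [add_assoc, add_comm 1 l]

/-- Contractions by covectors anticommute, and `a` is made of `l` of them. -/
theorem contractLeft_multiContract {ν : Submodule ℝ V} {l : ℕ}
    {a : ExteriorAlgebra ℝ (Module.Dual ℝ V)} (ha : a ∈ annPow ν l) (α : Module.Dual ℝ V)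
    (x : ExteriorAlgebra ℝ V) :
    contractLeft α (multiContract a x) = (-1 : ℝ) ^ l • multiContract a (contractLeft α x) := by
  induction ha using annPow_induction with
  | scalar r => simp only [multiContract_algebraMap, map_smul, pow_zero, one_smul]
  | add l a a' _ _ h h' => simp only [map_add, LinearMap.add_apply, h, h', smul_add]
  | ι_mul l β hβ a ha _ h =>
    rw [multiContract_ι_mul, multiContract_ι_mul, CliffordAlgebra.contractLeft_comm, h, map_smul,
      pow_succ, mul_neg_one, neg_smul]

variable {τ ν : Submodule ℝ V} {p : V →ₗ[ℝ] V} (hν : LinearMap.ker p = ν) (hp : IsIdempotentElem p)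

include hν hp in
-- The difference `v - p v` lies in the kernel `ν` of `p`, where `α` is zero.
theorem dual_comp_projection {α : Module.Dual ℝ V} (hα : α ∈ ν.dualAnnihilator) :
    α ∘ₗ p = α := by
  ext v
  have h1 : v - p v ∈ ν := by
    rw [← hν, LinearMap.mem_ker, map_sub, sub_eq_zero]
    exact (congrArg (fun f => f v) hp).symm
  have := (Submodule.mem_dualAnnihilator α).1 hα _ h1
  rw [map_sub, sub_eq_zero] at this
  exact this.symm

include hν in
theorem comp_projection_mem (α : Module.Dual ℝ V) : α ∘ₗ p ∈ ν.dualAnnihilator := by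
  rw [Submodule.mem_dualAnnihilator]
  intro v hv
  rw [← hν, LinearMap.mem_ker] at hv
  rw [LinearMap.comp_apply, hv, map_zero]

include hν hp in
theorem map_projection_contractLeft {α : Module.Dual ℝ V} (hα : α ∈ ν.dualAnnihilator)
    (x : ExteriorAlgebra ℝ V) :
    ExteriorAlgebra.map p (contractLeft α x) =
      contractLeft α (ExteriorAlgebra.map p x) := by
  rw [contractLeft_map, dual_comp_projection hν hp hα]

include hν hp in
theorem map_projection_multiContract {l : ℕ}
    {a : ExteriorAlgebra ℝ (Module.Dual ℝ V)} (ha : a ∈ annPow ν l) (x : ExteriorAlgebra ℝ V) :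
    ExteriorAlgebra.map p (multiContract a x) =
      multiContract a (ExteriorAlgebra.map p x) := by
  induction ha using annPow_induction with
  | scalar r => simp only [multiContract_algebraMap, map_smul]
  | add l a a' _ _ h h' => simp only [map_add, LinearMap.add_apply, h, h']
  | ι_mul l β hβ a ha _ h =>
    rw [multiContract_ι_mul, multiContract_ι_mul, map_projection_contractLeft hν hp hβ, h]

include hν hp in
-- Forward: contraction with `a` commutes with ⋀p and lands in degree zero, where ⋀p is the
-- identity. Backward, by induction on the degree: a multivector of positive degree is zero once all
-- its contractions are, and the contraction of ⋀p x by β is ⋀p applied to the contraction of `x` by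
-- β ∘ p, which annihilates `ν`.
theorem map_projection_eq_zero_iff {k : ℕ} {x : ExteriorAlgebra ℝ V} (hx : x ∈ ⋀[ℝ]^k V) :
    ExteriorAlgebra.map p x = 0 ↔ ∀ a ∈ annPow ν k, multiContract a x = 0 := by
  constructor
  · intro h0 a ha
    have h1 : multiContract a x ∈ ⋀[ℝ]^0 V := multiContract_mem ha (by rwa [zero_add])
    obtain ⟨r, hr⟩ := exists_algebraMap_of_mem_zero h1
    have h2 := map_projection_multiContract hν hp ha x
    rw [h0, map_zero, hr, AlgHom.commutes] at h2
    rw [hr, h2]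
  · intro h0
    induction k generalizing x with
    | zero => rw [show x = 0 by simpa using h0 1 (one_mem_annPow ν), map_zero]
    | succ k ih =>
      refine eq_zero_of_contractLeft_eq_zero (map_mem_exteriorPower _ hx) fun β => ?_
      rw [contractLeft_map]
      refine ih (contractLeft_mem _ hx) fun a ha => ?_
      rw [← multiContract_mul_ι]
      exact h0 _ (mul_ι_mem_annPow (comp_projection_mem hν β) ha)

include hν hp in
-- A vector lies in `τ` iff every `α` in the annihilator of `τ` kills it. Such an `α` commutes with
-- `a` up to sign, so the condition says that α ⌋ x vanishes on ⋀^l ann(ν), that is, that ⋀p kills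
-- it.
theorem multiContract_mem_ι_iff {l : ℕ} {x : ExteriorAlgebra ℝ V} (hx : x ∈ ⋀[ℝ]^(l + 1) V) :
    (∀ a ∈ annPow ν l, multiContract a x ∈ τ.map (ExteriorAlgebra.ι ℝ)) ↔
      ∀ α ∈ τ.dualAnnihilator, ExteriorAlgebra.map p (contractLeft α x) = 0 := by
  constructor
  · intro h0 α hα
    rw [map_projection_eq_zero_iff hν hp (contractLeft_mem α hx)]
    intro a ha
    obtain ⟨t, ht, h1⟩ := h0 a ha
    have h2 := contractLeft_multiContract ha α x
    rw [← h1, CliffordAlgebra.contractLeft_ι, (Submodule.mem_dualAnnihilator α).1 hα t ht,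
      map_zero] at h2
    exact (smul_eq_zero.1 h2.symm).resolve_left (by simp)
  · intro h0 a ha
    obtain ⟨v, hv⟩ := exists_ι_of_mem_one (multiContract_mem (k := 1) ha (by rwa [add_comm]))
    refine ⟨v, ?_, hv.symm⟩
    rw [SetLike.mem_coe, ← Subspace.dualAnnihilator_dualCoannihilator_eq (W := τ),
      Submodule.mem_dualCoannihilator]
    intro α hα
    have h1 := contractLeft_multiContract ha α x
    rw [(map_projection_eq_zero_iff hν hp (contractLeft_mem α hx)).1 (h0 α hα) a ha, hv, smul_zero,
      CliffordAlgebra.contractLeft_ι] at h1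
    simpa using h1

end Projection

end

section

/-! ### Calculus of functions with values in the exterior algebra -/

section ExteriorCalculus

open CliffordAlgebra (contractLeft contractRight involute)

variable {E : Type*} [NormedAddCommGroup E] [NormedSpace ℝ E] [FiniteDimensional ℝ E]

/-- A norm on the exterior algebra of a finite dimensional vector space. -/
@[reducible] def extNormedAddCommGroup : NormedAddCommGroup (ExteriorAlgebra ℝ E) :=
  NormedAddCommGroup.induced (ExteriorAlgebra ℝ E) (Finset (Fin (Module.finrank ℝ E)) → ℝ)
    (Module.finBasis ℝ E).ExteriorAlgebra.equivFun
    (Module.finBasis ℝ E).ExteriorAlgebra.equivFun.injective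

attribute [local instance] extNormedAddCommGroup

/-- The exterior algebra as a normed space. -/
@[reducible] def extNormedSpace : NormedSpace ℝ (ExteriorAlgebra ℝ E) :=
  NormedSpace.induced ℝ (ExteriorAlgebra ℝ E) (Finset (Fin (Module.finrank ℝ E)) → ℝ)
    (Module.finBasis ℝ E).ExteriorAlgebra.equivFun

attribute [local instance] extNormedSpace

instance finiteDimensional_exteriorAlgebra : FiniteDimensional ℝ (ExteriorAlgebra ℝ E) :=
  (Module.finBasis ℝ E).ExteriorAlgebra.finiteDimensional_of_finite

/-- The product of the exterior algebra as a continuous bilinear map. -/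
def extMulL : ExteriorAlgebra ℝ E →L[ℝ] ExteriorAlgebra ℝ E →L[ℝ] ExteriorAlgebra ℝ E :=
  LinearMap.toContinuousLinearMap
    (LinearMap.toContinuousLinearMap.toLinearMap ∘ₗ LinearMap.mul ℝ (ExteriorAlgebra ℝ E))

variable {G : Type*} [NormedAddCommGroup G] [NormedSpace ℝ G]

/-- Smoothness of multivector fields is defined through linear functionals; expanding in a basis
shows that it is smoothness for the chosen norm, so that Fréchet calculus applies. -/
theorem contDiffAt_ext_iff {n : WithTop ℕ∞} {Q : G → ExteriorAlgebra ℝ E} {z : G} :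
    ContDiffAt ℝ n Q z ↔
      ∀ l : Module.Dual ℝ (ExteriorAlgebra ℝ E), ContDiffAt ℝ n (fun y => l (Q y)) z := by
  constructor
  · intro h l
    exact (LinearMap.toContinuousLinearMap l).contDiff.contDiffAt.comp z h
  · intro h
    have h1 : Q = fun y => ∑ I, (Module.finBasis ℝ E).ExteriorAlgebra.coord I (Q y) •
        (Module.finBasis ℝ E).ExteriorAlgebra I := by
      ext1 y
      conv_lhs => rw [← (Module.finBasis ℝ E).ExteriorAlgebra.sum_repr (Q y)]
      rfl
    rw [h1]
    exact ContDiffAt.sum fun I _ => (h _).smul contDiffAt_const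

theorem ext_contDiffAt_mul {n : WithTop ℕ∞} {P Q : G → ExteriorAlgebra ℝ E} {z : G}
    (hP : ContDiffAt ℝ n P z) (hQ : ContDiffAt ℝ n Q z) :
    ContDiffAt ℝ n (fun y => P y * Q y) z :=
  (extMulL.isBoundedBilinearMap.contDiff.contDiffAt).comp z (hP.prodMk hQ)

theorem ext_hasFDerivAt_mul {P Q : G → ExteriorAlgebra ℝ E} {z : G}
    {P' Q' : G →L[ℝ] ExteriorAlgebra ℝ E} (hP : HasFDerivAt P P' z) (hQ : HasFDerivAt Q Q' z) :
    HasFDerivAt (fun y => P y * Q y)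
      (extMulL.precompR G (P z) Q' + extMulL.precompL G P' (Q z)) z :=
  extMulL.hasFDerivAt_of_bilinear hP hQ

theorem ext_fderiv_mul {P Q : G → ExteriorAlgebra ℝ E} {z : G}
    (hP : DifferentiableAt ℝ P z) (hQ : DifferentiableAt ℝ Q z) (v : G) :
    fderiv ℝ (fun y => P y * Q y) z v = P z * fderiv ℝ Q z v + fderiv ℝ P z v * Q z := by
  rw [(ext_hasFDerivAt_mul hP.hasFDerivAt hQ.hasFDerivAt).fderiv]
  rfl

theorem fderiv_linear_comp {V : Type*} [NormedAddCommGroup V] [NormedSpace ℝ V]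
    (l : ExteriorAlgebra ℝ E →ₗ[ℝ] V) {Q : G → ExteriorAlgebra ℝ E} {z : G}
    (hQ : DifferentiableAt ℝ Q z) (v : G) :
    fderiv ℝ (fun y => l (Q y)) z v = l (fderiv ℝ Q z v) := by
  have := ((LinearMap.toContinuousLinearMap l).hasFDerivAt.comp z hQ.hasFDerivAt).fderiv
  exact congrArg (fun f => f v) this

theorem contDiffAt_linear_comp {V : Type*} [NormedAddCommGroup V] [NormedSpace ℝ V]
    {n : WithTop ℕ∞}
    (l : ExteriorAlgebra ℝ E →ₗ[ℝ] V) {Q : G → ExteriorAlgebra ℝ E} {z : G}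
    (hQ : ContDiffAt ℝ n Q z) : ContDiffAt ℝ n (fun y => l (Q y)) z :=
  (LinearMap.toContinuousLinearMap l).contDiff.contDiffAt.comp z hQ

theorem dirDeriv_eq {Q : E → ExteriorAlgebra ℝ E} {y : E} (hQ : DifferentiableAt ℝ Q y) (v : E) :
    dirDeriv Q y v = fderiv ℝ Q y v := by
  conv_rhs => rw [← (Module.finBasis ℝ E).ExteriorAlgebra.sum_repr (fderiv ℝ Q y v)]
  refine Finset.sum_congr rfl fun I _ => ?_
  congr 1
  exact fderiv_linear_comp ((Module.finBasis ℝ E).ExteriorAlgebra.coord I) hQ v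

/-- Functionals that vanish on `S` compose with `Q` to functions that are locally zero, and they
separate the points of the quotient by `S`. -/
theorem fderiv_mem_of_eventually_mem {S : Submodule ℝ (ExteriorAlgebra ℝ E)}
    {Q : G → ExteriorAlgebra ℝ E} {z : G} (hQ : ∀ᶠ y in 𝓝 z, Q y ∈ S) (v : G) :
    fderiv ℝ Q z v ∈ S := by
  by_cases hd : DifferentiableAt ℝ Q z
  · rw [← Submodule.Quotient.mk_eq_zero, ← Submodule.mkQ_apply,
      ← Module.forall_dual_apply_eq_zero_iff ℝ]
    intro l
    have h1 : (fun y => (l ∘ₗ S.mkQ) (Q y)) =ᶠ[𝓝 z] fun _ => 0 := by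
      filter_upwards [hQ] with y hy
      rw [LinearMap.comp_apply, Submodule.mkQ_apply, (Submodule.Quotient.mk_eq_zero S).2 hy,
        map_zero]
    have h2 := fderiv_linear_comp (l ∘ₗ S.mkQ) hd v
    rw [h1.fderiv_eq] at h2
    simpa using h2.symm
  -- Without differentiability the derivative is zero by convention.
  · rw [fderiv_zero_of_not_differentiableAt hd]
    exact S.zero_mem

/-! #### The induced map on the exterior algebra as a function of the linear map -/

/-- The derivative of `A ↦ ⋀ A` at `A` in the direction `B`. -/
def mapDer (A B : E →ₗ[ℝ] E) (x : ExteriorAlgebra ℝ E) : ExteriorAlgebra ℝ E :=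
  ∑ i, ExteriorAlgebra.ι ℝ (B (Module.finBasis ℝ E i)) *
    ExteriorAlgebra.map A (contractLeft ((Module.finBasis ℝ E).coord i) x)

/-- Moving the vector to the right costs an involution, which turns the left contraction into the
right one. Having both forms allows the second-derivative terms of the two factors of a bracket to
be compared. -/
theorem mapDer_eq_right (A B : E →ₗ[ℝ] E) (x : ExteriorAlgebra ℝ E) :
    mapDer A B x = ∑ i, ExteriorAlgebra.map A (contractRight x ((Module.finBasis ℝ E).coord i)) *
      ExteriorAlgebra.ι ℝ (B (Module.finBasis ℝ E i)) := by
  refine Finset.sum_congr rfl fun i _ => ?_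
  rw [contractRight_eq_involute, mul_ι_eq, involute_map, CliffordAlgebra.involute_involute]

theorem mapDer_algebraMap (A B : E →ₗ[ℝ] E) (r : ℝ) : mapDer A B (algebraMap ℝ _ r) = 0 := by
  simp [mapDer]

theorem mapDer_add (A B : E →ₗ[ℝ] E) (x y : ExteriorAlgebra ℝ E) :
    mapDer A B (x + y) = mapDer A B x + mapDer A B y := by
  simp only [mapDer, map_add, mul_add, Finset.sum_add_distrib]

theorem mapDer_ι_mul (A B : E →ₗ[ℝ] E) (v : E) (x : ExteriorAlgebra ℝ E) :
    mapDer A B (ExteriorAlgebra.ι ℝ v * x) =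
      ExteriorAlgebra.ι ℝ (A v) * mapDer A B x +
        ExteriorAlgebra.ι ℝ (B v) * ExteriorAlgebra.map A x := by
  have hv : B v = ∑ i, (Module.finBasis ℝ E).coord i v • B (Module.finBasis ℝ E i) := by
    conv_lhs => rw [← (Module.finBasis ℝ E).sum_repr v]
    simp only [map_sum, map_smul, Module.Basis.coord_apply]
  simp only [mapDer, contractLeft_ι_mul', map_sub, map_mul, ExteriorAlgebra.map_apply_ι, mul_sub,
    Finset.sum_sub_distrib, hv, map_sum, map_smul, Finset.sum_mul, Finset.mul_sum, mul_smul_comm,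
    smul_mul_assoc]
  rw [add_comm, sub_eq_add_neg, ← Finset.sum_neg_distrib]
  congr 1
  refine Finset.sum_congr rfl fun i _ => ?_
  rw [← mul_assoc, ← mul_assoc, eq_neg_of_add_eq_zero_left (ExteriorAlgebra.ι_add_mul_swap _ _),
    neg_mul, neg_neg]

/-- The linear inclusion of `E` into its exterior algebra, as a continuous linear map. -/
def extιL : E →L[ℝ] ExteriorAlgebra ℝ E := LinearMap.toContinuousLinearMap (ExteriorAlgebra.ι ℝ)

theorem contDiff_extMap (x : ExteriorAlgebra ℝ E) :
    ContDiff ℝ ∞ (fun A : E →L[ℝ] E => ExteriorAlgebra.map A.toLinearMap x) := by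
  induction x using exterior_induction with
  | scalar r => simp only [AlgHom.commutes]; exact contDiff_const
  | add x y hx hy => simp only [map_add]; exact hx.add hy
  | ι_mul v x h =>
    simp only [map_mul, ExteriorAlgebra.map_apply_ι]
    refine contDiff_iff_contDiffAt.2 fun A => ext_contDiffAt_mul ?_ h.contDiffAt
    exact (extιL.comp (ContinuousLinearMap.apply ℝ E v)).contDiff.contDiffAt

/-- Induction on `x`: both sides obey the same Leibniz rule under left multiplication by a vector
(`mapDer_ι_mul`). -/
theorem fderiv_extMap (x : ExteriorAlgebra ℝ E) (A B : E →L[ℝ] E) :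
    fderiv ℝ (fun A : E →L[ℝ] E => ExteriorAlgebra.map A.toLinearMap x) A B =
      mapDer A.toLinearMap B.toLinearMap x := by
  induction x using exterior_induction with
  | scalar r => simp only [AlgHom.commutes, mapDer_algebraMap]; simp
  | add x y hx hy =>
    simp only [map_add, mapDer_add]
    rw [← hx, ← hy]
    have := fderiv_fun_add (((contDiff_extMap x).differentiable (by simp)).differentiableAt (x := A))
      (((contDiff_extMap y).differentiable (by simp)).differentiableAt (x := A))
    exact congrArg (fun f => f B) this
  | ι_mul v x h =>
    simp only [map_mul, ExteriorAlgebra.map_apply_ι]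
    have h1 : HasFDerivAt (fun A : E →L[ℝ] E => ExteriorAlgebra.ι ℝ (A.toLinearMap v))
      (extιL.comp (ContinuousLinearMap.apply ℝ E v)) A :=
      (extιL.comp (ContinuousLinearMap.apply ℝ E v)).hasFDerivAt
    rw [ext_fderiv_mul h1.differentiableAt
      (((contDiff_extMap x).differentiable (by simp)).differentiableAt (x := A)), h, h1.fderiv,
      mapDer_ι_mul]
    rfl

/-- The algebra map `⋀ A`, as a continuous linear map. -/
def extMapL (A : E →L[ℝ] E) : ExteriorAlgebra ℝ E →L[ℝ] ExteriorAlgebra ℝ E :=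
  LinearMap.toContinuousLinearMap (ExteriorAlgebra.map A.toLinearMap).toLinearMap

theorem contDiff_extMapL : ContDiff ℝ ∞ (extMapL (E := E)) :=
  contDiff_clm_apply_iff.2 fun x => contDiff_extMap x

theorem contDiffAt_map {n : WithTop ℕ∞} (hn : n ≤ ∞) {A : G → E →L[ℝ] E}
    {Q : G → ExteriorAlgebra ℝ E} {z : G}
    (hA : ContDiffAt ℝ n A z) (hQ : ContDiffAt ℝ n Q z) :
    ContDiffAt ℝ n (fun y => ExteriorAlgebra.map (A y).toLinearMap (Q y)) z :=
  ((contDiff_extMapL.of_le hn).contDiffAt.comp z hA).clm_apply hQ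

/-- The `mapDer` term is the inhomogeneous part that appears when a multivector field is
differentiated after a nonlinear change of coordinates. -/
theorem fderiv_map {A : G → E →L[ℝ] E} {Q : G → ExteriorAlgebra ℝ E} {z : G}
    (hA : DifferentiableAt ℝ A z) (hQ : DifferentiableAt ℝ Q z) (v : G) :
    fderiv ℝ (fun y => ExteriorAlgebra.map (A y).toLinearMap (Q y)) z v =
      ExteriorAlgebra.map (A z).toLinearMap (fderiv ℝ Q z v) +
        mapDer (A z).toLinearMap (fderiv ℝ A z v).toLinearMap (Q z) := by
  have h1 : HasFDerivAt (extMapL (E := E)) (fderiv ℝ extMapL (A z)) (A z) :=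
    (contDiff_extMapL.differentiable (by simp)).differentiableAt.hasFDerivAt
  have h2 := ((h1.comp z hA.hasFDerivAt).clm_apply hQ.hasFDerivAt).fderiv
  have h3 : ∀ B x, fderiv ℝ (extMapL (E := E)) (A z) B x =
      mapDer (A z).toLinearMap B.toLinearMap x := fun B x => by
    rw [← fderiv_extMap]
    have := (h1.clm_apply (hasFDerivAt_const x (A z))).fderiv
    refine Eq.trans ?_ (congrArg (fun f => f B) this).symm
    simp
  refine (congrArg (fun f => f v) h2).trans ?_
  rw [← h3]
  rfl

end ExteriorCalculus

end

section

/-! ### The Schouten-Nijenhuis bracket on a vector space -/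

/-! ### The Jacobi identity for the bracket generated by an operator -/

section GeneratedBracket

variable {R : Type*} [Ring R] [Algebra ℝ R] (Δ : R →ₗ[ℝ] R)

/-- The bracket generated by an operator `Δ` on an algebra, for a first argument of sign `a`. -/
def generatedBracket (a : ℝ) (x y : R) : R := Δ (x * y) - Δ x * y - a • (x * Δ y)

theorem generatedBracket_neg_smul_right (a c : ℝ) (x y : R) :
    generatedBracket Δ a x (-(c • y)) = -(c • generatedBracket Δ a x y) := by
  simp only [generatedBracket, mul_neg, map_neg, mul_smul_comm, map_smul, smul_sub, smul_neg,
    smul_comm a c]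
  abel

theorem generatedBracket_neg_smul_left (a c : ℝ) (x y : R) :
    generatedBracket Δ a (-(c • x)) y = -(c • generatedBracket Δ a x y) := by
  simp only [generatedBracket, neg_mul, map_neg, smul_mul_assoc, map_smul, smul_sub, smul_neg,
    smul_comm a c]
  abel

theorem generatedBracket_zero_left (a : ℝ) (y : R) : generatedBracket Δ a 0 y = 0 := by
  simp [generatedBracket]

theorem generatedBracket_zero_right (a : ℝ) (x : R) : generatedBracket Δ a x 0 = 0 := by
  simp [generatedBracket]

variable {Δ}

/-- The signs stand for a = (-1)^p, b = (-1)^q and e = (-1)^(pq); degrees enter in no other way.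
This is the Batalin–Vilkovisky argument: given Δ² = 0, Jacobi follows from the product rule for the
bracket by `P` on products starting with `Q` or `Δ Q`, and for the bracket by `Δ P` on products
starting with `Q`. -/
theorem generatedBracket_jacobi (hΔ : ∀ x, Δ (Δ x) = 0) {a b e : ℝ}
    (ha : a = 1 ∨ a = -1) (hb : b = 1 ∨ b = -1) (he : e = 1 ∨ e = -1) {P Q : R}
    (h₁ : ∀ T, generatedBracket Δ a P (Q * T) = generatedBracket Δ a P Q * T +
      (e * b) • (Q * generatedBracket Δ a P T))
    (h₂ : ∀ T, generatedBracket Δ a P (Δ Q * T) = generatedBracket Δ a P (Δ Q) * T +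
      (-(a * e * b)) • (Δ Q * generatedBracket Δ a P T))
    (h₃ : ∀ T, generatedBracket Δ (-a) (Δ P) (Q * T) = generatedBracket Δ (-a) (Δ P) Q * T +
      e • (Q * generatedBracket Δ (-a) (Δ P) T)) (T : R) :
    generatedBracket Δ a P (generatedBracket Δ b Q T) =
      -(a • generatedBracket Δ (-(a * b)) (generatedBracket Δ a P Q) T) -
        (a * (e * b)) • generatedBracket Δ b Q (generatedBracket Δ a P T) := by
  -- Four instances suffice: Δ applied to the first rule at `T`, the same rule at `Δ T`, and the
  -- rules for `Δ Q` and `Δ P` at `T`.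
  have H₁ := congrArg Δ (h₁ T)
  have H₁' := h₁ (Δ T)
  have H₂ := h₂ T
  have H₃ := h₃ T
  clear h₁ h₂ h₃
  simp only [generatedBracket, mul_sub, sub_mul, mul_assoc, smul_mul_assoc, mul_smul_comm, map_sub, map_add,
    map_smul, hΔ, mul_zero, zero_mul] at *
  -- Once the signs are numbers, the identity is in each of the eight cases a combination of these
  -- instances with coefficients ±1.
  rcases ha with rfl | rfl <;> rcases hb with rfl | rfl <;> rcases he with rfl | rfl <;>
  norm_num only [one_smul, neg_smul, neg_neg, sub_neg_eq_add] at * 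
  · linear_combination (norm := module) -H₁ - H₃ - H₂ - H₁'
  · linear_combination (norm := module) -H₁ - H₃ - H₂ - H₁'
  · linear_combination (norm := module) -H₁ - H₃ - H₂ + H₁'
  · linear_combination (norm := module) -H₁ - H₃ - H₂ + H₁'
  · linear_combination (norm := module) H₁ + H₃ - H₂ - H₁'
  · linear_combination (norm := module) H₁ + H₃ - H₂ - H₁'
  · linear_combination (norm := module) H₁ + H₃ - H₂ + H₁'
  · linear_combination (norm := module) H₁ + H₃ - H₂ + H₁'

end GeneratedBracket

/-! ### The coordinate bracket: identities and invariance under diffeomorphisms -/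

section FlatSchouten

open CliffordAlgebra (contractLeft contractRight involute)

variable {E : Type*} [NormedAddCommGroup E] [NormedSpace ℝ E] [FiniteDimensional ℝ E]

attribute [local instance] extNormedAddCommGroup extNormedSpace

theorem involute_contractLeft {V : Type*} [AddCommGroup V] [Module ℝ V] (α : Module.Dual ℝ V)
    (x : ExteriorAlgebra ℝ V) : involute (contractLeft α x) = -contractLeft α (involute x) := by
  induction x using exterior_induction with
  | scalar r => simp
  | add x x' h h' => simp only [map_add, h, h']; abel
  | ι_mul v x h =>
    simp only [map_mul, involute_ι', contractLeft_ι_mul', map_sub, map_smul, h, neg_mul, map_neg]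
    simp

theorem flatSchouten_eq {P Q : E → ExteriorAlgebra ℝ E} {y : E} (hP : DifferentiableAt ℝ P y)
    (hQ : DifferentiableAt ℝ Q y) :
    flatSchouten P Q y =
      ∑ i, (contractRight (P y) ((Module.finBasis ℝ E).coord i) *
          fderiv ℝ Q y (Module.finBasis ℝ E i) -
        fderiv ℝ P y (Module.finBasis ℝ E i) *
          contractLeft ((Module.finBasis ℝ E).coord i) (Q y)) :=
  Finset.sum_congr rfl fun i _ => by rw [dirDeriv_eq hP, dirDeriv_eq hQ]

theorem dirDeriv_congr {P P' : E → ExteriorAlgebra ℝ E} {y : E} (h : P =ᶠ[𝓝 y] P') (v : E) :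
    dirDeriv P y v = dirDeriv P' y v := by
  refine Finset.sum_congr rfl fun I _ => ?_
  have : (fun z => (Module.finBasis ℝ E).ExteriorAlgebra.repr (P z) I) =ᶠ[𝓝 y]
      fun z => (Module.finBasis ℝ E).ExteriorAlgebra.repr (P' z) I := by
    filter_upwards [h] with z hz using by rw [hz]
  rw [this.fderiv_eq]

theorem flatSchouten_congr {P P' Q Q' : E → ExteriorAlgebra ℝ E} {y : E} (hP : P =ᶠ[𝓝 y] P')
    (hQ : Q =ᶠ[𝓝 y] Q') : flatSchouten P Q y = flatSchouten P' Q' y := by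
  refine Finset.sum_congr rfl fun i _ => ?_
  rw [dirDeriv_congr hP, dirDeriv_congr hQ, hP.eq_of_nhds, hQ.eq_of_nhds]

theorem flatSchouten_eventuallyEq {P P' Q Q' : E → ExteriorAlgebra ℝ E} {y : E}
    (hP : P =ᶠ[𝓝 y] P') (hQ : Q =ᶠ[𝓝 y] Q') :
    flatSchouten P Q =ᶠ[𝓝 y] flatSchouten P' Q' := by
  filter_upwards [hP.eventuallyEq_nhds, hQ.eventuallyEq_nhds] with z h h'
  exact flatSchouten_congr h h'

/-- Summand by summand, `Q` is moved past P ⌊ α, of degree p - 1, or past ∂P, of degree p; in the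
second case the antiderivation rule adds (-1)^q, so the sign is (-1)^((p+1)q) both times.
Homogeneity is needed near the point, for the derivatives to be homogeneous. -/
theorem flatSchouten_mul {P Q R : E → ExteriorAlgebra ℝ E} {y : E} {p q : ℕ}
    (hP : DifferentiableAt ℝ P y) (hQ : DifferentiableAt ℝ Q y) (hR : DifferentiableAt ℝ R y)
    (hp : ∀ᶠ z in 𝓝 y, P z ∈ ⋀[ℝ]^p E) (hq : ∀ᶠ z in 𝓝 y, Q z ∈ ⋀[ℝ]^q E) :
    flatSchouten P (fun z => Q z * R z) y =
      flatSchouten P Q y * R y + (-1 : ℝ) ^ ((p + 1) * q) • (Q y * flatSchouten P R y) := by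
  have hQR : DifferentiableAt ℝ (fun z => Q z * R z) y :=
    (ext_hasFDerivAt_mul hQ.hasFDerivAt hR.hasFDerivAt).differentiableAt
  rw [flatSchouten_eq hP hQR, flatSchouten_eq hP hQ, flatSchouten_eq hP hR]
  simp only [Finset.mul_sum, Finset.sum_mul, Finset.smul_sum, ← Finset.sum_add_distrib]
  refine Finset.sum_congr rfl fun i _ => ?_
  set α := (Module.finBasis ℝ E).coord i
  set v := Module.finBasis ℝ E i
  have h1 : contractRight (P y) α * Q y =
      (-1 : ℝ) ^ ((p + 1) * q) • (Q y * contractRight (P y) α) := by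
    rw [contractRight_of_mem α hp.self_of_nhds]
    cases p with
    | zero => rw [contractLeft_of_mem_zero α hp.self_of_nhds]; simp
    | succ p =>
      rw [smul_mul_assoc, mul_comm_of_mem (contractLeft_mem α hp.self_of_nhds) hq.self_of_nhds,
        mul_smul_comm, smul_smul, smul_smul]
      congr 1
      ring_nf
      simp
  have h2 : fderiv ℝ P y v * Q y = (-1 : ℝ) ^ (p * q) • (Q y * fderiv ℝ P y v) :=
    mul_comm_of_mem (fderiv_mem_of_eventually_mem hp v) hq.self_of_nhds
  rw [ext_fderiv_mul hQ hR, contractLeft_mul, involute_of_mem hq.self_of_nhds, mul_add, mul_add,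
    ← mul_assoc (contractRight (P y) α) (Q y), h1, smul_mul_assoc, smul_mul_assoc, mul_smul_comm,
    ← mul_assoc (fderiv ℝ P y v) (Q y), h2, smul_mul_assoc, smul_smul, ← pow_add, sub_mul, mul_sub,
    smul_sub, show q + p * q = (p + 1) * q by ring]
  simp only [mul_assoc]
  abel

/-- Up to the sign in `key`, the first half of [P, Q] is the second half of [Q, P], and conversely.
-/
theorem flatSchouten_skew {P Q : E → ExteriorAlgebra ℝ E} {y : E} {p q : ℕ}
    (hP : DifferentiableAt ℝ P y) (hQ : DifferentiableAt ℝ Q y)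
    (hp : ∀ᶠ z in 𝓝 y, P z ∈ ⋀[ℝ]^p E) (hq : ∀ᶠ z in 𝓝 y, Q z ∈ ⋀[ℝ]^q E) :
    flatSchouten P Q y = -((-1 : ℝ) ^ ((p + 1) * (q + 1)) • flatSchouten Q P y) := by
  have key : ∀ {P Q : E → ExteriorAlgebra ℝ E} {p q : ℕ}, (∀ᶠ z in 𝓝 y, P z ∈ ⋀[ℝ]^p E) →
      (∀ᶠ z in 𝓝 y, Q z ∈ ⋀[ℝ]^q E) → ∀ α v, contractRight (P y) α * fderiv ℝ Q y v =
        (-1 : ℝ) ^ ((p + 1) * (q + 1)) • (fderiv ℝ Q y v * contractLeft α (P y)) := by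
    intro P Q p q hp hq α v
    rw [contractRight_of_mem α hp.self_of_nhds]
    cases p with
    | zero => rw [contractLeft_of_mem_zero α hp.self_of_nhds]; simp
    | succ p =>
      rw [smul_mul_assoc, mul_comm_of_mem (contractLeft_mem α hp.self_of_nhds)
        (fderiv_mem_of_eventually_mem hq v), smul_smul]
      congr 1
      ring_nf
      simp
  rw [flatSchouten_eq hP hQ, flatSchouten_eq hQ hP, Finset.smul_sum, ← Finset.sum_neg_distrib]
  refine Finset.sum_congr rfl fun i _ => ?_
  rw [key hp hq, key hq hp, smul_sub, smul_smul, mul_comm (q + 1), ← mul_pow]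
  simp

theorem flatSchouten_mem {P Q : E → ExteriorAlgebra ℝ E} {y : E} {p q r : ℕ} (hr : p + q = r + 1)
    (hP : DifferentiableAt ℝ P y) (hQ : DifferentiableAt ℝ Q y)
    (hp : ∀ᶠ z in 𝓝 y, P z ∈ ⋀[ℝ]^p E) (hq : ∀ᶠ z in 𝓝 y, Q z ∈ ⋀[ℝ]^q E) :
    flatSchouten P Q y ∈ ⋀[ℝ]^r E := by
  rw [flatSchouten_eq hP hQ]
  refine Submodule.sum_mem _ fun i _ => Submodule.sub_mem _ ?_ ?_
  · rw [contractRight_of_mem _ hp.self_of_nhds, smul_mul_assoc]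
    refine Submodule.smul_mem _ _ ?_
    cases p with
    | zero =>
      rw [contractLeft_of_mem_zero _ hp.self_of_nhds, zero_mul]; exact Submodule.zero_mem _
    | succ p =>
      obtain rfl : p + q = r := by omega
      exact mul_mem_exteriorPower (contractLeft_mem _ hp.self_of_nhds)
        (fderiv_mem_of_eventually_mem hq _)
  · cases q with
    | zero =>
      rw [contractLeft_of_mem_zero _ hq.self_of_nhds, mul_zero]; exact Submodule.zero_mem _
    | succ q =>
      obtain rfl : p + q = r := by omega
      exact mul_mem_exteriorPower (fderiv_mem_of_eventually_mem hp _)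
        (contractLeft_mem _ hq.self_of_nhds)

theorem flatSchouten_zero_zero {P Q : E → ExteriorAlgebra ℝ E} {y : E}
    (hp : P y ∈ ⋀[ℝ]^0 E) (hq : Q y ∈ ⋀[ℝ]^0 E) : flatSchouten P Q y = 0 := by
  refine Finset.sum_eq_zero fun i _ => ?_
  rw [contractRight_of_mem _ hp, contractLeft_of_mem_zero _ hp, contractLeft_of_mem_zero _ hq,
    smul_zero, zero_mul, mul_zero, sub_zero]

theorem contDiffAt_flatSchouten {P Q : E → ExteriorAlgebra ℝ E} {y : E}
    (hP : ∀ᶠ z in 𝓝 y, ContDiffAt ℝ ∞ P z) (hQ : ∀ᶠ z in 𝓝 y, ContDiffAt ℝ ∞ Q z) :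
    ContDiffAt ℝ ∞ (flatSchouten P Q) y := by
  have h : flatSchouten P Q =ᶠ[𝓝 y] fun y =>
      ∑ i, (contractRight (P y) ((Module.finBasis ℝ E).coord i) *
          fderiv ℝ Q y (Module.finBasis ℝ E i) -
        fderiv ℝ P y (Module.finBasis ℝ E i) *
          contractLeft ((Module.finBasis ℝ E).coord i) (Q y)) := by
    filter_upwards [hP, hQ] with z h h'
    exact flatSchouten_eq (h.differentiableAt (by simp)) (h'.differentiableAt (by simp))
  refine ContDiffAt.congr_of_eventuallyEq ?_ h
  have hd : ∀ {P : E → ExteriorAlgebra ℝ E} (_ : ∀ᶠ z in 𝓝 y, ContDiffAt ℝ ∞ P z) (v : E),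
      ContDiffAt ℝ ∞ (fun z => fderiv ℝ P z v) y := fun h v =>
    (h.self_of_nhds.fderiv_right (m := ∞) (by simp)).clm_apply contDiffAt_const
  refine ContDiffAt.sum fun i _ => ContDiffAt.sub ?_ ?_
  · exact ext_contDiffAt_mul (contDiffAt_linear_comp
      (contractRight.flip ((Module.finBasis ℝ E).coord i)) hP.self_of_nhds) (hd hQ _)
  · exact ext_contDiffAt_mul (hd hP _) (contDiffAt_linear_comp
      (contractLeft ((Module.finBasis ℝ E).coord i)) hQ.self_of_nhds)

/-! #### The Jacobi identity -/

variable (E) in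
/-- The algebra of smooth multivector fields on a vector space. -/
def smoothExt : Subalgebra ℝ (E → ExteriorAlgebra ℝ E) where
  carrier := {f | ContDiff ℝ ∞ f}
  add_mem' {f g} (hf : ContDiff ℝ ∞ f) (hg : ContDiff ℝ ∞ g) := hf.add hg
  mul_mem' {f g} (hf : ContDiff ℝ ∞ f) (hg : ContDiff ℝ ∞ g) := contDiff_iff_contDiffAt.2 fun _ =>
    ext_contDiffAt_mul hf.contDiffAt hg.contDiffAt
  algebraMap_mem' r := (contDiff_const : ContDiff ℝ ∞ fun _ : E => algebraMap ℝ _ r)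

theorem smoothExt_contDiff (f : smoothExt E) : ContDiff ℝ ∞ f.1 := f.2

theorem smoothExt_diff (f : smoothExt E) : Differentiable ℝ f.1 :=
  (smoothExt_contDiff f).differentiable (by simp)

variable (E) in
/-- The divergence `∑ i, ∂_i (dx^i ⌋ f)` of smooth multivector fields. -/
def extDivergence : smoothExt E →ₗ[ℝ] smoothExt E where
  toFun f := ⟨fun y => ∑ i, contractLeft ((Module.finBasis ℝ E).coord i)
      (fderiv ℝ f.1 y (Module.finBasis ℝ E i)), by
    change ContDiff ℝ ∞ _
    refine ContDiff.sum fun i _ => contDiff_iff_contDiffAt.2 fun y => contDiffAt_linear_comp _ ?_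
    exact ((smoothExt_contDiff f).contDiffAt.fderiv_right (m := ∞) (by simp)).clm_apply
      contDiffAt_const⟩
  map_add' f g := by
    ext1; ext1 y
    change ∑ i : Fin (Module.finrank ℝ E), _ =
      (∑ i : Fin (Module.finrank ℝ E), _ : ExteriorAlgebra ℝ E) +
        ∑ i : Fin (Module.finrank ℝ E), _
    rw [← Finset.sum_add_distrib]
    refine Finset.sum_congr rfl fun i _ => ?_
    rw [← map_add]
    congr 1
    exact congrArg (fun f => f (Module.finBasis ℝ E i)) (fderiv_add (smoothExt_diff f y) (smoothExt_diff g y))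
  map_smul' c f := by
    ext1; ext1 y
    change ∑ i : Fin (Module.finrank ℝ E), _ =
      c • (∑ i : Fin (Module.finrank ℝ E), _ : ExteriorAlgebra ℝ E)
    rw [Finset.smul_sum]
    refine Finset.sum_congr rfl fun i _ => ?_
    rw [← map_smul]
    congr 1
    exact congrArg (fun f => f (Module.finBasis ℝ E i))
      (fderiv_const_smul (smoothExt_diff f y) c)

theorem extDivergence_apply (f : smoothExt E) (y : E) :
    (extDivergence E f).1 y = ∑ i, contractLeft ((Module.finBasis ℝ E).coord i)
      (fderiv ℝ f.1 y (Module.finBasis ℝ E i)) := rfl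

/-- Second derivatives are symmetric while contractions anticommute, so the double sum equals its
own negative. -/
theorem extDivergence_extDivergence (f : smoothExt E) :
    extDivergence E (extDivergence E f) = 0 := by
  ext1; ext1 y
  rw [extDivergence_apply]
  have hf : ContDiffAt ℝ ∞ f.1 y := (smoothExt_contDiff f).contDiffAt
  have hs : ∀ v w, fderiv ℝ (fderiv ℝ f.1) y v w = fderiv ℝ (fderiv ℝ f.1) y w v := fun v w =>
    (hf.isSymmSndFDerivAt (by simpa using WithTop.coe_le_coe.2 (le_top : (2 : ℕ∞) ≤ ⊤))) v w
  have hd : DifferentiableAt ℝ (fderiv ℝ f.1) y :=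
    (hf.fderiv_right (m := ∞) (by simp)).differentiableAt (by simp)
  have h1 : ∀ v, fderiv ℝ (extDivergence E f).1 y v =
      ∑ i, contractLeft ((Module.finBasis ℝ E).coord i)
        (fderiv ℝ (fderiv ℝ f.1) y v (Module.finBasis ℝ E i)) := fun v => by
    have h2 : ∀ w, HasFDerivAt (fun z => fderiv ℝ f.1 z w)
        ((fderiv ℝ (fderiv ℝ f.1) y).flip w) y := fun w => by
      simpa using hd.hasFDerivAt.clm_apply (hasFDerivAt_const w y)
    have h3 : (extDivergence E f).1 = fun z => ∑ i, contractLeft ((Module.finBasis ℝ E).coord i)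
      (fderiv ℝ f.1 z (Module.finBasis ℝ E i)) := rfl
    rw [h3, fderiv_fun_sum fun i _ => (contDiffAt_linear_comp (n := ∞) _
      ((hf.fderiv_right (m := ∞) (by simp)).clm_apply contDiffAt_const)).differentiableAt
        (by simp), sum_apply]
    refine Finset.sum_congr rfl fun i _ => ?_
    rw [fderiv_linear_comp _ (h2 _).differentiableAt, (h2 _).fderiv]
    rfl
  have h4 : ∑ j, contractLeft ((Module.finBasis ℝ E).coord j)
      (fderiv ℝ (extDivergence E f).1 y (Module.finBasis ℝ E j)) =
      -∑ j, contractLeft ((Module.finBasis ℝ E).coord j)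
      (fderiv ℝ (extDivergence E f).1 y (Module.finBasis ℝ E j)) := by
    simp only [h1, map_sum]
    conv_lhs => rw [Finset.sum_comm]
    simp only [← Finset.sum_neg_distrib]
    refine Finset.sum_congr rfl fun i _ => Finset.sum_congr rfl fun j _ => ?_
    rw [CliffordAlgebra.contractLeft_comm, hs]
  have h5 : (2 : ℝ) • ∑ j, contractLeft ((Module.finBasis ℝ E).coord j)
      (fderiv ℝ (extDivergence E f).1 y (Module.finBasis ℝ E j)) = 0 := by
    rw [two_smul]
    nth_rewrite 1 [h4]
    exact neg_add_cancel _
  exact (smul_eq_zero.1 h5).resolve_left two_ne_zero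

/-- Expand Δ(PQ). The terms in which derivative and contraction hit the same factor are those of ΔP
· Q and a P · ΔQ; the mixed terms that remain form the bracket. Being an eigenvector of the
involution is all that is used of the degree of `P`. -/
theorem extDivergence_mul_sub {a : ℝ} {P : smoothExt E} (ha : a * a = 1)
    (hP : ∀ y, involute (P.1 y) = a • P.1 y) (Q : smoothExt E) (y : E) :
    flatSchouten P.1 Q.1 y = (-(a • (extDivergence E (P * Q) - extDivergence E P * Q -
      a • (P * extDivergence E Q)))).1 y := by
  have hP' : ∀ v, involute (fderiv ℝ P.1 y v) = a • fderiv ℝ P.1 y v := fun v => by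
    have h1 := fderiv_linear_comp involute.toLinearMap (smoothExt_diff P y) v
    simp only [AlgHom.toLinearMap_apply, hP] at h1
    rw [← h1]
    exact congrArg (fun f => f v) (fderiv_const_smul (smoothExt_diff P y) a)
  have h : (-(a • (extDivergence E (P * Q) - extDivergence E P * Q -
      a • (P * extDivergence E Q)))).1 y = -(a • ((extDivergence E (P * Q)).1 y -
        (extDivergence E P).1 y * Q.1 y - a • (P.1 y * (extDivergence E Q).1 y))) := rfl
  rw [h, flatSchouten_eq (smoothExt_diff P y) (smoothExt_diff Q y), extDivergence_apply,
    extDivergence_apply, extDivergence_apply, Finset.sum_mul, Finset.mul_sum, Finset.smul_sum,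
    ← Finset.sum_sub_distrib, ← Finset.sum_sub_distrib, Finset.smul_sum, ← Finset.sum_neg_distrib]
  refine Finset.sum_congr rfl fun i _ => ?_
  have h2 : (P * Q).1 = fun z => P.1 z * Q.1 z := rfl
  rw [h2, ext_fderiv_mul (smoothExt_diff P y) (smoothExt_diff Q y), map_add, contractLeft_mul,
    contractLeft_mul, hP, hP', contractRight_eq_involute, involute_contractLeft, hP]
  simp only [map_smul, smul_mul_assoc, neg_mul, smul_sub, smul_add, smul_smul, ha, one_smul]
  abel

theorem smoothExt_involute {P : smoothExt E} {p : ℕ} (hp : ∀ y, P.1 y ∈ ⋀[ℝ]^p E) (y : E) :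
    involute (P.1 y) = (-1 : ℝ) ^ p • P.1 y :=
  involute_of_mem (hp y)

theorem extDivergence_mem {P : smoothExt E} {p : ℕ} (hp : ∀ y, P.1 y ∈ ⋀[ℝ]^(p + 1) E) (y : E) :
    (extDivergence E P).1 y ∈ ⋀[ℝ]^p E := by
  rw [extDivergence_apply]
  exact Submodule.sum_mem _ fun _ _ =>
    contractLeft_mem _ (fderiv_mem_of_eventually_mem (Filter.Eventually.of_forall hp) _)

theorem extDivergence_of_mem_zero {P : smoothExt E} (hp : ∀ y, P.1 y ∈ ⋀[ℝ]^0 E) :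
    extDivergence E P = 0 := by
  ext1; ext1 y
  exact (extDivergence_apply P y).trans <| Finset.sum_eq_zero fun _ _ =>
    contractLeft_of_mem_zero _ (fderiv_mem_of_eventually_mem (Filter.Eventually.of_forall hp) _)

/-- The bracket generated by the divergence, for a first argument of sign `a`. -/
def divBracket (a : ℝ) (P Q : smoothExt E) : smoothExt E :=
  generatedBracket (extDivergence E) a P Q

theorem flatSchouten_eq_divBracket {P : smoothExt E} {p : ℕ} (hp : ∀ y, P.1 y ∈ ⋀[ℝ]^p E)
    (Q : smoothExt E) :
    flatSchouten P.1 Q.1 = (-((-1 : ℝ) ^ p • divBracket ((-1) ^ p) P Q)).1 :=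
  funext fun y => extDivergence_mul_sub (by rw [← mul_pow]; simp) (smoothExt_involute hp) Q y

theorem divBracket_mul {P Q : smoothExt E} {p q : ℕ} (hp : ∀ y, P.1 y ∈ ⋀[ℝ]^p E)
    (hq : ∀ y, Q.1 y ∈ ⋀[ℝ]^q E) (T : smoothExt E) :
    divBracket ((-1) ^ p) P (Q * T) = divBracket ((-1) ^ p) P Q * T +
      (-1 : ℝ) ^ ((p + 1) * q) • (Q * divBracket ((-1) ^ p) P T) := by
  have h1 : ∀ R y, (divBracket ((-1) ^ p) P R).1 y = -((-1 : ℝ) ^ p • flatSchouten P.1 R.1 y) := by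
    intro R y
    have h2 : flatSchouten P.1 R.1 y = -((-1 : ℝ) ^ p • (divBracket ((-1) ^ p) P R).1 y) :=
      congrFun (flatSchouten_eq_divBracket hp R) y
    rw [h2, smul_neg, neg_neg, smul_smul, ← mul_pow]
    simp
  ext1; ext1 y
  have h3 := flatSchouten_mul (smoothExt_diff P y) (smoothExt_diff Q y) (smoothExt_diff T y)
    (Filter.Eventually.of_forall hp) (Filter.Eventually.of_forall hq)
  change _ = (divBracket ((-1) ^ p) P Q).1 y * T.1 y +
    (-1 : ℝ) ^ ((p + 1) * q) • (Q.1 y * (divBracket ((-1) ^ p) P T).1 y)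
  rw [h1, h1, h1]
  change -((-1 : ℝ) ^ p • flatSchouten P.1 (fun z => Q.1 z * T.1 z) y) = _
  rw [h3]
  simp only [smul_add, neg_add, mul_neg, neg_mul, smul_mul_assoc, mul_smul_comm, smul_neg]
  rw [smul_comm]

theorem flatSchouten_jacobi_of_contDiff {P Q : smoothExt E} {p q : ℕ}
    (hp : ∀ y, P.1 y ∈ ⋀[ℝ]^p E) (hq : ∀ y, Q.1 y ∈ ⋀[ℝ]^q E) (T : smoothExt E) :
    flatSchouten P.1 (flatSchouten Q.1 T.1) =
      flatSchouten (flatSchouten P.1 Q.1) T.1 +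
        (-1 : ℝ) ^ ((p + 1) * (q + 1)) • flatSchouten Q.1 (flatSchouten P.1 T.1) := by
  have hsq : ∀ n : ℕ, (-1 : ℝ) ^ n = 1 ∨ (-1 : ℝ) ^ n = -1 := neg_one_pow_eq_or ℝ
  have hmul : ∀ n : ℕ, (-1 : ℝ) ^ n * (-1) ^ n = 1 := fun n => by rw [← mul_pow]; simp
  have hj := generatedBracket_jacobi (Δ := extDivergence E) extDivergence_extDivergence
    (hsq p) (hsq q) (hsq (p * q)) (P := P) (Q := Q)
    (fun T => by
      refine (divBracket_mul hp hq T).trans ?_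
      rw [add_mul, one_mul, pow_add]
      rfl)
    (fun T => by
      -- The divergence of a field of degree zero is zero, so the rule for `Δ Q` is trivial there;
      -- otherwise `Δ Q` has degree one less and is again homogeneous.
      cases q with
      | zero =>
        rw [extDivergence_of_mem_zero hq, zero_mul, zero_mul, generatedBracket_zero_right]
        simp
      | succ q =>
        refine (divBracket_mul hp (extDivergence_mem hq) T).trans ?_
        congr 2
        rw [mul_add, mul_one, pow_add, pow_succ, add_mul, one_mul, pow_add,
          show (-1 : ℝ) ^ p * ((-1) ^ (p * q) * (-1) ^ p) * ((-1) ^ q * -1) =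
            -(((-1) ^ p * (-1) ^ p) * ((-1) ^ (p * q) * (-1) ^ q)) by ring, hmul]
        ring)
    (fun T => by
      cases p with
      | zero =>
        rw [extDivergence_of_mem_zero hp, generatedBracket_zero_left, generatedBracket_zero_left,
          generatedBracket_zero_left]
        simp
      | succ p =>
        rw [show -(-1 : ℝ) ^ (p + 1) = (-1) ^ p by rw [pow_succ]; ring]
        exact divBracket_mul (extDivergence_mem hp) hq T)
    T
  change divBracket ((-1) ^ p) P (divBracket ((-1) ^ q) Q T) =
    -((-1 : ℝ) ^ p • divBracket (-((-1) ^ p * (-1) ^ q)) (divBracket ((-1) ^ p) P Q) T) -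
      ((-1 : ℝ) ^ p * ((-1) ^ (p * q) * (-1) ^ q)) •
        divBracket ((-1) ^ q) Q (divBracket ((-1) ^ p) P T) at hj
  -- For p = q = 0 the truncated degree is 0, which is harmless since the bracket of two functions
  -- is zero.
  have hPQ : ∀ y, (-((-1 : ℝ) ^ p • divBracket ((-1) ^ p) P Q)).1 y ∈ ⋀[ℝ]^(p + q - 1) E := by
    intro y
    rw [← flatSchouten_eq_divBracket hp]
    rcases Nat.eq_zero_or_pos (p + q) with h | h
    · obtain ⟨rfl, rfl⟩ : p = 0 ∧ q = 0 := by omega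
      rw [flatSchouten_zero_zero (hp y) (hq y)]
      exact Submodule.zero_mem _
    · exact flatSchouten_mem (by omega) (smoothExt_diff P y) (smoothExt_diff Q y)
        (Filter.Eventually.of_forall hp) (Filter.Eventually.of_forall hq)
  have hlin : ∀ (a c : ℝ) (P Q : smoothExt E), divBracket a P (-(c • Q)) =
      -(c • divBracket a P Q) := generatedBracket_neg_smul_right _
  have hlin' : ∀ (a c : ℝ) (P Q : smoothExt E), divBracket a (-(c • P)) Q =
      -(c • divBracket a P Q) := generatedBracket_neg_smul_left _
  rw [flatSchouten_eq_divBracket hq, flatSchouten_eq_divBracket hp, flatSchouten_eq_divBracket hp,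
    flatSchouten_eq_divBracket hp, flatSchouten_eq_divBracket hPQ, flatSchouten_eq_divBracket hq]
  rw [hlin, hlin, hlin']
  have hgoal : -((-1 : ℝ) ^ p • -((-1 : ℝ) ^ q • divBracket ((-1) ^ p) P
        (divBracket ((-1) ^ q) Q T))) =
      -((-1 : ℝ) ^ (p + q - 1) • -((-1 : ℝ) ^ p • divBracket ((-1) ^ (p + q - 1))
        (divBracket ((-1) ^ p) P Q) T)) +
      (-1 : ℝ) ^ ((p + 1) * (q + 1)) • -((-1 : ℝ) ^ q • -((-1 : ℝ) ^ p • divBracket ((-1) ^ q) Q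
        (divBracket ((-1) ^ p) P T))) := by
    have hs : (-1 : ℝ) ^ ((p + 1) * (q + 1)) = -((-1) ^ (p * q) * (-1) ^ p * (-1) ^ q) := by
      rw [add_mul, mul_add, pow_add, pow_add]; ring
    -- For p = q = 0 the truncated exponent gives the wrong sign, but the bracket it multiplies
    -- vanishes.
    rcases Nat.eq_zero_or_pos (p + q) with h | h
    · obtain ⟨rfl, rfl⟩ : p = 0 ∧ q = 0 := by omega
      have h0 : divBracket ((-1) ^ 0) P Q = 0 := by
        have := flatSchouten_eq_divBracket hp Q
        have h1 : flatSchouten P.1 Q.1 = 0 :=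
          funext fun y => flatSchouten_zero_zero (hp y) (hq y)
        rw [h1] at this
        have h2 := (Subtype.ext this : (0 : smoothExt E) = _)
        simpa using h2.symm
      have h0' : ∀ a, divBracket a (0 : smoothExt E) T = 0 := fun a =>
        generatedBracket_zero_left _ a T
      rw [h0, h0'] at hj ⊢
      rw [hj]
      simp
    · have hn : (-1 : ℝ) ^ (p + q - 1) = -((-1) ^ p * (-1) ^ q) := by
        obtain ⟨n, hn⟩ : ∃ n, p + q = n + 1 := ⟨p + q - 1, by omega⟩
        rw [hn, ← pow_add, hn, pow_succ]
        simp
      rw [hn, hs, hj]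
      rcases hsq p with h1 | h1 <;> rcases hsq q with h2 | h2 <;>
        rcases hsq (p * q) with h3 | h3 <;> rw [h1, h2, h3] <;> module
  exact congrArg Subtype.val hgoal

/-- The divergence acts on globally smooth fields, whereas chart expressions are smooth only
locally. A bump function repairs this, and the fibrewise scalar multiple keeps the degree. -/
theorem exists_contDiff_eventuallyEq {P : E → ExteriorAlgebra ℝ E} {y : E}
    (h : ∀ᶠ z in 𝓝 y, ContDiffAt ℝ ∞ P z) :
    ∃ P' : smoothExt E, P'.1 =ᶠ[𝓝 y] P ∧ ∀ z, ∃ c : ℝ, P'.1 z = c • P z := by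
  obtain ⟨r, hr, hr'⟩ := Metric.eventually_nhds_iff_ball.1 h
  let χ : ContDiffBump y := ⟨r / 4, r / 2, by positivity, by linarith⟩
  refine ⟨⟨fun z => χ z • P z, ?_⟩, ?_, fun z => ⟨χ z, rfl⟩⟩
  · change ContDiff ℝ ∞ _
    refine contDiff_iff_contDiffAt.2 fun z => ?_
    by_cases hz : z ∈ Metric.ball y r
    · exact χ.contDiff.contDiffAt.smul (hr' z hz)
    · have h1 : (fun z => χ z • P z) =ᶠ[𝓝 z] fun _ => 0 := by
        have h2 : z ∈ (tsupport χ)ᶜ := by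
          rw [χ.tsupport_eq]
          simp only [Set.mem_compl_iff, Metric.mem_closedBall, Metric.mem_ball, not_lt] at hz ⊢
          change ¬ dist z y ≤ r / 2
          linarith
        filter_upwards [(isClosed_tsupport χ).isOpen_compl.mem_nhds h2] with w hw
        rw [image_eq_zero_of_notMem_tsupport hw, zero_smul]
      exact contDiffAt_const.congr_of_eventuallyEq h1
  · filter_upwards [χ.eventuallyEq_one] with z hz
    rw [hz]
    exact one_smul _ _

theorem flatSchouten_jacobi {P Q T : E → ExteriorAlgebra ℝ E} {y : E} {p q : ℕ}
    (hP : ∀ᶠ z in 𝓝 y, ContDiffAt ℝ ∞ P z) (hQ : ∀ᶠ z in 𝓝 y, ContDiffAt ℝ ∞ Q z)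
    (hT : ∀ᶠ z in 𝓝 y, ContDiffAt ℝ ∞ T z)
    (hp : ∀ y, P y ∈ ⋀[ℝ]^p E) (hq : ∀ y, Q y ∈ ⋀[ℝ]^q E) :
    flatSchouten P (flatSchouten Q T) y = flatSchouten (flatSchouten P Q) T y +
        (-1 : ℝ) ^ ((p + 1) * (q + 1)) • flatSchouten Q (flatSchouten P T) y := by
  obtain ⟨P', hP1, hP2⟩ := exists_contDiff_eventuallyEq hP
  obtain ⟨Q', hQ1, hQ2⟩ := exists_contDiff_eventuallyEq hQ
  obtain ⟨T', hT1, -⟩ := exists_contDiff_eventuallyEq hT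
  have hp' : ∀ y, P'.1 y ∈ ⋀[ℝ]^p E := fun y => by
    obtain ⟨c, hc⟩ := hP2 y
    rw [hc]; exact Submodule.smul_mem _ _ (hp y)
  have hq' : ∀ y, Q'.1 y ∈ ⋀[ℝ]^q E := fun y => by
    obtain ⟨c, hc⟩ := hQ2 y
    rw [hc]; exact Submodule.smul_mem _ _ (hq y)
  have := congrFun (flatSchouten_jacobi_of_contDiff hp' hq' T') y
  rw [flatSchouten_congr hP1.symm (flatSchouten_eventuallyEq hQ1.symm hT1.symm), this,
    flatSchouten_congr hQ1.symm (flatSchouten_eventuallyEq hP1.symm hT1.symm),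
    flatSchouten_congr (flatSchouten_eventuallyEq hP1.symm hQ1.symm) hT1.symm]
  rfl

/-! #### Invariance under diffeomorphisms -/

/-- Differentiating the transformation law of `P` and `Q` gives a tensorial term and a term with the
second derivative of `φ`. The tensorial terms transform as wanted, by independence of the sum from
the frame; the others cancel because the second derivative is symmetric. -/
theorem flatSchouten_map {P Q P' Q' : E → ExteriorAlgebra ℝ E} {φ : E → E} {y : E}
    (hφ : ContDiffAt ℝ 2 φ y) (hφ' : (fderiv ℝ φ y).IsInvertible)
    (hP : DifferentiableAt ℝ P y) (hQ : DifferentiableAt ℝ Q y)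
    (hP' : DifferentiableAt ℝ P' (φ y)) (hQ' : DifferentiableAt ℝ Q' (φ y))
    (hPP : ∀ᶠ z in 𝓝 y, P' (φ z) = ExteriorAlgebra.map (fderiv ℝ φ z).toLinearMap (P z))
    (hQQ : ∀ᶠ z in 𝓝 y, Q' (φ z) = ExteriorAlgebra.map (fderiv ℝ φ z).toLinearMap (Q z)) :
    flatSchouten P' Q' (φ y) =
      ExteriorAlgebra.map (fderiv ℝ φ y).toLinearMap (flatSchouten P Q y) := by
  obtain ⟨A, hA⟩ := hφ'
  set A' : E →ₗ[ℝ] E := (fderiv ℝ φ y).toLinearMap with hA'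
  set A'' : E →ₗ[ℝ] E := A.symm.toLinearEquiv.toLinearMap with hA''
  have hAA : A'' ∘ₗ A' = LinearMap.id := by
    ext v; simp only [hA', ← hA, hA'']; exact A.symm_apply_apply v
  have hAA' : A' ∘ₗ A'' = LinearMap.id := by
    ext v; simp only [hA', ← hA, hA'']; exact A.apply_symm_apply v
  have hd : DifferentiableAt ℝ φ y := hφ.differentiableAt (by simp)
  have hd' : DifferentiableAt ℝ (fderiv ℝ φ) y :=
    (hφ.fderiv_right (m := 1) (by norm_num)).differentiableAt (by simp)
  have hs : ∀ v w, fderiv ℝ (fderiv ℝ φ) y v w = fderiv ℝ (fderiv ℝ φ) y w v := fun v w =>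
    (hφ.isSymmSndFDerivAt (by simp)) v w
  have key : ∀ {P P' : E → ExteriorAlgebra ℝ E}, DifferentiableAt ℝ P y →
      DifferentiableAt ℝ P' (φ y) →
      (∀ᶠ z in 𝓝 y, P' (φ z) = ExteriorAlgebra.map (fderiv ℝ φ z).toLinearMap (P z)) → ∀ v,
      fderiv ℝ P' (φ y) (A' v) = ExteriorAlgebra.map A' (fderiv ℝ P y v) +
        mapDer A' (fderiv ℝ (fderiv ℝ φ) y v).toLinearMap (P y) := by
    intro P P' h h' he v
    rw [← fderiv_map hd' h, ← (show (fun z => P' (φ z)) =ᶠ[𝓝 y] _ from he).fderiv_eq]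
    have := fderiv_comp y h' hd
    exact (congrArg (fun f => f v) this).symm
  rw [flatSchouten_eq hP' hQ', flatSchouten_eq hP hQ]
  set b := Module.finBasis ℝ E
  -- The coordinate sum may be taken in the transformed frame: vectors `A' (b i)` with dual
  -- covectors `b.coord i ∘ₗ A''`.
  have hsum : ∀ (F : Module.Dual ℝ E →ₗ[ℝ] E →ₗ[ℝ] ExteriorAlgebra ℝ E),
      ∑ i, F (b.coord i) (b i) = ∑ i, F (b.coord i ∘ₗ A'') (A' (b i)) := fun F => by
    have h1 := sum_coord_comp b F A'
    have h2 := sum_coord_comp b (F ∘ₗ (LinearMap.lcomp ℝ ℝ A'')) A'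
    simp only [LinearMap.comp_apply, LinearMap.lcomp_apply'] at h2
    rw [← h2]
    refine Finset.sum_congr rfl fun i _ => ?_
    rw [LinearMap.comp_assoc, hAA', LinearMap.comp_id]
  have hF1 := hsum (LinearMap.mk₂ ℝ
    (fun α v => contractRight (P' (φ y)) α * fderiv ℝ Q' (φ y) v)
    (fun _ _ _ => by simp only [map_add, add_mul])
    (fun _ _ _ => by simp only [map_smul, smul_mul_assoc])
    (fun _ _ _ => by simp only [map_add, mul_add])
    (fun _ _ _ => by simp only [map_smul, mul_smul_comm]))
  have hF2 := hsum (LinearMap.mk₂ ℝ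
    (fun α v => fderiv ℝ P' (φ y) v * contractLeft α (Q' (φ y)))
    (fun _ _ _ => by simp only [map_add, LinearMap.add_apply, mul_add])
    (fun _ _ _ => by simp only [map_smul, LinearMap.smul_apply, mul_smul_comm])
    (fun _ _ _ => by simp only [map_add, add_mul])
    (fun _ _ _ => by simp only [map_smul, smul_mul_assoc]))
  simp only [LinearMap.mk₂_apply] at hF1 hF2
  have hR : ∀ α : Module.Dual ℝ E, contractRight (P' (φ y)) (α ∘ₗ A'') =
      ExteriorAlgebra.map A' (contractRight (P y) α) := fun α => by
    rw [hPP.self_of_nhds, contractRight_map, LinearMap.comp_assoc, hAA, LinearMap.comp_id]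
  have hL : ∀ α : Module.Dual ℝ E, contractLeft (α ∘ₗ A'') (Q' (φ y)) =
      ExteriorAlgebra.map A' (contractLeft α (Q y)) := fun α => by
    rw [hQQ.self_of_nhds, contractLeft_map, LinearMap.comp_assoc, hAA, LinearMap.comp_id]
  rw [Finset.sum_sub_distrib, hF1, hF2]
  simp only [hR, hL, key hP hP' hPP, key hQ hQ' hQQ, mul_add, add_mul, map_sum, map_sub, map_mul,
    Finset.sum_add_distrib, Finset.sum_sub_distrib]
  -- With a right contraction on `P` and a left contraction on `Q`, the two inhomogeneous terms
  -- differ only by exchanging the arguments of the second derivative.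
  have hsym : ∑ i, ExteriorAlgebra.map A' (contractRight (P y) (b.coord i)) *
        mapDer A' (fderiv ℝ (fderiv ℝ φ) y (b i)).toLinearMap (Q y) =
      ∑ i, mapDer A' (fderiv ℝ (fderiv ℝ φ) y (b i)).toLinearMap (P y) *
        ExteriorAlgebra.map A' (contractLeft (b.coord i) (Q y)) := by
    simp only [mapDer_eq_right _ _ (P y), Finset.sum_mul]
    simp only [mapDer, Finset.mul_sum]
    rw [Finset.sum_comm]
    refine Finset.sum_congr rfl fun i _ => Finset.sum_congr rfl fun j _ => ?_
    rw [mul_assoc]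
    congr 3
    exact hs (b j) (b i)
  rw [hsym]
  abel

end FlatSchouten

end

section

/-! ### Tensors in charts -/

section ChartExpressions

variable {E M : Type*} [NormedAddCommGroup E] [NormedSpace ℝ E]
  [TopologicalSpace M] [ChartedSpace E M] [IsManifold 𝓘(ℝ, E) ∞ M]

instance isManifold_one : IsManifold 𝓘(ℝ, E) 1 M := IsManifold.of_le (n := ∞) (by simp)

local notation "φ" => extChartAt 𝓘(ℝ, E)
local notation "τ" => tangentCoordChange 𝓘(ℝ, E)

/-- The value of a vector field, in the model space. -/
def vecAt (X : (x : M) → TangentSpace 𝓘(ℝ, E) x) (p : M) : E := X p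

/-- The value of a section of `⋀ TM`, in the exterior algebra of the model space. -/
def multiAt (Q : MultiField E M) (p : M) : ExteriorAlgebra ℝ E := Q p

/-- The value of a differential form, on the model space. -/
def formAt {k : ℕ} (κ : FormField E M k) (p : M) : E [⋀^Fin k]→L[ℝ] ℝ := κ p

/-- The differential of the inverse of a preferred chart, as an endomorphism of the model space. -/
def chartInvDerivAt (x₀ : M) (z : E) : E →L[ℝ] E := chartInvDeriv x₀ z

theorem tangentCoordChange_comp' {w x y z : M}
    (hw : z ∈ (φ w).source) (hx : z ∈ (φ x).source) (hy : z ∈ (φ y).source) :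
    (τ x y z).comp (τ w x z) = τ w y z := by
  ext v; exact tangentCoordChange_comp ⟨⟨hw, hx⟩, hy⟩

theorem tangentCoordChange_self' {x z : M} (hx : z ∈ (φ x).source) :
    τ x x z = ContinuousLinearMap.id ℝ E := by
  ext v; exact tangentCoordChange_self hx

theorem tangentCoordChange_eq_inverse {x y z : M} (hx : z ∈ (φ x).source)
    (hy : z ∈ (φ y).source) : (τ x y z).inverse = τ y x z := by
  refine ContinuousLinearMap.inverse_eq ?_ ?_
  · rw [tangentCoordChange_comp' hy hx hy, tangentCoordChange_self' hy]
  · rw [tangentCoordChange_comp' hx hy hx, tangentCoordChange_self' hx]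

theorem tangentCoordChange_isInvertible {x y z : M} (hx : z ∈ (φ x).source)
    (hy : z ∈ (φ y).source) : (τ x y z).IsInvertible := by
  refine ContinuousLinearMap.IsInvertible.of_inverse (g := τ y x z) ?_ ?_
  · rw [tangentCoordChange_comp' hy hx hy, tangentCoordChange_self' hy]
  · rw [tangentCoordChange_comp' hx hy hx, tangentCoordChange_self' hx]

/-- The differential of a preferred chart, as an endomorphism of the model space. -/
def chartDerivAt (x₀ p : M) : E →L[ℝ] E := mfderiv 𝓘(ℝ, E) 𝓘(ℝ, E) (φ x₀) p

theorem chartDerivAt_eq {x₀ p : M} (hp : p ∈ (φ x₀).source) : chartDerivAt x₀ p = τ p x₀ p := by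
  rw [extChartAt_source] at hp
  exact mfderiv_chartAt_eq_tangentCoordChange (I := 𝓘(ℝ, E)) hp

/-- The tangent space at `x` is the model space read through the preferred chart at `x`. So objects
defined through that chart need no conversion at `x` itself. -/
theorem chartDerivAt_self (x : M) : chartDerivAt x x = ContinuousLinearMap.id ℝ E :=
  (chartDerivAt_eq (mem_extChartAt_source x)).trans
    (tangentCoordChange_self' (mem_extChartAt_source x))

/-- Each point p identifies its tangent space with `E` by its own chart, so the differential of the
inverse of another chart is a coordinate change to the chart at p. It is found by cancelling the
differential of the chart, which is the opposite coordinate change. -/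
theorem chartInvDerivAt_eq (x₀ : M) {z : E} (hz : z ∈ (φ x₀).target) :
    chartInvDerivAt x₀ z = τ x₀ ((φ x₀).symm z) ((φ x₀).symm z) := by
  have hp := (φ x₀).map_target hz
  have h1 : (chartDerivAt x₀ ((φ x₀).symm z)).comp (chartInvDerivAt x₀ z) =
      ContinuousLinearMap.id ℝ E := by
    have := mfderiv_extChartAt_comp_mfderivWithin_extChartAt_symm (I := 𝓘(ℝ, E)) hz
    simp only [modelWithCornersSelf_coe, Set.range_id, mfderivWithin_univ] at this
    exact this
  rw [chartDerivAt_eq hp] at h1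
  have h2 := congrArg (fun f => (τ x₀ ((φ x₀).symm z) ((φ x₀).symm z)).comp f) h1
  beta_reduce at h2
  rw [← ContinuousLinearMap.comp_assoc, tangentCoordChange_comp' (mem_extChartAt_source _) hp
    (mem_extChartAt_source _), tangentCoordChange_self' (mem_extChartAt_source _),
    ContinuousLinearMap.id_comp, ContinuousLinearMap.comp_id] at h2
  exact h2

theorem chartInvDerivAt_inverse_eq (x₀ : M) {z : E} (hz : z ∈ (φ x₀).target) :
    (chartInvDerivAt x₀ z).inverse = τ ((φ x₀).symm z) x₀ ((φ x₀).symm z) := by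
  rw [chartInvDerivAt_eq x₀ hz,
    tangentCoordChange_eq_inverse ((φ x₀).map_target hz) (mem_extChartAt_source _)]

theorem chartVField_eq (X : (x : M) → TangentSpace 𝓘(ℝ, E) x) (x₀ : M) {z : E}
    (hz : z ∈ (φ x₀).target) :
    chartVField X x₀ z = τ ((φ x₀).symm z) x₀ ((φ x₀).symm z) (vecAt X ((φ x₀).symm z)) :=
  congrArg (fun f : E →L[ℝ] E => f (vecAt X ((φ x₀).symm z))) (chartInvDerivAt_inverse_eq x₀ hz)

theorem chartMulti_eq (Q : MultiField E M) (x₀ : M) {z : E} (hz : z ∈ (φ x₀).target) :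
    chartMulti Q x₀ z = ExteriorAlgebra.map
      (τ ((φ x₀).symm z) x₀ ((φ x₀).symm z)).toLinearMap (multiAt Q ((φ x₀).symm z)) :=
  congrArg (fun f : E →L[ℝ] E => ExteriorAlgebra.map f.toLinearMap
    (multiAt Q ((φ x₀).symm z))) (chartInvDerivAt_inverse_eq x₀ hz)

theorem chartForm_eq {k : ℕ} (κ : FormField E M k) (x₀ : M) {z : E} (hz : z ∈ (φ x₀).target) :
    chartForm κ x₀ z = (formAt κ ((φ x₀).symm z)).compContinuousLinearMap
      (τ x₀ ((φ x₀).symm z) ((φ x₀).symm z)) :=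
  congrArg (fun f : E →L[ℝ] E =>
    (formAt κ ((φ x₀).symm z)).compContinuousLinearMap f) (chartInvDerivAt_eq x₀ hz)

/-- The change of coordinates from the preferred chart at `x` to the preferred chart at `y`. -/
def chartTransition (x y : M) : E → E := fun z => φ y ((φ x).symm z)

theorem contDiffAt_chartTransition {x y p : M} (hx : p ∈ (φ x).source) (hy : p ∈ (φ y).source) :
    ContDiffAt ℝ ∞ (chartTransition x y) (φ x p) := by
  have h1 : ContDiffWithinAt ℝ ∞ (φ y ∘ (φ x).symm) (Set.range 𝓘(ℝ, E)) (φ x p) :=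
    contDiffWithinAt_ext_coord_change y x (by
      rw [PartialEquiv.trans_source'']
      exact ⟨p, ⟨hx, hy⟩, rfl⟩)
  simp only [modelWithCornersSelf_coe, Set.range_id, contDiffWithinAt_univ] at h1
  exact h1

theorem fderiv_chartTransition (x y p : M) :
    fderiv ℝ (chartTransition x y) (φ x p) = τ x y p := by
  rw [tangentCoordChange_def]
  simp only [modelWithCornersSelf_coe, Set.range_id, fderivWithin_univ]
  rfl

theorem eventually_mem_target_and_source {x y : M} {z : E} (hz : z ∈ (φ x).target)
    (hy : (φ x).symm z ∈ (φ y).source) :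
    ∀ᶠ w in 𝓝 z, w ∈ (φ x).target ∧ (φ x).symm w ∈ (φ y).source := by
  refine Filter.Eventually.and ((isOpen_extChartAt_target x).mem_nhds hz) ?_
  exact (continuousAt_extChartAt_symm'' hz).eventually
    ((isOpen_extChartAt_source y).mem_nhds hy)

/-- Both chart expressions come from the value at the point by a coordinate change, and coordinate
changes satisfy the cocycle rule. -/
theorem chartMulti_transition (Q : MultiField E M) {x y : M} {z : E} (hz : z ∈ (φ x).target)
    (hy : (φ x).symm z ∈ (φ y).source) :
    chartMulti Q y (chartTransition x y z) = ExteriorAlgebra.map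
      (fderiv ℝ (chartTransition x y) z).toLinearMap (chartMulti Q x z) := by
  have h1 : chartTransition x y z ∈ (φ y).target := (φ y).map_source hy
  have h2 : (φ y).symm (chartTransition x y z) = (φ x).symm z := (φ y).left_inv hy
  have h3 : fderiv ℝ (chartTransition x y) z = τ x y ((φ x).symm z) := by
    have := fderiv_chartTransition (E := E) x y ((φ x).symm z)
    rwa [(φ x).right_inv hz] at this
  rw [chartMulti_eq Q y h1, chartMulti_eq Q x hz, h3, map_map_apply, h2,
    ← ContinuousLinearMap.toLinearMap_comp,
    tangentCoordChange_comp' (mem_extChartAt_source ((φ x).symm z)) ((φ x).map_target hz) hy]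

theorem chartForm_transition {k : ℕ} (κ : FormField E M k) {x y : M} {z : E}
    (hz : z ∈ (φ x).target) (hy : (φ x).symm z ∈ (φ y).source) :
    chartForm κ x z = (chartForm κ y (chartTransition x y z)).compContinuousLinearMap
      (fderiv ℝ (chartTransition x y) z) := by
  have h1 : chartTransition x y z ∈ (φ y).target := (φ y).map_source hy
  have h2 : (φ y).symm (chartTransition x y z) = (φ x).symm z := (φ y).left_inv hy
  have h3 : fderiv ℝ (chartTransition x y) z = τ x y ((φ x).symm z) := by
    have := fderiv_chartTransition (E := E) x y ((φ x).symm z)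
    rwa [(φ x).right_inv hz] at this
  rw [chartForm_eq κ y h1, chartForm_eq κ x hz, h3, h2,
    ← tangentCoordChange_comp' ((φ x).map_target hz) hy (mem_extChartAt_source ((φ x).symm z))]
  rfl

theorem multiAt_eq_chartMulti (Q : MultiField E M) (x : M) :
    multiAt Q x = chartMulti Q x (φ x x) := by
  rw [chartMulti_eq Q x (mem_extChartAt_target x), extChartAt_to_inv,
    tangentCoordChange_self' (mem_extChartAt_source x)]
  exact (map_id_apply _).symm

theorem formAt_eq_chartForm {k : ℕ} (κ : FormField E M k) (x : M) :
    formAt κ x = chartForm κ x (φ x x) := by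
  rw [chartForm_eq κ x (mem_extChartAt_target x), extChartAt_to_inv,
    tangentCoordChange_self' (mem_extChartAt_source x)]
  rfl

theorem vecAt_eq_chartVField (X : (x : M) → TangentSpace 𝓘(ℝ, E) x) (x : M) :
    vecAt X x = chartVField X x (φ x x) := by
  rw [chartVField_eq X x (mem_extChartAt_target x), extChartAt_to_inv,
    tangentCoordChange_self' (mem_extChartAt_source x)]
  rfl

theorem chartMulti_mem {Q : MultiField E M} {k : ℕ}
    (hQ : ∀ x, Q x ∈ ⋀[ℝ]^k (TangentSpace 𝓘(ℝ, E) x)) (x₀ : M) (z : E) :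
    chartMulti Q x₀ z ∈ ⋀[ℝ]^k E :=
  map_mem_exteriorPower (V := E) (W := E) _ (hQ _)

/-- Near each point the chart expression is the fibre component in the trivialization at `x₀`, which
is what smoothness of a section controls. -/
theorem contMDiff_vfield_chart (X : VField E M) (x₀ : M) :
    ContDiffOn ℝ ∞ (chartVField X x₀) (φ x₀).target := by
  intro z hz
  have hp := (φ x₀).map_target hz
  have h1 : ContMDiffAt 𝓘(ℝ, E) 𝓘(ℝ, E) ∞
      (fun p => (trivializationAt E (TangentSpace 𝓘(ℝ, E)) x₀ ⟨p, X p⟩).2) ((φ x₀).symm z) :=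
    ((trivializationAt E (TangentSpace 𝓘(ℝ, E)) x₀).contMDiffAt_section_iff
      (by simpa using hp)).1 (X.contMDiff _)
  have h2 : ContMDiffAt 𝓘(ℝ, E) 𝓘(ℝ, E) ∞ (φ x₀).symm z :=
    ((contMDiffOn_extChartAt_symm x₀).contMDiffAt ((isOpen_extChartAt_target x₀).mem_nhds hz))
  have h3 := (h1.comp z h2).contDiffAt
  refine (h3.congr_of_eventuallyEq ?_).contDiffWithinAt
  filter_upwards [(isOpen_extChartAt_target x₀).mem_nhds hz] with w hw
  rw [chartVField_eq _ _ hw, tangentCoordChange_def]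
  rfl

end ChartExpressions

end

section

/-! ### The algebra of smooth multivector fields on a manifold -/

section Multivectors

open CliffordAlgebra (contractLeft contractRight involute)

variable {E M : Type*} [NormedAddCommGroup E] [NormedSpace ℝ E] [FiniteDimensional ℝ E]
  [TopologicalSpace M] [ChartedSpace E M]

local notation "φ" => extChartAt 𝓘(ℝ, E)
local notation "τ" => tangentCoordChange 𝓘(ℝ, E)

attribute [local instance] extNormedAddCommGroup extNormedSpace

theorem isSmoothMulti_iff {Q : MultiField E M} :
    IsSmoothMulti Q ↔ ∀ (x₀ : M), ∀ z ∈ (φ x₀).target, ContDiffAt ℝ ∞ (chartMulti Q x₀) z := by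
  refine ⟨fun h x₀ z hz => contDiffAt_ext_iff.2 fun l => ?_, fun h x₀ l z hz => ?_⟩
  · exact (h x₀ l).contDiffAt ((isOpen_extChartAt_target x₀).mem_nhds hz)
  · exact (contDiffAt_ext_iff.1 (h x₀ z hz) l).contDiffWithinAt

theorem IsSmoothMulti.contDiffAt {Q : MultiField E M} (h : IsSmoothMulti Q) {x₀ : M} {z : E}
    (hz : z ∈ (φ x₀).target) : ContDiffAt ℝ ∞ (chartMulti Q x₀) z :=
  isSmoothMulti_iff.1 h x₀ z hz

theorem IsSmoothMulti.eventually {Q : MultiField E M} (h : IsSmoothMulti Q) {x₀ : M} {z : E}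
    (hz : z ∈ (φ x₀).target) : ∀ᶠ w in 𝓝 z, ContDiffAt ℝ ∞ (chartMulti Q x₀) w := by
  filter_upwards [(isOpen_extChartAt_target x₀).mem_nhds hz] with w hw using h.contDiffAt hw

theorem IsSmoothMulti.differentiableAt {Q : MultiField E M} (h : IsSmoothMulti Q) {x₀ : M} {z : E}
    (hz : z ∈ (φ x₀).target) : DifferentiableAt ℝ (chartMulti Q x₀) z :=
  (h.contDiffAt hz).differentiableAt (by simp)

theorem chartMulti_mul (P Q : MultiField E M) (x₀ : M) :
    chartMulti (P * Q) x₀ = fun z => chartMulti P x₀ z * chartMulti Q x₀ z :=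
  funext fun z => map_mul (ExteriorAlgebra.map (chartInvDeriv x₀ z).inverse.toLinearMap) _ _

theorem IsSmoothMulti.mul {P Q : MultiField E M} (hP : IsSmoothMulti P) (hQ : IsSmoothMulti Q) :
    IsSmoothMulti (P * Q) :=
  isSmoothMulti_iff.2 fun x₀ z hz => by
    rw [chartMulti_mul]
    exact ext_contDiffAt_mul (hP.contDiffAt hz) (hQ.contDiffAt hz)

variable [IsManifold 𝓘(ℝ, E) ∞ M]

theorem IsSmoothMulti.add {P Q : MultiField E M} (hP : IsSmoothMulti P) (hQ : IsSmoothMulti Q) :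
    IsSmoothMulti (P + Q) :=
  isSmoothMulti_iff.2 fun x₀ z hz => by
    rw [chartMulti_add]
    exact (hP.contDiffAt hz).add (hQ.contDiffAt hz)

/-- A function, as a section of `⋀ TM`. -/
def funMulti (f : M → ℝ) : MultiField E M := fun x => algebraMap ℝ _ (f x)

theorem chartMulti_funMulti (f : M → ℝ) (x₀ : M) :
    chartMulti (funMulti (E := E) f) x₀ = fun z => algebraMap ℝ _ (f ((φ x₀).symm z)) :=
  funext fun z => AlgHom.commutes (ExteriorAlgebra.map (chartInvDeriv x₀ z).inverse.toLinearMap) _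

theorem chartMulti_vfieldMulti (X : (x : M) → TangentSpace 𝓘(ℝ, E) x) (x₀ : M) :
    chartMulti (vfieldMulti X) x₀ = fun z => ExteriorAlgebra.ι ℝ (chartVField X x₀ z) :=
  funext fun z => ExteriorAlgebra.map_apply_ι (chartInvDeriv x₀ z).inverse.toLinearMap _

theorem multiAt_ext {P Q : MultiField E M} (h : ∀ x, multiAt P x = multiAt Q x) : P = Q :=
  funext h

theorem multiAt_add (P Q : MultiField E M) (x : M) :
    multiAt (P + Q) x = multiAt P x + multiAt Q x := rfl

theorem multiAt_neg (P : MultiField E M) (x : M) : multiAt (-P) x = -multiAt P x := rfl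

theorem multiAt_smul (c : ℝ) (P : MultiField E M) (x : M) :
    multiAt (c • P) x = c • multiAt P x := rfl

theorem multiAt_mul (P Q : MultiField E M) (x : M) :
    multiAt (P * Q) x = multiAt P x * multiAt Q x := rfl

theorem multiAt_schouten (P Q : MultiField E M) (x : M) :
    multiAt (schouten P Q) x = flatSchouten (chartMulti P x) (chartMulti Q x) (φ x x) := by
  change ExteriorAlgebra.map (chartDerivAt x x).inverse.toLinearMap _ = _
  rw [chartDerivAt_self, ContinuousLinearMap.inverse_id]
  exact map_id_apply _

theorem multiAt_multiLie (X : (x : M) → TangentSpace 𝓘(ℝ, E) x) (Q : MultiField E M) (x : M) :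
    multiAt (multiLie X Q) x = flatLie (chartVField X x) (chartMulti Q x) (φ x x) := by
  change ExteriorAlgebra.map (chartDerivAt x x).inverse.toLinearMap _ = _
  rw [chartDerivAt_self, ContinuousLinearMap.inverse_id]
  exact map_id_apply _

/-- At a point p the bracket is computed in the chart at p; `flatSchouten_map`, for the transition
to the chart at `x₀`, carries the result there. A bracket thus has a known expression on a whole
chart, as its smoothness and iterated brackets require. -/
theorem chartMulti_schouten {P Q : MultiField E M} (hP : IsSmoothMulti P) (hQ : IsSmoothMulti Q)
    (x₀ : M) {z : E} (hz : z ∈ (φ x₀).target) :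
    chartMulti (schouten P Q) x₀ z = flatSchouten (chartMulti P x₀) (chartMulti Q x₀) z := by
  set p := (φ x₀).symm z with hp
  have hps : p ∈ (φ x₀).source := (φ x₀).map_target hz
  have hpp := mem_extChartAt_source (I := 𝓘(ℝ, E)) p
  have hpt := mem_extChartAt_target (I := 𝓘(ℝ, E)) p
  have hpi : (φ p).symm (φ p p) = p := extChartAt_to_inv p
  have hz' : chartTransition p x₀ (φ p p) = z := by
    rw [chartTransition, hpi, hp, (φ x₀).right_inv hz]
  have hd : fderiv ℝ (chartTransition p x₀) (φ p p) = τ p x₀ p := fderiv_chartTransition p x₀ p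
  have hev : ∀ T : MultiField E M, ∀ᶠ w in 𝓝 (φ p p), chartMulti T x₀ (chartTransition p x₀ w) =
      ExteriorAlgebra.map (fderiv ℝ (chartTransition p x₀) w).toLinearMap (chartMulti T p w) :=
    fun T => by
      filter_upwards [eventually_mem_target_and_source hpt (y := x₀) (by rwa [hpi])] with w hw
        using chartMulti_transition T hw.1 hw.2
  have key := flatSchouten_map (P := chartMulti P p) (Q := chartMulti Q p) (P' := chartMulti P x₀)
    (Q' := chartMulti Q x₀)
    ((contDiffAt_chartTransition hpp hps).of_le
      (by simpa using WithTop.coe_le_coe.2 (le_top : (2 : ℕ∞) ≤ ⊤)))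
    (by rw [hd]; exact tangentCoordChange_isInvertible hpp hps)
    (hP.differentiableAt hpt) (hQ.differentiableAt hpt)
    (by rw [hz']; exact hP.differentiableAt hz) (by rw [hz']; exact hQ.differentiableAt hz)
    (hev P) (hev Q)
  rw [hz', hd] at key
  rw [key, chartMulti_eq _ x₀ hz, ← hp, multiAt_schouten]

theorem chartMulti_schouten_eventuallyEq {P Q : MultiField E M} (hP : IsSmoothMulti P)
    (hQ : IsSmoothMulti Q) (x₀ : M) {z : E} (hz : z ∈ (φ x₀).target) :
    chartMulti (schouten P Q) x₀ =ᶠ[𝓝 z] flatSchouten (chartMulti P x₀) (chartMulti Q x₀) := by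
  filter_upwards [(isOpen_extChartAt_target x₀).mem_nhds hz] with w hw
    using chartMulti_schouten hP hQ x₀ hw

theorem IsSmoothMulti.schouten {P Q : MultiField E M} (hP : IsSmoothMulti P)
    (hQ : IsSmoothMulti Q) : IsSmoothMulti (schouten P Q) :=
  isSmoothMulti_iff.2 fun x₀ _ hz =>
    (contDiffAt_flatSchouten (hP.eventually hz) (hQ.eventually hz)).congr_of_eventuallyEq
      (chartMulti_schouten_eventuallyEq hP hQ x₀ hz)

theorem flatSchouten_add_left {P P' Q : E → ExteriorAlgebra ℝ E} {y : E}
    (hP : DifferentiableAt ℝ P y) (hP' : DifferentiableAt ℝ P' y) (hQ : DifferentiableAt ℝ Q y) :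
    flatSchouten (P + P') Q y = flatSchouten P Q y + flatSchouten P' Q y := by
  rw [flatSchouten_eq (hP.add hP') hQ, flatSchouten_eq hP hQ, flatSchouten_eq hP' hQ,
    ← Finset.sum_add_distrib, fderiv_add hP hP']
  refine Finset.sum_congr rfl fun i _ => ?_
  simp only [Pi.add_apply, map_add, add_apply, LinearMap.add_apply, add_mul]
  abel

theorem flatSchouten_add_right {P Q Q' : E → ExteriorAlgebra ℝ E} {y : E}
    (hP : DifferentiableAt ℝ P y) (hQ : DifferentiableAt ℝ Q y) (hQ' : DifferentiableAt ℝ Q' y) :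
    flatSchouten P (Q + Q') y = flatSchouten P Q y + flatSchouten P Q' y := by
  rw [flatSchouten_eq hP (hQ.add hQ'), flatSchouten_eq hP hQ, flatSchouten_eq hP hQ',
    ← Finset.sum_add_distrib, fderiv_add hQ hQ']
  refine Finset.sum_congr rfl fun i _ => ?_
  simp only [Pi.add_apply, map_add, add_apply, mul_add]
  abel

theorem flatSchouten_smul_left {P Q : E → ExteriorAlgebra ℝ E} {y : E} (c : ℝ)
    (hP : DifferentiableAt ℝ P y) (hQ : DifferentiableAt ℝ Q y) :
    flatSchouten (c • P) Q y = c • flatSchouten P Q y := by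
  rw [flatSchouten_eq (hP.const_smul c) hQ, flatSchouten_eq hP hQ, Finset.smul_sum,
    fderiv_const_smul hP]
  refine Finset.sum_congr rfl fun i _ => ?_
  simp only [Pi.smul_apply, map_smul, smul_apply, LinearMap.smul_apply, smul_mul_assoc, smul_sub]

theorem flatSchouten_smul_right {P Q : E → ExteriorAlgebra ℝ E} {y : E} (c : ℝ)
    (hP : DifferentiableAt ℝ P y) (hQ : DifferentiableAt ℝ Q y) :
    flatSchouten P (c • Q) y = c • flatSchouten P Q y := by
  rw [flatSchouten_eq hP (hQ.const_smul c), flatSchouten_eq hP hQ, Finset.smul_sum,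
    fderiv_const_smul hQ]
  refine Finset.sum_congr rfl fun i _ => ?_
  simp only [Pi.smul_apply, map_smul, smul_apply, mul_smul_comm, smul_sub]

theorem schouten_add_left {P P' Q : MultiField E M} (hP : IsSmoothMulti P)
    (hP' : IsSmoothMulti P') (hQ : IsSmoothMulti Q) :
    schouten (P + P') Q = schouten P Q + schouten P' Q :=
  multiAt_ext fun x => by
    have hx := mem_extChartAt_target (I := 𝓘(ℝ, E)) x
    rw [multiAt_add]
    simp only [multiAt_schouten, chartMulti_add]
    exact flatSchouten_add_left (hP.differentiableAt hx) (hP'.differentiableAt hx)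
      (hQ.differentiableAt hx)

theorem schouten_add_right {P Q Q' : MultiField E M} (hP : IsSmoothMulti P)
    (hQ : IsSmoothMulti Q) (hQ' : IsSmoothMulti Q') :
    schouten P (Q + Q') = schouten P Q + schouten P Q' :=
  multiAt_ext fun x => by
    have hx := mem_extChartAt_target (I := 𝓘(ℝ, E)) x
    rw [multiAt_add]
    simp only [multiAt_schouten, chartMulti_add]
    exact flatSchouten_add_right (hP.differentiableAt hx) (hQ.differentiableAt hx)
      (hQ'.differentiableAt hx)

theorem schouten_smul_left (c : ℝ) {P Q : MultiField E M} (hP : IsSmoothMulti P)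
    (hQ : IsSmoothMulti Q) : schouten (c • P) Q = c • schouten P Q :=
  multiAt_ext fun x => by
    have hx := mem_extChartAt_target (I := 𝓘(ℝ, E)) x
    rw [multiAt_smul]
    simp only [multiAt_schouten, chartMulti_smul]
    exact flatSchouten_smul_left c (hP.differentiableAt hx) (hQ.differentiableAt hx)

theorem schouten_smul_right (c : ℝ) {P Q : MultiField E M} (hP : IsSmoothMulti P)
    (hQ : IsSmoothMulti Q) : schouten P (c • Q) = c • schouten P Q :=
  multiAt_ext fun x => by
    have hx := mem_extChartAt_target (I := 𝓘(ℝ, E)) x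
    rw [multiAt_smul]
    simp only [multiAt_schouten, chartMulti_smul]
    exact flatSchouten_smul_right c (hP.differentiableAt hx) (hQ.differentiableAt hx)

/-- The section `Q` of `⋀ TM` is of degree `k`. -/
def IsOfDegree (k : ℕ) (Q : MultiField E M) : Prop := ∀ x, Q x ∈ ⋀[ℝ]^k (TangentSpace 𝓘(ℝ, E) x)

theorem IsOfDegree.multiAt {k : ℕ} {Q : MultiField E M} (h : IsOfDegree k Q) (x : M) :
    multiAt Q x ∈ ⋀[ℝ]^k E := h x

theorem IsOfDegree.chartMulti {k : ℕ} {Q : MultiField E M} (h : IsOfDegree k Q) (x : M) (z : E) :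
    chartMulti Q x z ∈ ⋀[ℝ]^k E := chartMulti_mem h x z

theorem schouten_mul {P Q R : MultiField E M} {p q : ℕ} (hP : IsSmoothMulti P)
    (hQ : IsSmoothMulti Q) (hR : IsSmoothMulti R) (hp : IsOfDegree p P) (hq : IsOfDegree q Q) :
    schouten P (Q * R) = schouten P Q * R + (-1 : ℝ) ^ ((p + 1) * q) • (Q * schouten P R) :=
  multiAt_ext fun x => by
    have hx := mem_extChartAt_target (I := 𝓘(ℝ, E)) x
    rw [multiAt_add, multiAt_smul, multiAt_mul, multiAt_mul]
    simp only [multiAt_schouten, chartMulti_mul, multiAt_eq_chartMulti Q, multiAt_eq_chartMulti R]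
    exact flatSchouten_mul (hP.differentiableAt hx) (hQ.differentiableAt hx)
      (hR.differentiableAt hx) (.of_forall (hp.chartMulti x)) (.of_forall (hq.chartMulti x))

theorem schouten_skew {P Q : MultiField E M} {p q : ℕ} (hP : IsSmoothMulti P)
    (hQ : IsSmoothMulti Q) (hp : IsOfDegree p P) (hq : IsOfDegree q Q) :
    schouten P Q = -((-1 : ℝ) ^ ((p + 1) * (q + 1)) • schouten Q P) :=
  multiAt_ext fun x => by
    have hx := mem_extChartAt_target (I := 𝓘(ℝ, E)) x
    rw [multiAt_neg, multiAt_smul]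
    simp only [multiAt_schouten]
    exact flatSchouten_skew (hP.differentiableAt hx) (hQ.differentiableAt hx)
      (.of_forall (hp.chartMulti x)) (.of_forall (hq.chartMulti x))

theorem IsOfDegree.schouten {P Q : MultiField E M} {p q r : ℕ} (hr : p + q = r + 1)
    (hP : IsSmoothMulti P) (hQ : IsSmoothMulti Q) (hp : IsOfDegree p P) (hq : IsOfDegree q Q) :
    IsOfDegree r (schouten P Q) := fun x => by
  have hx := mem_extChartAt_target (I := 𝓘(ℝ, E)) x
  change Soldered.multiAt (Soldered.schouten P Q) x ∈ ⋀[ℝ]^r E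
  rw [multiAt_schouten]
  exact flatSchouten_mem hr (hP.differentiableAt hx) (hQ.differentiableAt hx)
      (.of_forall (hp.chartMulti x)) (.of_forall (hq.chartMulti x))

theorem schouten_zero_zero {P Q : MultiField E M} (hp : IsOfDegree 0 P) (hq : IsOfDegree 0 Q) :
    schouten P Q = 0 :=
  multiAt_ext fun x => by
    rw [multiAt_schouten]
    exact flatSchouten_zero_zero (hp.chartMulti x _) (hq.chartMulti x _)

theorem schouten_jacobi {P Q T : MultiField E M} {p q : ℕ} (hP : IsSmoothMulti P)
    (hQ : IsSmoothMulti Q) (hT : IsSmoothMulti T) (hp : IsOfDegree p P) (hq : IsOfDegree q Q) :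
    schouten P (schouten Q T) = schouten (schouten P Q) T +
      (-1 : ℝ) ^ ((p + 1) * (q + 1)) • schouten Q (schouten P T) :=
  multiAt_ext fun x => by
    have hx := mem_extChartAt_target (I := 𝓘(ℝ, E)) x
    rw [multiAt_add, multiAt_smul]
    simp only [multiAt_schouten]
    -- The outer bracket sees only germs, so the inner ones can be replaced by their coordinate
    -- expressions in the chart at `x`.
    rw [flatSchouten_congr .rfl (chartMulti_schouten_eventuallyEq hQ hT x hx),
      flatSchouten_congr .rfl (chartMulti_schouten_eventuallyEq hP hT x hx),
      flatSchouten_congr (chartMulti_schouten_eventuallyEq hP hQ x hx) .rfl]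
    exact flatSchouten_jacobi (hP.eventually hx) (hQ.eventually hx) (hT.eventually hx)
      (hp.chartMulti x) (hq.chartMulti x)

/-! #### Vector fields and functions as multivector fields -/

theorem VField.contDiffAt_chart (X : VField E M) {x₀ : M} {z : E} (hz : z ∈ (φ x₀).target) :
    ContDiffAt ℝ ∞ (chartVField X x₀) z :=
  (contMDiff_vfield_chart X x₀).contDiffAt ((isOpen_extChartAt_target x₀).mem_nhds hz)

theorem VField.isSmoothMulti (X : VField E M) : IsSmoothMulti (vfieldMulti X) :=
  isSmoothMulti_iff.2 fun x₀ z hz => by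
    rw [chartMulti_vfieldMulti]
    exact extιL.contDiff.contDiffAt.comp z (X.contDiffAt_chart hz)

theorem isOfDegree_vfieldMulti (X : (x : M) → TangentSpace 𝓘(ℝ, E) x) :
    IsOfDegree 1 (vfieldMulti X) := fun x => ι_mem_exteriorPower (V := E) (vecAt X x)

theorem isOfDegree_funMulti (f : M → ℝ) : IsOfDegree 0 (funMulti (E := E) f) :=
  fun x => algebraMap_mem_exteriorPower (V := E) (f x)

theorem isSmoothMulti_funMulti_iff {f : M → ℝ} :
    IsSmoothMulti (funMulti (E := E) f) ↔ ContMDiff 𝓘(ℝ, E) 𝓘(ℝ) ∞ f := by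
  rw [isSmoothMulti_iff]
  simp only [chartMulti_funMulti]
  constructor
  · intro h x
    -- The left inverse of the embedding of scalars is a linear functional that recovers `f`.
    have h1 := contDiffAt_ext_iff.1 (h x _ (mem_extChartAt_target x))
      (ExteriorAlgebra.algebraMapInv).toLinearMap
    have h2 : ContDiffAt ℝ ∞ (fun z => f ((φ x).symm z)) (φ x x) := by
      refine h1.congr_of_eventuallyEq (.of_forall fun z => ?_)
      exact (ExteriorAlgebra.algebraMap_leftInverse E (f ((φ x).symm z))).symm
    refine (h2.contMDiffAt.comp x (contMDiffAt_extChartAt (I := 𝓘(ℝ, E)))).congr_of_eventuallyEq ?_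
    filter_upwards [extChartAt_source_mem_nhds (I := 𝓘(ℝ, E)) x] with p hp
    rw [Function.comp_apply, (φ x).left_inv hp]
  · intro h x z hz
    have h2 : ContMDiffAt 𝓘(ℝ, E) 𝓘(ℝ, E) ∞ (φ x).symm z :=
      (contMDiffOn_extChartAt_symm x).contMDiffAt ((isOpen_extChartAt_target x).mem_nhds hz)
    exact (Algebra.linearMap ℝ (ExteriorAlgebra ℝ E)).toContinuousLinearMap.contDiff.contDiffAt.comp
      z ((h _).comp z h2).contDiffAt

theorem contractRight_ι' {V : Type*} [AddCommGroup V] [Module ℝ V] (v : V) (α : Module.Dual ℝ V) :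
    contractRight (ExteriorAlgebra.ι ℝ v) α = algebraMap ℝ (ExteriorAlgebra ℝ V) (α v) :=
  CliffordAlgebra.contractRight_ι _ _ _

theorem fderiv_ι_comp {V : E → E} {y : E} (hV : DifferentiableAt ℝ V y) (v : E) :
    fderiv ℝ (fun z => ExteriorAlgebra.ι ℝ (V z)) y v = ExteriorAlgebra.ι ℝ (fderiv ℝ V y v) := by
  have h := (extιL (E := E)).hasFDerivAt.comp y hV.hasFDerivAt
  exact congrArg (fun f => f v) h.fderiv

theorem differentiableAt_ι_comp {V : E → E} {y : E} (hV : DifferentiableAt ℝ V y) :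
    DifferentiableAt ℝ (fun z => ExteriorAlgebra.ι ℝ (V z)) y :=
  (extιL (E := E)).differentiableAt.comp y hV

theorem flatSchouten_ι_left {V : E → E} {Q : E → ExteriorAlgebra ℝ E} {y : E}
    (hV : DifferentiableAt ℝ V y) (hQ : DifferentiableAt ℝ Q y) :
    flatSchouten (fun z => ExteriorAlgebra.ι ℝ (V z)) Q y = fderiv ℝ Q y (V y) -
      ∑ i, ExteriorAlgebra.ι ℝ (fderiv ℝ V y (Module.finBasis ℝ E i)) *
        contractLeft ((Module.finBasis ℝ E).coord i) (Q y) := by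
  rw [flatSchouten_eq (differentiableAt_ι_comp hV) hQ, Finset.sum_sub_distrib]
  congr 1
  · conv_rhs => rw [← (Module.finBasis ℝ E).sum_repr (V y), map_sum]
    refine Finset.sum_congr rfl fun i _ => ?_
    rw [contractRight_ι', map_smul, Algebra.smul_def]
    rfl
  · exact Finset.sum_congr rfl fun i _ => by rw [fderiv_ι_comp hV]

/-- For a vector field the right contraction with dxⁱ is its i-th component. In this form condition
(ii) of soldering can be combined with the Leibniz and Jacobi rules. -/
theorem multiLie_eq_schouten (X : VField E M) {Q : MultiField E M} (hQ : IsSmoothMulti Q) :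
    multiLie X Q = schouten (vfieldMulti X) Q :=
  multiAt_ext fun x => by
    have hx := mem_extChartAt_target (I := 𝓘(ℝ, E)) x
    have hX := (X.contDiffAt_chart hx).differentiableAt (by simp)
    rw [multiAt_schouten, multiAt_multiLie, chartMulti_vfieldMulti,
      flatSchouten_ι_left hX (hQ.differentiableAt hx), flatLie,
      dirDeriv_eq (hQ.differentiableAt hx)]

theorem flatSchouten_ι_ι {V W : E → E} {y : E}
    (hV : DifferentiableAt ℝ V y) (hW : DifferentiableAt ℝ W y) :
    flatSchouten (fun z => ExteriorAlgebra.ι ℝ (V z)) (fun z => ExteriorAlgebra.ι ℝ (W z)) y =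
      ExteriorAlgebra.ι ℝ (VectorField.lieBracket ℝ V W y) := by
  rw [flatSchouten_ι_left hV (differentiableAt_ι_comp hW), fderiv_ι_comp hW,
    VectorField.lieBracket, map_sub]
  congr 1
  conv_rhs => rw [← (Module.finBasis ℝ E).sum_repr (W y), map_sum, map_sum]
  refine Finset.sum_congr rfl fun i _ => ?_
  have h : contractLeft ((Module.finBasis ℝ E).coord i) (ExteriorAlgebra.ι ℝ (W y)) =
      algebraMap ℝ (ExteriorAlgebra ℝ E) ((Module.finBasis ℝ E).coord i (W y)) :=
    CliffordAlgebra.contractLeft_ι _ _ _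
  rw [h, map_smul, map_smul, Algebra.smul_def, Algebra.commutes]
  rfl

theorem vecAt_bracket (X Y : VField E M) (x : M) :
    vecAt (⁅X, Y⁆ : VField E M) x = VectorField.lieBracket ℝ (chartVField X x) (chartVField Y x) (φ x x) := by
  have h : vecAt (⁅X, Y⁆ : VField E M) x = (chartDerivAt x x).inverse
      (VectorField.lieBracket ℝ (chartVField X x) (chartVField Y x) (φ x x)) := by
    have := VectorField.mlieBracketWithin_apply (I := 𝓘(ℝ, E)) (V := X) (W := Y)
      (s := Set.univ) (x₀ := x)
    simp only [modelWithCornersSelf_coe, Set.range_id, Set.preimage_univ, Set.inter_univ,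
      VectorField.mpullbackWithin_univ,
      VectorField.mlieBracketWithin_univ] at this
    rw [← VectorField.lieBracketWithin_univ]
    exact this
  rw [h, chartDerivAt_self, ContinuousLinearMap.inverse_id]
  rfl

/-- Together with `schouten_vfieldMulti_funMulti`, this makes vector fields and their action on
functions the part of degrees one and zero of the Gerstenhaber structure. -/
theorem vfieldMulti_bracket (X Y : VField E M) :
    vfieldMulti (⁅X, Y⁆ : VField E M) = schouten (vfieldMulti X) (vfieldMulti Y) :=
  multiAt_ext fun x => by
    have hx := mem_extChartAt_target (I := 𝓘(ℝ, E)) x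
    rw [multiAt_schouten, chartMulti_vfieldMulti, chartMulti_vfieldMulti, flatSchouten_ι_ι
      ((X.contDiffAt_chart hx).differentiableAt (by simp))
      ((Y.contDiffAt_chart hx).differentiableAt (by simp)), ← vecAt_bracket]
    rfl

theorem mfderiv_apply_vecAt {f : M → ℝ} (hf : MDifferentiable 𝓘(ℝ, E) 𝓘(ℝ) f) (x : M) (v : E) :
    mfderiv 𝓘(ℝ, E) 𝓘(ℝ) f x v = fderiv ℝ (fun z => f ((φ x).symm z)) (φ x x) v := by
  have h3 : MDifferentiableAt 𝓘(ℝ, E) 𝓘(ℝ) (fun y => f ((φ x).symm y)) (φ x x) := by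
    have := (mdifferentiableOn_extChartAt_symm (I := 𝓘(ℝ, E)) (x := x)).mdifferentiableAt
      (target_mem x)
    exact (hf _).comp _ this
  have h4 : MDifferentiableAt 𝓘(ℝ, E) 𝓘(ℝ, E) (φ x) x :=
    mdifferentiableAt_extChartAt (mem_chart_source E x)
  have h5 : f =ᶠ[𝓝 x] (fun y => f ((φ x).symm y)) ∘ (φ x) := by
    filter_upwards [extChartAt_source_mem_nhds (I := 𝓘(ℝ, E)) x] with z hz
    simp only [Function.comp_apply]
    rw [(φ x).left_inv hz]
  rw [h5.mfderiv_eq, mfderiv_comp x h3 h4, mfderiv_eq_fderiv]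
  exact congrArg (fun A : E →L[ℝ] E => fderiv ℝ (fun z => f ((φ x).symm z)) (φ x x) (A v))
    (chartDerivAt_self x)

theorem schouten_vfieldMulti_funMulti (X : VField E M) {f : M → ℝ}
    (hf : ContMDiff 𝓘(ℝ, E) 𝓘(ℝ) ∞ f) :
    schouten (vfieldMulti X) (funMulti f) =
      funMulti fun x => mfderiv 𝓘(ℝ, E) 𝓘(ℝ) f x (X x) :=
  multiAt_ext fun x => by
    have hx := mem_extChartAt_target (I := 𝓘(ℝ, E)) x
    have hs := (isSmoothMulti_funMulti_iff (E := E)).2 hf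
    have hd := hs.differentiableAt hx
    have hf' : DifferentiableAt ℝ (fun z => f ((φ x).symm z)) (φ x x) :=
      ((hf _).comp _ ((contMDiffOn_extChartAt_symm x).contMDiffAt
        (target_mem x))).contDiffAt.differentiableAt (by simp)
    rw [multiAt_schouten, chartMulti_vfieldMulti, flatSchouten_ι_left
      ((X.contDiffAt_chart hx).differentiableAt (by simp)) hd, ← vecAt_eq_chartVField]
    have h1 : ∀ i, contractLeft ((Module.finBasis ℝ E).coord i)
        (chartMulti (funMulti f) x (φ x x)) = 0 := fun i => by
      rw [chartMulti_funMulti]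
      exact CliffordAlgebra.contractLeft_algebraMap (Q := (0 : QuadraticForm ℝ E)) _ _
    simp only [h1, mul_zero, Finset.sum_const_zero, sub_zero]
    rw [chartMulti_funMulti]
    have h2 := ((Algebra.linearMap ℝ (ExteriorAlgebra ℝ E)).toContinuousLinearMap.hasFDerivAt.comp
      (φ x x) hf'.hasFDerivAt).fderiv
    refine (congrArg (fun A => A (vecAt X x)) h2).trans ?_
    exact congrArg (algebraMap ℝ (ExteriorAlgebra ℝ E))
      (mfderiv_apply_vecAt (hf.mdifferentiable (by simp)) x (vecAt X x)).symm

end Multivectors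

end

section

/-! ### Extension of locally defined functions and vector fields -/

section Extension

variable {E M : Type*} [NormedAddCommGroup E] [NormedSpace ℝ E] [FiniteDimensional ℝ E]
  [TopologicalSpace M] [ChartedSpace E M] [IsManifold 𝓘(ℝ, E) ∞ M] [T2Space M]

local notation "φ" => extChartAt 𝓘(ℝ, E)
local notation "τ" => tangentCoordChange 𝓘(ℝ, E)

theorem exists_bump (x₀ : M) {U : Set M} (hU : U ∈ 𝓝 x₀) :
    ∃ χ : M → ℝ, ContMDiff 𝓘(ℝ, E) 𝓘(ℝ) ∞ χ ∧ χ =ᶠ[𝓝 x₀] 1 ∧ tsupport χ ⊆ U := by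
  obtain ⟨f, -, hf⟩ := (SmoothBumpFunction.nhds_basis_tsupport (I := 𝓘(ℝ, E)) x₀).mem_iff.1 hU
  exact ⟨f, f.contMDiff, f.eventuallyEq_one, hf⟩

/-- The formula for `g` at every point, with `χ` zero off `U`, is recorded so that vanishing along
all of `N` need only be checked inside `U`. -/
theorem exists_contMDiff_extension (x₀ : M) {U : Set M} (hU : U ∈ 𝓝 x₀) {f : E → ℝ}
    (hf : ∀ᶠ z in 𝓝 (φ x₀ x₀), ContDiffAt ℝ ∞ f z) :
    ∃ g : M → ℝ, ContMDiff 𝓘(ℝ, E) 𝓘(ℝ) ∞ g ∧ (g =ᶠ[𝓝 x₀] fun p => f (φ x₀ p)) ∧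
      ∃ χ : M → ℝ, (∀ p, p ∉ U → χ p = 0) ∧ ∀ p, g p = χ p * f (φ x₀ p) := by
  have hU' : {p | p ∈ U ∧ p ∈ (φ x₀).source ∧ ContDiffAt ℝ ∞ f (φ x₀ p)} ∈ 𝓝 x₀ :=
    Filter.Eventually.and hU (Filter.Eventually.and (extChartAt_source_mem_nhds x₀)
      ((continuousAt_extChartAt x₀).eventually hf))
  obtain ⟨χ, hχ, hχ1, hχs⟩ := exists_bump (E := E) x₀ hU'
  refine ⟨fun p => χ p * f (φ x₀ p), fun p => ?_, ?_, χ, fun p hp => ?_, fun _ => rfl⟩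
  · by_cases hp : p ∈ tsupport χ
    · obtain ⟨-, hs, hc⟩ := hχs hp
      exact (hχ p).mul (hc.contMDiffAt.comp p (contMDiffAt_extChartAt'
        (by rwa [← extChartAt_source 𝓘(ℝ, E)])))
    · refine (contMDiffAt_const (c := (0 : ℝ))).congr_of_eventuallyEq ?_
      filter_upwards [(isClosed_tsupport χ).isOpen_compl.mem_nhds hp] with q hq
      rw [image_eq_zero_of_notMem_tsupport hq, zero_mul]
  · filter_upwards [hχ1] with p hp
    rw [hp, Pi.one_apply, one_mul]
  · exact image_eq_zero_of_notMem_tsupport fun h => hp (hχs h).1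

/-- As for functions, the formula at every point reduces normality along all of `N` to the points in
`U`. -/
theorem exists_vfield_extension (x₀ : M) {U : Set M} (hU : U ∈ 𝓝 x₀) {V : E → E}
    (hV : ∀ᶠ z in 𝓝 (φ x₀ x₀), ContDiffAt ℝ ∞ V z) :
    ∃ X : VField E M, (chartVField X x₀ =ᶠ[𝓝 (φ x₀ x₀)] V) ∧
      ∃ χ : M → ℝ, (∀ p, p ∉ U → χ p = 0) ∧
        ∀ p, vecAt X p = χ p • τ x₀ p p (V (φ x₀ p)) := by
  have hU' : {p | p ∈ U ∧ p ∈ (φ x₀).source ∧ ContDiffAt ℝ ∞ V (φ x₀ p)} ∈ 𝓝 x₀ :=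
    Filter.Eventually.and hU (Filter.Eventually.and (extChartAt_source_mem_nhds x₀)
      ((continuousAt_extChartAt x₀).eventually hV))
  obtain ⟨χ, hχ, hχ1, hχs⟩ := exists_bump (E := E) x₀ hU'
  have hsm : ∀ p, ContMDiffAt 𝓘(ℝ, E) 𝓘(ℝ, E).tangent ∞ (fun p => (⟨p,
      χ p • τ x₀ p p (V (φ x₀ p))⟩ : TangentBundle 𝓘(ℝ, E) M)) p := by
    intro p
    -- On the support of `χ` the field is read in the trivialization at `x₀`; off it the field is
    -- locally the zero section.
    by_cases hp : p ∈ tsupport χ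
    · obtain ⟨-, hs, hc⟩ := hχs hp
      refine ((trivializationAt E (TangentSpace 𝓘(ℝ, E)) x₀).contMDiffAt_section_iff
        (E := (TangentSpace 𝓘(ℝ, E) : M → Type _))
        (s := fun p => (χ p • τ x₀ p p (V (φ x₀ p)) : E)) (by simpa using hs)).2 ?_
      have h1 : ContMDiffAt 𝓘(ℝ, E) 𝓘(ℝ, E) ∞ (fun q => χ q • V (φ x₀ q)) p :=
        (hχ p).smul (hc.contMDiffAt.comp p (contMDiffAt_extChartAt'
          (by rwa [← extChartAt_source 𝓘(ℝ, E)])))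
      refine h1.congr_of_eventuallyEq ?_
      filter_upwards [(isOpen_extChartAt_source (I := 𝓘(ℝ, E)) x₀).mem_nhds hs] with q hq
      have h2 : τ q x₀ q (χ q • τ x₀ q q (V (φ x₀ q))) = χ q • V (φ x₀ q) := by
        rw [map_smul, tangentCoordChange_comp ⟨⟨hq, mem_extChartAt_source q⟩, hq⟩,
          tangentCoordChange_self hq]
      exact h2
    · refine (Bundle.contMDiff_zeroSection ℝ (TangentSpace 𝓘(ℝ, E) : M → Type _)
        p).congr_of_eventuallyEq ?_
      filter_upwards [(isClosed_tsupport χ).isOpen_compl.mem_nhds hp] with q hq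
      rw [image_eq_zero_of_notMem_tsupport hq, zero_smul]
      rfl
  refine ⟨⟨fun p => (χ p • τ x₀ p p (V (φ x₀ p)) : E), hsm⟩, ?_, χ, fun p hp => ?_, fun _ => rfl⟩
  · have h1 : ∀ᶠ z in 𝓝 (φ x₀ x₀), χ ((φ x₀).symm z) = 1 := by
      have := continuousAt_extChartAt_symm (I := 𝓘(ℝ, E)) x₀
      rw [ContinuousAt, extChartAt_to_inv] at this
      exact this.eventually hχ1
    filter_upwards [h1, target_mem x₀] with z hz hzt
    rw [chartVField_eq _ x₀ hzt]
    change τ ((φ x₀).symm z) x₀ ((φ x₀).symm z)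
      (χ ((φ x₀).symm z) • τ x₀ _ _ (V (φ x₀ ((φ x₀).symm z)))) = _
    have hs := (φ x₀).map_target hzt
    rw [hz, one_smul, tangentCoordChange_comp ⟨⟨hs, mem_extChartAt_source _⟩, hs⟩,
      tangentCoordChange_self hs, (φ x₀).right_inv hzt]
  · exact image_eq_zero_of_notMem_tsupport fun h => hp (hχs h).1

end Extension

/-! ### The local geometry of a normalized submanifold -/

namespace NormalizedSubmanifold

variable {E M F N : Type*} [NormedAddCommGroup E] [NormedSpace ℝ E] [FiniteDimensional ℝ E]
  [TopologicalSpace M] [ChartedSpace E M] [IsManifold 𝓘(ℝ, E) ∞ M]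
  [NormedAddCommGroup F] [NormedSpace ℝ F] [FiniteDimensional ℝ F]
  [TopologicalSpace N] [ChartedSpace F N] [IsManifold 𝓘(ℝ, F) ∞ N]
  (S : NormalizedSubmanifold E M F N)

local notation "φ" => extChartAt 𝓘(ℝ, E)
local notation "τ" => tangentCoordChange 𝓘(ℝ, E)

theorem contMDiff_incl : ContMDiff 𝓘(ℝ, F) 𝓘(ℝ, E) ∞ S.incl := S.isSmoothEmbedding.contMDiff

/-- In the charts of the immersion the inclusion is u ↦ (u, 0), and forgetting the second component
gives the retraction. It shows that dι is injective and extends data from `N` to a neighbourhood in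
`M`. -/
theorem exists_local_retraction (y₀ : N) :
    ∃ ρ : M → N, (∀ᶠ q in 𝓝 (S.incl y₀), ContMDiffAt 𝓘(ℝ, E) 𝓘(ℝ, F) ∞ ρ q) ∧
      ∀ᶠ y in 𝓝 y₀, ρ (S.incl y) = y := by
  have h := S.isSmoothEmbedding.isImmersion.isImmersionAt y₀
  have hw : ∀ y ∈ h.domChart.source,
      h.codChart (S.incl y) = h.equiv (h.domChart y, 0) := fun y hy => by
    have hm : h.domChart y ∈ (h.domChart.extend 𝓘(ℝ, F)).target := by
      simpa [OpenPartialHomeomorph.extend] using h.domChart.map_source hy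
    have := h.writtenInCharts hm
    simpa [h.domChart.left_inv hy] using this
  have hret : ∀ y ∈ h.domChart.source,
      h.domChart.symm (h.equiv.symm (h.codChart (S.incl y))).1 = y := fun y hy => by
    rw [hw y hy, ContinuousLinearEquiv.symm_apply_apply]
    exact h.domChart.left_inv hy
  refine ⟨fun q => h.domChart.symm (h.equiv.symm (h.codChart q)).1, ?_, ?_⟩
  · have hx := h.mem_codChart_source
    have hg : ∀ q ∈ h.codChart.source, ContMDiffAt 𝓘(ℝ, E) 𝓘(ℝ, F) ∞
        (fun q => (h.equiv.symm (h.codChart q)).1) q := fun q hq => by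
      have h1 : ContDiff ℝ ∞ (fun z => (h.equiv.symm z).1) :=
        contDiff_fst.comp h.equiv.symm.contDiff
      exact h1.contMDiff.contMDiffAt.comp q
        (contMDiffAt_of_mem_maximalAtlas h.codChart_mem_maximalAtlas hq)
    have h2 : ∀ᶠ q in 𝓝 (S.incl y₀), (h.equiv.symm (h.codChart q)).1 ∈ h.domChart.target := by
      refine (hg _ hx).continuousAt.eventually (h.domChart.open_target.mem_nhds ?_)
      beta_reduce
      rw [hw _ h.mem_domChart_source, ContinuousLinearEquiv.symm_apply_apply]
      exact h.domChart.map_source h.mem_domChart_source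
    filter_upwards [h.codChart.open_source.mem_nhds hx, h2] with q hq hq'
    exact (contMDiffAt_symm_of_mem_maximalAtlas h.domChart_mem_maximalAtlas hq').comp q (hg q hq)
  · filter_upwards [h.domChart.open_source.mem_nhds h.mem_domChart_source] with y hy
      using hret y hy

/-- The differential of the embedding, on the model spaces. -/
def dInclAt (y : N) : F →L[ℝ] E := S.dIncl y

/-- The tangent space of `N`, in the model space of `M`. -/
def tangentAt (y : N) : Submodule ℝ E := S.tangent y

/-- The normal space of `N`, in the model space of `M`. -/
def normalAt (y : N) : Submodule ℝ E := S.normal y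

theorem dInclAt_mem (y : N) (w : F) : S.dInclAt y w ∈ S.tangentAt y := ⟨w, rfl⟩

theorem isComplAt (y : N) : IsCompl (S.tangentAt y) (S.normalAt y) := S.isCompl y

theorem dInclAt_injective (y : N) : Function.Injective (S.dInclAt y) := by
  obtain ⟨ρ, h1, h2⟩ := S.exists_local_retraction y
  have hρ := (h1.self_of_nhds).mdifferentiableAt (by simp)
  have hi := (S.contMDiff_incl y).mdifferentiableAt (by simp)
  have h3 := mfderiv_comp y hρ hi
  have h4 : (ρ ∘ S.incl) =ᶠ[𝓝 y] id := h2
  rw [h4.mfderiv_eq, mfderiv_id] at h3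
  intro v w hvw
  have h5 : ∀ u : F, u = (mfderiv 𝓘(ℝ, E) 𝓘(ℝ, F) ρ (S.incl y) : E →L[ℝ] F) (S.dInclAt y u) :=
    fun u => congrArg (fun A : F →L[ℝ] F => A u) h3
  rw [h5 v, h5 w, hvw]

/-- The projection to the tangent space of `N` along the normal space. -/
def proj (y : N) : E →L[ℝ] E :=
  LinearMap.toContinuousLinearMap ((S.tangentAt y).projection (S.normalAt y) (S.isComplAt y))

theorem proj_of_mem_tangentAt {y : N} {v : E} (hv : v ∈ S.tangentAt y) : S.proj y v = v :=
  Submodule.projection_apply_of_mem_left (S.isComplAt y) hv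

theorem proj_mem_tangentAt (y : N) (v : E) : S.proj y v ∈ S.tangentAt y :=
  Submodule.projection_apply_mem (S.isComplAt y) v

theorem proj_eq_zero_iff {y : N} {v : E} : S.proj y v = 0 ↔ v ∈ S.normalAt y :=
  Submodule.projection_apply_eq_zero_iff (S.isComplAt y)

theorem proj_proj (y : N) (v : E) : S.proj y (S.proj y v) = S.proj y v :=
  S.proj_of_mem_tangentAt (S.proj_mem_tangentAt y v)

theorem sub_proj_mem (y : N) (v : E) : v - S.proj y v ∈ S.normalAt y := by
  rw [← S.proj_eq_zero_iff, map_sub, proj_proj, sub_self]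

theorem ker_proj (y : N) : LinearMap.ker (S.proj y).toLinearMap = S.normalAt y :=
  Submodule.ker_projection (S.isComplAt y)

theorem isIdempotentElem_proj (y : N) : IsIdempotentElem (S.proj y).toLinearMap :=
  LinearMap.ext fun v => S.proj_proj y v

/-- The embedding, read in the preferred charts at `y₀` and at its image. -/
def inclChart (y₀ : N) : F → E := fun u => φ (S.incl y₀) (S.incl ((extChartAt 𝓘(ℝ, F) y₀).symm u))

theorem contDiffAt_inclChart {y₀ y : N} (hy : y ∈ (extChartAt 𝓘(ℝ, F) y₀).source)
    (hy' : S.incl y ∈ (φ (S.incl y₀)).source) :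
    ContDiffAt ℝ ∞ (S.inclChart y₀) (extChartAt 𝓘(ℝ, F) y₀ y) := by
  have h0 := (extChartAt 𝓘(ℝ, F) y₀).left_inv hy
  have h1 : ContMDiffAt 𝓘(ℝ, F) 𝓘(ℝ, F) ∞ (extChartAt 𝓘(ℝ, F) y₀).symm (extChartAt 𝓘(ℝ, F) y₀ y) :=
    (contMDiffOn_extChartAt_symm y₀).contMDiffAt ((isOpen_extChartAt_target y₀).mem_nhds
      ((extChartAt 𝓘(ℝ, F) y₀).map_source hy))
  have h2 : ContMDiffAt 𝓘(ℝ, E) 𝓘(ℝ, E) ∞ (φ (S.incl y₀)) (S.incl y) :=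
    contMDiffAt_extChartAt' (by rwa [← extChartAt_source 𝓘(ℝ, E)])
  rw [← h0] at h2
  have h3 := (S.contMDiff_incl _).comp (extChartAt 𝓘(ℝ, F) y₀ y) h1
  exact (ContMDiffAt.comp (extChartAt 𝓘(ℝ, F) y₀ y) h2 h3).contDiffAt

theorem fderiv_inclChart {y₀ y : N} (hy : y ∈ (extChartAt 𝓘(ℝ, F) y₀).source)
    (hy' : S.incl y ∈ (φ (S.incl y₀)).source) :
    fderiv ℝ (S.inclChart y₀) (extChartAt 𝓘(ℝ, F) y₀ y) =
      (τ (S.incl y) (S.incl y₀) (S.incl y)).comp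
        ((S.dInclAt y).comp (tangentCoordChange 𝓘(ℝ, F) y₀ y y)) := by
  have h0 := (extChartAt 𝓘(ℝ, F) y₀).left_inv hy
  have hyt := (extChartAt 𝓘(ℝ, F) y₀).map_source hy
  have h1 : MDifferentiableAt 𝓘(ℝ, F) 𝓘(ℝ, F) (extChartAt 𝓘(ℝ, F) y₀).symm
      (extChartAt 𝓘(ℝ, F) y₀ y) :=
    ((contMDiffOn_extChartAt_symm (n := ∞) y₀).contMDiffAt ((isOpen_extChartAt_target y₀).mem_nhds
      hyt)).mdifferentiableAt (by simp)
  have h2 : MDifferentiableAt 𝓘(ℝ, E) 𝓘(ℝ, E) (φ (S.incl y₀)) (S.incl y) :=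
    mdifferentiableAt_extChartAt (by rwa [← extChartAt_source 𝓘(ℝ, E)])
  have hi : MDifferentiableAt 𝓘(ℝ, F) 𝓘(ℝ, E) S.incl y :=
    (S.contMDiff_incl y).mdifferentiableAt (by simp)
  have e1 := chartInvDerivAt_eq y₀ hyt
  rw [h0] at e1
  rw [← mfderiv_eq_fderiv, ← chartDerivAt_eq hy', ← e1]
  have hi' := hi
  rw [← h0] at h2 hi'
  have h3 := mfderiv_comp (extChartAt 𝓘(ℝ, F) y₀ y) h2 (hi'.comp _ h1)
  rw [mfderiv_comp _ hi' h1] at h3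
  have e2 : S.dInclAt ((extChartAt 𝓘(ℝ, F) y₀).symm (extChartAt 𝓘(ℝ, F) y₀ y)) = S.dInclAt y := by
    rw [h0]
  have e3 : chartDerivAt (E := E) (S.incl y₀) (S.incl ((extChartAt 𝓘(ℝ, F) y₀).symm
      (extChartAt 𝓘(ℝ, F) y₀ y))) = chartDerivAt (S.incl y₀) (S.incl y) := by rw [h0]
  rw [← e2, ← e3]
  exact h3

end NormalizedSubmanifold

end

section

/-! ### The bundle of projections to the tangent spaces of a normalized submanifold -/

section Frames

variable {E F : Type*} [NormedAddCommGroup E] [NormedSpace ℝ E] [FiniteDimensional ℝ E]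
  [NormedAddCommGroup F] [NormedSpace ℝ F] [FiniteDimensional ℝ F] {r : ℕ}

/-- The linear map `(w, c) ↦ D w + ∑ c_j n_j`. -/
def frameMap (p : (F →L[ℝ] E) × (Fin r → E)) : F × (Fin r → ℝ) →L[ℝ] E :=
  p.1.comp (ContinuousLinearMap.fst ℝ F (Fin r → ℝ)) +
    ∑ j, ((ContinuousLinearMap.proj (R := ℝ) (φ := fun _ : Fin r => ℝ) j).comp
      (ContinuousLinearMap.snd ℝ F (Fin r → ℝ))).smulRight (p.2 j)

theorem frameMap_apply (p : (F →L[ℝ] E) × (Fin r → E)) (w : F) (c : Fin r → ℝ) :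
    frameMap p (w, c) = p.1 w + ∑ j, c j • p.2 j := by
  simp [frameMap, sum_apply]

theorem contDiff_frameMap : ContDiff ℝ ∞ (frameMap (E := E) (F := F) (r := r)) := by
  refine (contDiff_fst.clm_comp contDiff_const).add (ContDiff.sum fun j _ => ?_)
  exact ((ContinuousLinearMap.smulRightL ℝ (F × (Fin r → ℝ)) E
    ((ContinuousLinearMap.proj (R := ℝ) (φ := fun _ : Fin r => ℝ) j).comp
      (ContinuousLinearMap.snd ℝ F (Fin r → ℝ)))).contDiff).comp
    ((contDiff_apply ℝ E j).comp contDiff_snd)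

/-- The projection to the first part of a frame along the second one. -/
def frameProj (p : (F →L[ℝ] E) × (Fin r → E)) : E →L[ℝ] E :=
  (p.1.comp (ContinuousLinearMap.fst ℝ F (Fin r → ℝ))).comp (frameMap p).inverse

/-- Inversion is smooth at invertible linear maps, and the projection is built from the frame and
its inverse. -/
theorem contDiffAt_frameProj {p : (F →L[ℝ] E) × (Fin r → E)} (hp : (frameMap p).IsInvertible) :
    ContDiffAt ℝ ∞ frameProj p :=
  have : CompleteSpace F := FiniteDimensional.complete ℝ F
  (contDiffAt_fst.clm_comp contDiffAt_const).clm_comp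
    (hp.contDiffAt_map_inverse.comp p contDiff_frameMap.contDiffAt)

theorem isInvertible_of_bijective {G : Type*} [NormedAddCommGroup G] [NormedSpace ℝ G]
    [FiniteDimensional ℝ G] {A : G →L[ℝ] E} (hA : Function.Bijective A) : A.IsInvertible :=
  ⟨(LinearEquiv.ofBijective A.toLinearMap hA).toContinuousLinearEquiv, by ext; rfl⟩

end Frames

/-! ### Smoothness of the tangential projection and its extension off the submanifold -/

namespace NormalizedSubmanifold

variable {E M F N : Type*} [NormedAddCommGroup E] [NormedSpace ℝ E] [FiniteDimensional ℝ E]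
  [TopologicalSpace M] [ChartedSpace E M] [IsManifold 𝓘(ℝ, E) ∞ M]
  [NormedAddCommGroup F] [NormedSpace ℝ F] [FiniteDimensional ℝ F]
  [TopologicalSpace N] [ChartedSpace F N] [IsManifold 𝓘(ℝ, F) ∞ N]
  (S : NormalizedSubmanifold E M F N)

local notation "φ" => extChartAt 𝓘(ℝ, E)
local notation "τ" => tangentCoordChange 𝓘(ℝ, E)

/-- The projection to the tangent space of `N` at `y`, read in the chart at the image of `y₀`. -/
def chartProj (y₀ y : N) : E →L[ℝ] E :=
  (τ (S.incl y) (S.incl y₀) (S.incl y)).comp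
    ((S.proj y).comp (τ (S.incl y₀) (S.incl y) (S.incl y)))

theorem chartProj_comp {y₀ y : N} (hy : S.incl y ∈ (φ (S.incl y₀)).source) :
    (S.chartProj y₀ y).comp (τ (S.incl y) (S.incl y₀) (S.incl y)) =
      (τ (S.incl y) (S.incl y₀) (S.incl y)).comp (S.proj y) := by
  have hs := mem_extChartAt_source (I := 𝓘(ℝ, E)) (S.incl y)
  rw [chartProj, ContinuousLinearMap.comp_assoc, ContinuousLinearMap.comp_assoc,
    tangentCoordChange_comp' hs hy hs, tangentCoordChange_self' hs, ContinuousLinearMap.comp_id]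

theorem chartProj_self (y₀ : N) : S.chartProj y₀ y₀ = S.proj y₀ := by
  rw [chartProj, tangentCoordChange_self' (mem_extChartAt_source (I := 𝓘(ℝ, E)) (S.incl y₀))]
  rfl

theorem chartProj_chartProj {y₀ y : N} (hy : S.incl y ∈ (φ (S.incl y₀)).source) (v : E) :
    S.chartProj y₀ y (S.chartProj y₀ y v) = S.chartProj y₀ y v := by
  have h := congrArg (fun A : E →L[ℝ] E =>
    A (S.proj y (τ (S.incl y₀) (S.incl y) (S.incl y) v))) (S.chartProj_comp hy)
  refine h.trans ?_
  change τ (S.incl y) (S.incl y₀) (S.incl y) (S.proj y (S.proj y _)) = _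
  rw [S.proj_proj]
  rfl

theorem eventually_mem_source (y₀ : N) : ∀ᶠ y in 𝓝 y₀,
    y ∈ (extChartAt 𝓘(ℝ, F) y₀).source ∧ S.incl y ∈ (φ (S.incl y₀)).source :=
  Filter.Eventually.and (extChartAt_source_mem_nhds y₀)
    ((S.contMDiff_incl.continuous.tendsto y₀).eventually (extChartAt_source_mem_nhds (S.incl y₀)))

theorem contMDiffAt_fderiv_inclChart {y₀ y : N} (hy : y ∈ (extChartAt 𝓘(ℝ, F) y₀).source)
    (hy' : S.incl y ∈ (φ (S.incl y₀)).source) :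
    ContMDiffAt 𝓘(ℝ, F) 𝓘(ℝ, F →L[ℝ] E) ∞
      (fun y => fderiv ℝ (S.inclChart y₀) (extChartAt 𝓘(ℝ, F) y₀ y)) y := by
  have h1 : ContDiffAt ℝ ∞ (fderiv ℝ (S.inclChart y₀)) (extChartAt 𝓘(ℝ, F) y₀ y) :=
    (S.contDiffAt_inclChart hy hy').fderiv_right (by simp)
  exact h1.contMDiffAt.comp y (contMDiffAt_extChartAt' (by rwa [← extChartAt_source 𝓘(ℝ, F)]))

theorem contMDiffAt_section_chart {y₀ y : N} {s : (y : N) → TangentSpace 𝓘(ℝ, E) (S.incl y)}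
    (hs : ContMDiffAt 𝓘(ℝ, F) 𝓘(ℝ, E).tangent ∞
      (fun y => (⟨S.incl y, s y⟩ : TangentBundle 𝓘(ℝ, E) M)) y)
    (hy' : S.incl y ∈ (φ (S.incl y₀)).source) :
    ContMDiffAt 𝓘(ℝ, F) 𝓘(ℝ, E) ∞
      (fun y => τ (S.incl y) (S.incl y₀) (S.incl y) (s y)) y :=
  (((trivializationAt E (TangentSpace 𝓘(ℝ, E)) (S.incl y₀)).contMDiffAt_iff
    (by simpa [Bundle.Trivialization.mem_source] using hy')).1 hs).2

/-- In the chart, the derivative of the inclusion and a local frame of νN together form a smoothly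
varying invertible map F × ℝ^r → E, because TN and νN are complementary. The projection is a smooth
function of this map. -/
theorem eventually_contMDiffAt_chartProj (y₀ : N) : ∀ᶠ y in 𝓝 y₀,
    ContMDiffAt 𝓘(ℝ, F) 𝓘(ℝ, E →L[ℝ] E) ∞ (S.chartProj y₀) y := by
  obtain ⟨r, s, U, hU, hs, hspan⟩ := S.smooth y₀
  let D : N → F →L[ℝ] E := fun y => fderiv ℝ (S.inclChart y₀) (extChartAt 𝓘(ℝ, F) y₀ y)
  let n : N → Fin r → E := fun y j => τ (S.incl y) (S.incl y₀) (S.incl y) (s j y)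
  have hev : ∀ᶠ y in 𝓝 y₀, y ∈ U ∧ y ∈ (extChartAt 𝓘(ℝ, F) y₀).source ∧
    S.incl y ∈ (φ (S.incl y₀)).source := Filter.Eventually.and hU (S.eventually_mem_source y₀)
  have hfr : ∀ y, (y ∈ U ∧ y ∈ (extChartAt 𝓘(ℝ, F) y₀).source ∧
      S.incl y ∈ (φ (S.incl y₀)).source) →
      (frameMap (D y, n y)).IsInvertible ∧ S.chartProj y₀ y = frameProj (D y, n y) := by
    rintro y ⟨hyU, hy, hy'⟩
    obtain ⟨hli, hsp⟩ := hspan y hyU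
    have hys := mem_extChartAt_source (I := 𝓘(ℝ, E)) (S.incl y)
    set T := τ (S.incl y) (S.incl y₀) (S.incl y) with hT
    set T' := τ (S.incl y₀) (S.incl y) (S.incl y) with hT'
    have hTT' : T.comp T' = .id ℝ E := by
      rw [hT, hT', tangentCoordChange_comp' hy' hys hy', tangentCoordChange_self' hy']
    have hT'T : T'.comp T = .id ℝ E := by
      rw [hT, hT', tangentCoordChange_comp' hys hy' hys, tangentCoordChange_self' hys]
    set C := tangentCoordChange 𝓘(ℝ, F) y₀ y y with hC
    have hCb : Function.Bijective C := by
      obtain ⟨e, he⟩ := tangentCoordChange_isInvertible (E := F) hy (mem_extChartAt_source y)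
      rw [hC, ← he]
      exact e.bijective
    have hTinj : Function.Injective T := fun a b hab => by
      have := congrArg T' hab
      have h2 : ∀ v, T' (T v) = v := fun v => congrArg (fun A : E →L[ℝ] E => A v) hT'T
      rwa [h2, h2] at this
    have hD : ∀ w, D y w = T (S.dInclAt y (C w)) := fun w =>
      congrArg (fun A : F →L[ℝ] E => A w) (S.fderiv_inclChart hy hy')
    let s' : Fin r → E := fun j => s j y
    have hn : ∀ c : Fin r → ℝ, ∑ j, c j • n y j = T (∑ j, c j • s' j) := fun c => by
      rw [map_sum]
      exact Finset.sum_congr rfl fun j _ => (map_smul T (c j) (s' j)).symm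
    have hsp' : Submodule.span ℝ (Set.range s') = S.normalAt y := hsp
    have hli' : LinearIndependent ℝ s' := hli
    have hmem : ∀ c : Fin r → ℝ, ∑ j, c j • s' j ∈ S.normalAt y := fun c => by
      rw [← hsp']
      exact Submodule.sum_mem _ fun j _ => Submodule.smul_mem _ _ (Submodule.subset_span ⟨j, rfl⟩)
    have happ : ∀ w c, frameMap (D y, n y) (w, c) =
        T (S.dInclAt y (C w) + ∑ j, c j • s' j) := fun w c => by
      rw [frameMap_apply, map_add, ← hD, hn]
    have hbij : Function.Bijective (frameMap (D y, n y)) := by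
      constructor
      · rw [injective_iff_map_eq_zero]
        rintro ⟨w, c⟩ hwc
        rw [happ, map_eq_zero_iff T hTinj] at hwc
        have h1 : S.dInclAt y (C w) = 0 := by
          rw [← S.proj_of_mem_tangentAt (S.dInclAt_mem y (C w)), eq_neg_of_add_eq_zero_left hwc,
            map_neg, S.proj_eq_zero_iff.2 (hmem c), neg_zero]
        rw [h1, zero_add] at hwc
        have h2 : w = 0 := hCb.1 (S.dInclAt_injective y (by rw [h1, map_zero, map_zero]))
        have h3 : c = 0 := funext (Fintype.linearIndependent_iff.1 hli' c hwc)
        rw [h2, h3]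
        rfl
      · intro v
        obtain ⟨w, hw⟩ := S.proj_mem_tangentAt y (T' v)
        obtain ⟨w', rfl⟩ := hCb.2 w
        have h2 := S.sub_proj_mem y (T' v)
        rw [← hsp', Submodule.mem_span_range_iff_exists_fun] at h2
        obtain ⟨c, hc⟩ := h2
        refine ⟨(w', c), ?_⟩
        rw [happ, hc]
        have hw' : S.dInclAt y (C w') = S.proj y (T' v) := hw
        rw [hw', add_sub_cancel]
        exact congrArg (fun A : E →L[ℝ] E => A v) hTT'
    have hinv := isInvertible_of_bijective hbij
    refine ⟨hinv, ?_⟩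
    ext v
    obtain ⟨⟨w, c⟩, rfl⟩ := hbij.2 v
    have h1 : frameProj (D y, n y) (frameMap (D y, n y) (w, c)) = D y w := by
      change D y (((frameMap (D y, n y)).inverse (frameMap (D y, n y) (w, c))).1) = _
      rw [hinv.inverse_apply_self]
    have h2 := congrArg (fun A : E →L[ℝ] E => A (S.dInclAt y (C w) + ∑ j, c j • s' j))
      (S.chartProj_comp hy')
    rw [h1, happ]
    refine h2.trans ?_
    change T (S.proj y _) = _
    rw [map_add, S.proj_of_mem_tangentAt (S.dInclAt_mem y (C w)),
      S.proj_eq_zero_iff.2 (hmem c), add_zero, hD]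
  -- Smoothness at `y` needs the identification with `frameProj` on a neighbourhood of `y`, hence
  -- the nested eventuality.
  filter_upwards [eventually_eventually_nhds.2 hev] with y hy
  obtain ⟨hyU, hy1, hy2⟩ := hy.self_of_nhds
  have hUy : U ∈ 𝓝 y := hy.mono fun _ h => h.1
  have hn : ContMDiffAt 𝓘(ℝ, F) 𝓘(ℝ, Fin r → E) ∞ n y := contMDiffAt_pi_space.2 fun j =>
    S.contMDiffAt_section_chart ((hs j).contMDiffAt hUy) hy2
  have h := (contDiffAt_frameProj (hfr y ⟨hyU, hy1, hy2⟩).1).contMDiffAt.comp y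
    ((S.contMDiffAt_fderiv_inclChart hy1 hy2).prodMk_space hn)
  refine h.congr_of_eventuallyEq ?_
  filter_upwards [hy] with y' hy'
  exact (hfr y' hy').2

/-- Precompose the projection along `N` with the local retraction: the value at z is the projection
at the retracted point, so it stays idempotent off `N`. -/
theorem exists_chart_projection (y₀ : N) : ∃ K : E → E →L[ℝ] E,
    (∀ᶠ z in 𝓝 (φ (S.incl y₀) (S.incl y₀)), ContDiffAt ℝ ∞ K z) ∧
    (∀ᶠ z in 𝓝 (φ (S.incl y₀) (S.incl y₀)), ∀ v, K z (K z v) = K z v) ∧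
    ∀ᶠ y in 𝓝 y₀, K (φ (S.incl y₀) (S.incl y)) = S.chartProj y₀ y := by
  obtain ⟨ρ, h1, h2⟩ := S.exists_local_retraction y₀
  set x₀ := S.incl y₀ with hx₀
  have hc : Filter.Tendsto (φ x₀).symm (𝓝 (φ x₀ x₀)) (𝓝 x₀) := by
    have := continuousAt_extChartAt_symm (I := 𝓘(ℝ, E)) x₀
    rwa [ContinuousAt, extChartAt_to_inv] at this
  have hcρ : Filter.Tendsto ρ (𝓝 x₀) (𝓝 y₀) := by
    have := h1.self_of_nhds.continuousAt
    rwa [ContinuousAt, h2.self_of_nhds] at this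
  refine ⟨fun z => S.chartProj y₀ (ρ ((φ x₀).symm z)), ?_, ?_, ?_⟩
  · filter_upwards [target_mem x₀, hc.eventually h1,
      hc.eventually (hcρ.eventually (S.eventually_contMDiffAt_chartProj y₀))] with z hz hz1 hz2
    have h3 : ContMDiffAt 𝓘(ℝ, E) 𝓘(ℝ, E) ∞ (φ x₀).symm z :=
      (contMDiffOn_extChartAt_symm x₀).contMDiffAt ((isOpen_extChartAt_target x₀).mem_nhds hz)
    exact (ContMDiffAt.comp z hz2 (ContMDiffAt.comp z hz1 h3)).contDiffAt
  · filter_upwards [hc.eventually (hcρ.eventually (S.eventually_mem_source y₀))] with z hz v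
    exact S.chartProj_chartProj hz.2 v
  · filter_upwards [h2, S.eventually_mem_source y₀] with y hy hy'
    rw [(φ x₀).left_inv hy'.2, hy]

/-- A tangent vector is dι of some `w`, and `g` composed with the inclusion is locally zero. -/
theorem fderiv_eq_zero_of_eventually {G : Type*} [NormedAddCommGroup G] [NormedSpace ℝ G]
    {y₀ : N} {g : E → G} (hg : DifferentiableAt ℝ g (φ (S.incl y₀) (S.incl y₀)))
    (h0 : ∀ᶠ y in 𝓝 y₀, g (φ (S.incl y₀) (S.incl y)) = 0) {v : E} (hv : v ∈ S.tangentAt y₀) :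
    fderiv ℝ g (φ (S.incl y₀) (S.incl y₀)) v = 0 := by
  obtain ⟨w, rfl⟩ := hv
  have hs := mem_extChartAt_source (I := 𝓘(ℝ, F)) y₀
  have hs' := mem_extChartAt_source (I := 𝓘(ℝ, E)) (S.incl y₀)
  have hi := (S.contDiffAt_inclChart hs hs').differentiableAt (by simp)
  have hi0 : S.inclChart y₀ (extChartAt 𝓘(ℝ, F) y₀ y₀) = φ (S.incl y₀) (S.incl y₀) := by
    rw [inclChart, extChartAt_to_inv]
  rw [← hi0] at hg
  have h1 := fderiv_comp _ hg hi
  have hc := continuousAt_extChartAt_symm (I := 𝓘(ℝ, F)) y₀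
  rw [ContinuousAt, extChartAt_to_inv] at hc
  have h2 : g ∘ S.inclChart y₀ =ᶠ[𝓝 (extChartAt 𝓘(ℝ, F) y₀ y₀)] fun _ => 0 :=
    hc.eventually h0
  rw [h2.fderiv_eq, S.fderiv_inclChart hs hs', tangentCoordChange_self' hs,
    tangentCoordChange_self' hs', hi0, fderiv_const_apply] at h1
  exact (congrArg (fun A : F →L[ℝ] G => A w) h1).symm

/-- Here the embedding is used, not just the immersion: `N` has the induced topology, so no distant
part of `N` enters a small neighbourhood in `M`. -/
theorem exists_mem_nhds_of_eventually {y₀ : N} {p : N → Prop} (hp : ∀ᶠ y in 𝓝 y₀, p y) :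
    ∃ U ∈ 𝓝 (S.incl y₀), ∀ y, S.incl y ∈ U → p y := by
  rw [S.isSmoothEmbedding.isEmbedding.isInducing.nhds_eq_comap, Filter.eventually_comap] at hp
  exact ⟨_, hp, fun y hy => hy y rfl⟩

/-! ### Global normal fields and functions vanishing on the submanifold -/

variable [T2Space M]

/-- Along `N` near `y₀`, the field u - K u is the normal component of u in the chart. It is cut off
inside a neighbourhood on which every point of `N` has this property; elsewhere on `N` the field is
zero, hence normal. -/
theorem exists_normal_vfield {y₀ : N} {K : E → E →L[ℝ] E}
    (hK : ∀ᶠ z in 𝓝 (φ (S.incl y₀) (S.incl y₀)), ContDiffAt ℝ ∞ K z)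
    (hKN : ∀ᶠ y in 𝓝 y₀, K (φ (S.incl y₀) (S.incl y)) = S.chartProj y₀ y) (u : E) :
    ∃ X : VField E M, S.IsNormal X ∧
      chartVField X (S.incl y₀) =ᶠ[𝓝 (φ (S.incl y₀) (S.incl y₀))] fun z => u - K z u := by
  obtain ⟨U, hU, hUp⟩ := S.exists_mem_nhds_of_eventually (hKN.and (S.eventually_mem_source y₀))
  obtain ⟨X, hX, χ, hχ, hXχ⟩ := exists_vfield_extension (S.incl y₀) hU
    (V := fun z => u - K z u) (hK.mono fun z hz => contDiffAt_const.sub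
      (hz.clm_apply contDiffAt_const))
  refine ⟨X, fun y => ?_, hX⟩
  change vecAt X (S.incl y) ∈ S.normalAt y
  rw [hXχ]
  by_cases hy : S.incl y ∈ U
  · obtain ⟨h1, -, h2⟩ := hUp y hy
    rw [h1]
    refine Submodule.smul_mem _ _ ?_
    have hys := mem_extChartAt_source (I := 𝓘(ℝ, E)) (S.incl y)
    have h3 : ∀ v, τ (S.incl y₀) (S.incl y) (S.incl y)
        (τ (S.incl y) (S.incl y₀) (S.incl y) v) = v := fun v => by
      rw [tangentCoordChange_comp ⟨⟨hys, h2⟩, hys⟩, tangentCoordChange_self hys]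
    have h4 : τ (S.incl y₀) (S.incl y) (S.incl y) (S.chartProj y₀ y u) =
        S.proj y (τ (S.incl y₀) (S.incl y) (S.incl y) u) := h3 _
    rw [map_sub, h4]
    exact S.sub_proj_mem y _
  · rw [hχ _ hy, zero_smul]
    exact Submodule.zero_mem _

/-- In the chart take f(z) = α(z - ι(ρ(z))), with ρ the local retraction, and cut it off. It is zero
on `N`, and its differential is α - α ∘ dι ∘ dρ, which equals `α` because `α` kills TN. -/
theorem exists_vanishing_function {y₀ : N} {α : E →L[ℝ] ℝ} (hα : ∀ v ∈ S.tangentAt y₀, α v = 0) :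
    ∃ f : M → ℝ, ContMDiff 𝓘(ℝ, E) 𝓘(ℝ) ∞ f ∧ (∀ y, f (S.incl y) = 0) ∧
      fderiv ℝ (fun z => f ((φ (S.incl y₀)).symm z)) (φ (S.incl y₀) (S.incl y₀)) = α := by
  obtain ⟨ρ, h1, h2⟩ := S.exists_local_retraction y₀
  obtain ⟨U, hU, hUp⟩ := S.exists_mem_nhds_of_eventually (h2.and (S.eventually_mem_source y₀))
  set x₀ := S.incl y₀ with hx₀
  have hc : Filter.Tendsto (φ x₀).symm (𝓝 (φ x₀ x₀)) (𝓝 x₀) := by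
    have := continuousAt_extChartAt_symm (I := 𝓘(ℝ, E)) x₀
    rwa [ContinuousAt, extChartAt_to_inv] at this
  have hcρ : Filter.Tendsto ρ (𝓝 x₀) (𝓝 y₀) := by
    have := h1.self_of_nhds.continuousAt
    rwa [ContinuousAt, h2.self_of_nhds] at this
  let η : E → F := fun z => extChartAt 𝓘(ℝ, F) y₀ (ρ ((φ x₀).symm z))
  have hη : ∀ᶠ z in 𝓝 (φ x₀ x₀), ContDiffAt ℝ ∞ η z ∧ ContDiffAt ℝ ∞ (S.inclChart y₀) (η z) := by
    filter_upwards [target_mem x₀, hc.eventually h1,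
      hc.eventually (hcρ.eventually (S.eventually_mem_source y₀))] with z hz hz1 hz2
    have h3 : ContMDiffAt 𝓘(ℝ, E) 𝓘(ℝ, E) ∞ (φ x₀).symm z :=
      (contMDiffOn_extChartAt_symm x₀).contMDiffAt ((isOpen_extChartAt_target x₀).mem_nhds hz)
    have h4 : ContMDiffAt 𝓘(ℝ, F) 𝓘(ℝ, F) ∞ (extChartAt 𝓘(ℝ, F) y₀) (ρ ((φ x₀).symm z)) :=
      contMDiffAt_extChartAt' (by rw [← extChartAt_source 𝓘(ℝ, F)]; exact hz2.1)
    exact ⟨(ContMDiffAt.comp z h4 (ContMDiffAt.comp z hz1 h3)).contDiffAt,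
      S.contDiffAt_inclChart hz2.1 hz2.2⟩
  let g : E → ℝ := fun z => α (z - S.inclChart y₀ (η z))
  have hg : ∀ᶠ z in 𝓝 (φ x₀ x₀), ContDiffAt ℝ ∞ g z := by
    filter_upwards [hη] with z hz
    exact α.contDiff.contDiffAt.comp z (contDiffAt_id.sub (hz.2.comp z hz.1))
  obtain ⟨f, hf, hfg, χ, hχ, hfχ⟩ := exists_contMDiff_extension x₀ hU hg
  refine ⟨f, hf, fun y => ?_, ?_⟩
  · rw [hfχ]
    by_cases hy : S.incl y ∈ U
    · obtain ⟨h3, h4, h5⟩ := hUp y hy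
      have h6 : g (φ x₀ (S.incl y)) = 0 := by
        simp only [g, η, inclChart]
        rw [(φ x₀).left_inv h5, h3, (extChartAt 𝓘(ℝ, F) y₀).left_inv h4, sub_self, map_zero]
      rw [h6, mul_zero]
    · rw [hχ _ hy, zero_mul]
  · have h3 : (fun z => f ((φ x₀).symm z)) =ᶠ[𝓝 (φ x₀ x₀)] g := by
      filter_upwards [hc.eventually hfg, target_mem x₀] with z hz hzt
      rw [hz, (φ x₀).right_inv hzt]
    rw [h3.fderiv_eq]
    obtain ⟨hη1, hη2⟩ := hη.self_of_nhds
    have hη0 : η (φ x₀ x₀) = extChartAt 𝓘(ℝ, F) y₀ y₀ := by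
      simp only [η]
      rw [extChartAt_to_inv, h2.self_of_nhds]
    have h4 := ((hη2.differentiableAt (by simp)).hasFDerivAt.comp (φ x₀ x₀)
      (hη1.differentiableAt (by simp)).hasFDerivAt)
    have h5 := (α.hasFDerivAt.comp (φ x₀ x₀) ((hasFDerivAt_id (𝕜 := ℝ) (φ x₀ x₀)).sub h4)).fderiv
    refine h5.trans ?_
    ext v
    rw [hη0, S.fderiv_inclChart (mem_extChartAt_source y₀) (mem_extChartAt_source (S.incl y₀)),
      tangentCoordChange_self' (mem_extChartAt_source (S.incl y₀)),
      tangentCoordChange_self' (mem_extChartAt_source y₀)]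
    change α (v - S.dInclAt y₀ _) = α v
    rw [map_sub, hα _ (S.dInclAt_mem y₀ _), sub_zero]

end NormalizedSubmanifold

end

section

/-! ### Multivector fields which vanish modulo the normal bundle -/

section FlatVanishing

open CliffordAlgebra (contractLeft contractRight)

variable {E : Type*} [NormedAddCommGroup E] [NormedSpace ℝ E] [FiniteDimensional ℝ E]

attribute [local instance] extNormedAddCommGroup extNormedSpace

/-- The covector bⁱ - bⁱ ∘ p kills the image of `p`, so `hx` allows bⁱ ∘ p in place of bⁱ; then `p`
is moved to the other factor. Only the tangential values of `D` matter. -/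
theorem sum_mul_map_contractLeft {p : E →ₗ[ℝ] E} {x : ExteriorAlgebra ℝ E}
    (hp : ∀ v, p (p v) = p v)
    (hx : ∀ α : Module.Dual ℝ E, (∀ v, α (p v) = 0) → ExteriorAlgebra.map p (contractLeft α x) = 0)
    (D : E →ₗ[ℝ] ExteriorAlgebra ℝ E) :
    ∑ i, D (Module.finBasis ℝ E i) *
        ExteriorAlgebra.map p (contractLeft ((Module.finBasis ℝ E).coord i) x) =
      ∑ i, D (p (Module.finBasis ℝ E i)) *
        ExteriorAlgebra.map p (contractLeft ((Module.finBasis ℝ E).coord i) x) := by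
  have h := sum_coord_comp (Module.finBasis ℝ E) ((LinearMap.mul ℝ (ExteriorAlgebra ℝ E)).flip.compl₁₂
    ((ExteriorAlgebra.map p).toLinearMap ∘ₗ contractLeft.flip x) D) p
  refine Eq.trans (Finset.sum_congr rfl fun i _ => ?_) h
  have h1 := hx ((Module.finBasis ℝ E).coord i - (Module.finBasis ℝ E).coord i ∘ₗ p) fun v => by
    simp [hp]
  rw [map_sub, LinearMap.sub_apply, map_sub, sub_eq_zero] at h1
  rw [h1]
  rfl

/-- With `p` moved to the covector, ⋀p of the contraction of `x` by bⁱ ∘ p is the contraction of ⋀p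
x by bⁱ, hence zero. The tangential values of `D` do not contribute. -/
theorem sum_map_contractRight_mul {p : E →ₗ[ℝ] E} {x : ExteriorAlgebra ℝ E}
    (hx : ExteriorAlgebra.map p x = 0) (D : E →ₗ[ℝ] ExteriorAlgebra ℝ E) :
    ∑ i, ExteriorAlgebra.map p (contractRight x ((Module.finBasis ℝ E).coord i)) *
      D (p (Module.finBasis ℝ E i)) = 0 := by
  have h := sum_coord_comp (Module.finBasis ℝ E) ((LinearMap.mul ℝ (ExteriorAlgebra ℝ E)).compl₁₂
    ((ExteriorAlgebra.map p).toLinearMap ∘ₗ contractRight x) D) p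
  refine h.symm.trans (Finset.sum_eq_zero fun i _ => ?_)
  change ExteriorAlgebra.map p (contractRight x ((Module.finBasis ℝ E).coord i ∘ₗ p)) * _ = 0
  rw [← contractRight_map, hx, map_zero, LinearMap.zero_apply, zero_mul]

/-- Write ⋀p[R, Q] as ∑ rⱼ ⋀p(∂ⱼQ) - ∑ ⋀p(∂ᵢR) qᵢ. In the first sum only normal derivatives of `Q`
count, and soldering expresses them through ∂K and the qᵢ. In the second only tangential derivatives
of `R` count, and vanishing of ⋀K R along `N` expresses them through ∂K and the rⱼ. The two results
agree up to one application of p, which K² = K accounts for. -/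
theorem map_flatSchouten_eq_zero {K : E → E →L[ℝ] E} {R Q : E → ExteriorAlgebra ℝ E} {y : E}
    (hK : DifferentiableAt ℝ K y) (hKK : ∀ᶠ z in 𝓝 y, ∀ v, K z (K z v) = K z v)
    (hR : DifferentiableAt ℝ R y) (hQ : DifferentiableAt ℝ Q y)
    (hR0 : ExteriorAlgebra.map (K y).toLinearMap (R y) = 0)
    (hR1 : ∀ v, fderiv ℝ (fun z => ExteriorAlgebra.map (K z).toLinearMap (R z)) y (K y v) = 0)
    (hQ1 : ∀ α : Module.Dual ℝ E, (∀ v, α (K y v) = 0) →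
      ExteriorAlgebra.map (K y).toLinearMap (contractLeft α (Q y)) = 0)
    (hQ2 : ∀ u, ExteriorAlgebra.map (K y).toLinearMap
      (flatSchouten (fun z => ExteriorAlgebra.ι ℝ (u - K z u)) Q y) = 0) :
    ExteriorAlgebra.map (K y).toLinearMap (flatSchouten R Q y) = 0 := by
  set p : E →ₗ[ℝ] E := (K y).toLinearMap with hp
  set b := Module.finBasis ℝ E with hb
  set r := fun i => ExteriorAlgebra.map p (contractRight (R y) (b.coord i)) with hr
  set q := fun i => ExteriorAlgebra.map p (contractLeft (b.coord i) (Q y)) with hq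
  have hpp : ∀ v, p (p v) = p v := hKK.self_of_nhds
  have hKu : ∀ u v, fderiv ℝ (fun z => K z u) y v = fderiv ℝ K y v u := fun u v => by
    have := (hK.hasFDerivAt.clm_apply (hasFDerivAt_const u y)).fderiv
    rw [this]
    simp
  -- Derivative of the identity K² = K.
  have hKKd : ∀ u v, fderiv ℝ K y v (p u) + p (fderiv ℝ K y v u) = fderiv ℝ K y v u :=
    fun u v => by
      have h1 : (fun z => K z (K z u)) =ᶠ[𝓝 y] fun z => K z u := hKK.mono fun z hz => hz u
      have h2 : DifferentiableAt ℝ (fun z => K z u) y := hK.clm_apply (differentiableAt_const u)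
      have h3 := (hK.hasFDerivAt.clm_apply h2.hasFDerivAt).fderiv
      have h4 := congrArg (fun A : E →L[ℝ] E => A v) (h3.symm.trans h1.fderiv_eq)
      simp only [add_apply, ContinuousLinearMap.coe_comp, Function.comp_apply,
        ContinuousLinearMap.flip_apply, hKu] at h4
      rw [add_comm]
      exact h4
  have hdX : ∀ u v, fderiv ℝ (fun z => u - K z u) y v = -fderiv ℝ K y v u := fun u v => by
    rw [fderiv_const_sub, neg_apply, hKu]
  -- The bracket with the field u - K u determines the derivative of `Q` in the normal direction u -
  -- p u.
  have e1 : ∀ u, ExteriorAlgebra.map p (fderiv ℝ Q y (u - p u)) =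
      -∑ i, ExteriorAlgebra.ι ℝ (p (fderiv ℝ K y (p (b i)) u)) * q i := fun u => by
    have h1 := hQ2 u
    have hu : DifferentiableAt ℝ (fun z => u - K z u) y :=
      (differentiableAt_const u).sub (hK.clm_apply (differentiableAt_const u))
    rw [flatSchouten_ι_left hu hQ, map_sub, sub_eq_zero] at h1
    refine h1.trans ?_
    rw [map_sum, ← Finset.sum_neg_distrib]
    have h2 := sum_mul_map_contractLeft hpp hQ1
      (ExteriorAlgebra.ι ℝ ∘ₗ p ∘ₗ (fderiv ℝ (fun z => u - K z u) y).toLinearMap)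
    refine Eq.trans (Finset.sum_congr rfl fun i _ => ?_)
      (h2.trans (Finset.sum_congr rfl fun i _ => ?_))
    · rw [map_mul, ExteriorAlgebra.map_apply_ι]
      rfl
    · change ExteriorAlgebra.ι ℝ (p (fderiv ℝ (fun z => u - K z u) y (p (b i)))) * _ = _
      rw [hdX, map_neg, map_neg, neg_mul]
  -- The product rule for ⋀K R, whose tangential derivatives are zero.
  have e2 : ∀ v, ExteriorAlgebra.map p (fderiv ℝ R y (p v)) =
      -∑ j, r j * ExteriorAlgebra.ι ℝ (fderiv ℝ K y (p v) (b j)) := fun v => by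
    have h1 := hR1 v
    rw [fderiv_map hK hR, mapDer_eq_right] at h1
    exact eq_neg_of_add_eq_zero_left h1
  have e3 : ∑ j, r j * ExteriorAlgebra.map p (fderiv ℝ Q y (b j)) =
      -∑ i, ∑ j, r j * ExteriorAlgebra.ι ℝ (p (fderiv ℝ K y (p (b i)) (b j))) * q i := by
    have h1 := sum_map_contractRight_mul hR0
      ((ExteriorAlgebra.map p).toLinearMap ∘ₗ (fderiv ℝ Q y).toLinearMap)
    have h2 : ∑ j, r j * ExteriorAlgebra.map p (fderiv ℝ Q y (b j)) =
        ∑ j, r j * ExteriorAlgebra.map p (fderiv ℝ Q y (b j - p (b j))) := by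
      refine (sub_zero _).symm.trans ?_
      rw [← h1, ← Finset.sum_sub_distrib]
      refine Finset.sum_congr rfl fun j _ => ?_
      rw [map_sub, map_sub, mul_sub]
      rfl
    rw [h2, Finset.sum_comm, ← Finset.sum_neg_distrib]
    refine Finset.sum_congr rfl fun j _ => ?_
    rw [e1, mul_neg, Finset.mul_sum]
    simp only [mul_assoc]
  have e4 : ∑ i, ExteriorAlgebra.map p (fderiv ℝ R y (b i)) * q i =
      -∑ i, ∑ j, r j * ExteriorAlgebra.ι ℝ (fderiv ℝ K y (p (b i)) (b j)) * q i := by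
    have h1 := sum_mul_map_contractLeft hpp hQ1
      ((ExteriorAlgebra.map p).toLinearMap ∘ₗ (fderiv ℝ R y).toLinearMap)
    refine h1.trans ?_
    rw [← Finset.sum_neg_distrib]
    refine Finset.sum_congr rfl fun i _ => ?_
    change ExteriorAlgebra.map p (fderiv ℝ R y (p (b i))) * q i = _
    rw [e2, neg_mul, Finset.sum_mul]
  -- By K² = K, applying p after ∂K changes the result only by ∂K ∘ p, which the rⱼ annihilate.
  have e5 : ∀ v, ∑ j, r j * ExteriorAlgebra.ι ℝ (fderiv ℝ K y v (b j)) =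
      ∑ j, r j * ExteriorAlgebra.ι ℝ (p (fderiv ℝ K y v (b j))) := fun v => by
    have h1 := sum_map_contractRight_mul hR0
      (ExteriorAlgebra.ι ℝ ∘ₗ (fderiv ℝ K y v).toLinearMap)
    have h2 : ∀ j, r j * ExteriorAlgebra.ι ℝ (fderiv ℝ K y v (b j)) =
        r j * ExteriorAlgebra.ι ℝ (fderiv ℝ K y v (p (b j))) +
          r j * ExteriorAlgebra.ι ℝ (p (fderiv ℝ K y v (b j))) := fun j => by
      rw [← mul_add, ← map_add, hKKd]
    simp only [h2, Finset.sum_add_distrib]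
    exact add_eq_right.2 h1
  have hsum : ExteriorAlgebra.map p (flatSchouten R Q y) =
      ∑ j, r j * ExteriorAlgebra.map p (fderiv ℝ Q y (b j)) -
        ∑ i, ExteriorAlgebra.map p (fderiv ℝ R y (b i)) * q i := by
    rw [flatSchouten_eq hR hQ, map_sum, ← Finset.sum_sub_distrib]
    exact Finset.sum_congr rfl fun i _ => by rw [map_sub, map_mul, map_mul]
  rw [hsum, e3, e4, sub_neg_eq_add, neg_add_eq_zero]
  refine Finset.sum_congr rfl fun i _ => ?_
  rw [← Finset.sum_mul, ← Finset.sum_mul, e5]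

/-- Contractions of scalars are zero, so only the second half of the bracket survives. This is how
condition (i) of soldering becomes a bracket condition. -/
theorem flatSchouten_algebraMap_left {f : E → ℝ} {Q : E → ExteriorAlgebra ℝ E} {y : E}
    (hf : DifferentiableAt ℝ f y) (hQ : DifferentiableAt ℝ Q y) :
    flatSchouten (fun z => algebraMap ℝ _ (f z)) Q y =
      -contractLeft (fderiv ℝ f y).toLinearMap (Q y) := by
  have hd : HasFDerivAt (fun z => algebraMap ℝ (ExteriorAlgebra ℝ E) (f z))
      ((Algebra.linearMap ℝ (ExteriorAlgebra ℝ E)).toContinuousLinearMap.comp (fderiv ℝ f y)) y :=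
    (Algebra.linearMap ℝ (ExteriorAlgebra ℝ E)).toContinuousLinearMap.hasFDerivAt.comp y
      hf.hasFDerivAt
  have h1 : (fderiv ℝ f y).toLinearMap = ∑ i, fderiv ℝ f y (Module.finBasis ℝ E i) •
      (Module.finBasis ℝ E).coord i :=
    (Module.finBasis ℝ E).ext fun j => by simp [Finsupp.single_apply]
  rw [flatSchouten_eq hd.differentiableAt hQ, hd.fderiv, h1, map_sum, LinearMap.sum_apply,
    ← Finset.sum_neg_distrib]
  refine Finset.sum_congr rfl fun i _ => ?_
  have h2 : contractRight (algebraMap ℝ (ExteriorAlgebra ℝ E) (f y))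
      ((Module.finBasis ℝ E).coord i) = 0 := CliffordAlgebra.contractRight_algebraMap _ _ _
  rw [h2, zero_mul, zero_sub, map_smul, LinearMap.smul_apply, Algebra.smul_def]
  rfl

end FlatVanishing

section SolderingConditions

variable {V : Type*} [AddCommGroup V] [Module ℝ V]

/-- The contractions of `x` with `⋀^l ann(ν)` belong to `τ`. -/
def IsTangential (τ ν : Submodule ℝ V) (l : ℕ) (x : ExteriorAlgebra ℝ V) : Prop :=
  ∀ a ∈ annPow ν l, multiContract a x ∈ τ.map (ExteriorAlgebra.ι ℝ)

/-- The contractions of `x` with `⋀^k ann(ν)` vanish. -/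
def VanishesOn (ν : Submodule ℝ V) (k : ℕ) (x : ExteriorAlgebra ℝ V) : Prop :=
  ∀ a ∈ annPow ν k, multiContract a x = 0

end SolderingConditions

/-! ### Soldered multivector fields through brackets, and their closure properties -/

namespace NormalizedSubmanifold

open CliffordAlgebra (contractLeft contractRight)

variable {E M F N : Type*} [NormedAddCommGroup E] [NormedSpace ℝ E] [FiniteDimensional ℝ E]
  [TopologicalSpace M] [ChartedSpace E M] [IsManifold 𝓘(ℝ, E) ∞ M]
  [NormedAddCommGroup F] [NormedSpace ℝ F] [FiniteDimensional ℝ F]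
  [TopologicalSpace N] [ChartedSpace F N] [IsManifold 𝓘(ℝ, F) ∞ N]
  (S : NormalizedSubmanifold E M F N)

local notation "φ" => extChartAt 𝓘(ℝ, E)
local notation "τ" => tangentCoordChange 𝓘(ℝ, E)

attribute [local instance] extNormedAddCommGroup extNormedSpace

/-- The multivector field `R` vanishes along `N`, modulo the ideal generated by the normal
bundle. -/
def IsVanishing (R : MultiField E M) : Prop :=
  ∀ y, ExteriorAlgebra.map (S.proj y).toLinearMap (multiAt R (S.incl y)) = 0

variable {S}

theorem IsVanishing.add {P Q : MultiField E M} (hP : S.IsVanishing P) (hQ : S.IsVanishing Q) :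
    S.IsVanishing (P + Q) := fun y => by rw [multiAt_add, map_add, hP, hQ, add_zero]

theorem IsVanishing.neg {P : MultiField E M} (hP : S.IsVanishing P) : S.IsVanishing (-P) :=
  fun y => by rw [multiAt_neg, map_neg, hP, neg_zero]

theorem IsVanishing.smul {P : MultiField E M} (c : ℝ) (hP : S.IsVanishing P) :
    S.IsVanishing (c • P) := fun y => by rw [multiAt_smul, map_smul, hP, smul_zero]

theorem IsVanishing.mul_right {P : MultiField E M} (hP : S.IsVanishing P) (Q : MultiField E M) :
    S.IsVanishing (P * Q) := fun y => by rw [multiAt_mul, map_mul, hP, zero_mul]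

theorem IsVanishing.mul_left {Q : MultiField E M} (P : MultiField E M) (hQ : S.IsVanishing Q) :
    S.IsVanishing (P * Q) := fun y => by rw [multiAt_mul, map_mul, hQ, mul_zero]

theorem IsVanishing.eventually_map_eq_zero {R : MultiField E M} (hR : S.IsVanishing R) {y₀ : N}
    {K : E → E →L[ℝ] E} (hK : ∀ᶠ y in 𝓝 y₀, K (φ (S.incl y₀) (S.incl y)) = S.chartProj y₀ y) :
    ∀ᶠ y in 𝓝 y₀, ExteriorAlgebra.map (K (φ (S.incl y₀) (S.incl y))).toLinearMap
      (chartMulti R (S.incl y₀) (φ (S.incl y₀) (S.incl y))) = 0 := by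
  filter_upwards [hK, S.eventually_mem_source y₀] with y hy hy'
  rw [hy, chartMulti_eq R _ ((φ (S.incl y₀)).map_source hy'.2), (φ (S.incl y₀)).left_inv hy'.2,
    map_map_apply, ← ContinuousLinearMap.toLinearMap_comp, S.chartProj_comp hy'.2,
    ContinuousLinearMap.toLinearMap_comp, ← map_map_apply, hR, map_zero]

variable (S)

/-- Definitional: tangent spaces are read as `E`, so that the lemmas about one fixed vector space
apply. -/
theorem isSolderedMulti_iff_annPow (k : ℕ) (Q : MultiField E M) :
    S.IsSolderedMulti k Q ↔
      (∀ (y : N) (l : ℕ), k = l + 1 →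
        IsTangential (S.tangentAt y) (S.normalAt y) l (multiAt Q (S.incl y))) ∧
      ∀ X : VField E M, S.IsNormal X → ∀ (y : N),
        VanishesOn (S.normalAt y) k (multiAt (multiLie X Q) (S.incl y)) := by
  have h : S.IsSolderedMulti k Q ↔
      (∀ (y : N) (l : ℕ), k = l + 1 →
        IsTangential (S.tangent y) (S.normal y) l (Q (S.incl y))) ∧
      ∀ X : VField E M, S.IsNormal X → ∀ (y : N),
        VanishesOn (S.normal y) k (multiLie X Q (S.incl y)) := Iff.rfl
  exact h

theorem isSolderedMulti_iff {k : ℕ} {Q : MultiField E M} (hQ : IsSmoothMulti Q)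
    (hk : IsOfDegree k Q) :
    S.IsSolderedMulti k Q ↔
      (∀ (y : N) (α : Module.Dual ℝ E), (∀ v ∈ S.tangentAt y, α v = 0) →
        ExteriorAlgebra.map (S.proj y).toLinearMap (contractLeft α (multiAt Q (S.incl y))) = 0) ∧
      ∀ X : VField E M, S.IsNormal X → S.IsVanishing (schouten (vfieldMulti X) Q) := by
  rw [isSolderedMulti_iff_annPow]
  refine and_congr ?_ ?_
  · refine forall_congr' fun y => ?_
    have hmem : ∀ α : Module.Dual ℝ E, α ∈ (S.tangentAt y).dualAnnihilator ↔
      ∀ v ∈ S.tangentAt y, α v = 0 := fun α => Submodule.mem_dualAnnihilator α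
    simp only [← hmem]
    cases k with
    | zero =>
      -- In degree zero both forms of condition (i) are void, as contractions of scalars vanish.
      refine iff_of_true (fun l hl => absurd hl (by omega)) fun α _ => ?_
      rw [contractLeft_of_mem_zero α (hk.multiAt _), map_zero]
    | succ k =>
      rw [← multiContract_mem_ι_iff (S.ker_proj y) (S.isIdempotentElem_proj y) (hk.multiAt _)]
      exact ⟨fun h => h k rfl, fun h l hl => by obtain rfl : k = l := (by omega); exact h⟩
  · refine forall_congr' fun X => forall_congr' fun _ => forall_congr' fun y => ?_
    have hd : IsOfDegree k (schouten (vfieldMulti X) Q) :=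
      IsOfDegree.schouten (by omega) X.isSmoothMulti hQ (isOfDegree_vfieldMulti X) hk
    rw [multiLie_eq_schouten X hQ, map_projection_eq_zero_iff (S.ker_proj y)
      (S.isIdempotentElem_proj y) (hd.multiAt _)]
    rfl

theorem multiAt_schouten_funMulti {f : M → ℝ} (hf : ContMDiff 𝓘(ℝ, E) 𝓘(ℝ) ∞ f)
    {Q : MultiField E M} (hQ : IsSmoothMulti Q) (x : M) :
    multiAt (schouten (funMulti f) Q) x =
      -contractLeft (fderiv ℝ (fun z => f ((φ x).symm z)) (φ x x)).toLinearMap (multiAt Q x) := by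
  have hx := mem_extChartAt_target (I := 𝓘(ℝ, E)) x
  have hf' : DifferentiableAt ℝ (fun z => f ((φ x).symm z)) (φ x x) :=
    ((hf _).comp _ ((contMDiffOn_extChartAt_symm x).contMDiffAt
      (target_mem x))).contDiffAt.differentiableAt (by simp)
  rw [multiAt_schouten, chartMulti_funMulti,
    flatSchouten_algebraMap_left hf' (hQ.differentiableAt hx), multiAt_eq_chartMulti Q]

/-- The functions which vanish on `N`, and the vector fields which are normal to `N`, regarded as
multivector fields. -/
def IsNormalGenerator (g : ℕ) (G : MultiField E M) : Prop :=
  (g = 0 ∧ ∃ f : M → ℝ, ContMDiff 𝓘(ℝ, E) 𝓘(ℝ) ∞ f ∧ (∀ y, f (S.incl y) = 0) ∧ G = funMulti f) ∨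
    (g = 1 ∧ ∃ X : VField E M, S.IsNormal X ∧ G = vfieldMulti X)

variable {S}

theorem IsNormalGenerator.isSmoothMulti {g : ℕ} {G : MultiField E M}
    (h : S.IsNormalGenerator g G) : IsSmoothMulti G := by
  obtain ⟨-, f, hf, -, rfl⟩ | ⟨-, X, -, rfl⟩ := h
  · exact isSmoothMulti_funMulti_iff.2 hf
  · exact X.isSmoothMulti

theorem IsNormalGenerator.isOfDegree {g : ℕ} {G : MultiField E M}
    (h : S.IsNormalGenerator g G) : IsOfDegree g G := by
  obtain ⟨rfl, f, -, -, rfl⟩ | ⟨rfl, X, -, rfl⟩ := h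
  · exact isOfDegree_funMulti f
  · exact isOfDegree_vfieldMulti X

variable (S) [T2Space M]

/-- Functions that are zero on `N` encode condition (i): their differentials kill TN, and by
`exists_vanishing_function` every covector killing TN arises so. Normal fields encode condition
(ii). -/
theorem isSolderedMulti_iff_vanishing {k : ℕ} {Q : MultiField E M} (hQ : IsSmoothMulti Q)
    (hk : IsOfDegree k Q) :
    S.IsSolderedMulti k Q ↔ ∀ g G, S.IsNormalGenerator g G → S.IsVanishing (schouten G Q) := by
  rw [S.isSolderedMulti_iff hQ hk]
  constructor
  · rintro ⟨h1, h2⟩ g G (⟨-, f, hf, hf0, rfl⟩ | ⟨-, X, hX, rfl⟩)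
    · intro y
      rw [multiAt_schouten_funMulti hf hQ, map_neg, h1, neg_zero]
      intro v hv
      refine S.fderiv_eq_zero_of_eventually ?_ ?_ hv
      · exact ((hf _).comp _ ((contMDiffOn_extChartAt_symm (S.incl y)).contMDiffAt
          (target_mem (S.incl y)))).contDiffAt.differentiableAt (by simp)
      · filter_upwards [S.eventually_mem_source y] with y' hy'
        rw [(φ (S.incl y)).left_inv hy'.2, hf0]
    · exact h2 X hX
  · refine fun h => ⟨fun y α hα => ?_, fun X hX => h 1 _ (Or.inr ⟨rfl, X, hX, rfl⟩)⟩
    obtain ⟨f, hf, hf0, hfα⟩ := S.exists_vanishing_function (α := LinearMap.toContinuousLinearMap α)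
      hα
    have h1 := h 0 _ (Or.inl ⟨rfl, f, hf, hf0, rfl⟩) y
    rw [multiAt_schouten_funMulti hf hQ, map_neg, neg_eq_zero, hfα] at h1
    exact h1

theorem IsVanishing.schouten {k : ℕ} {R Q : MultiField E M} (hR : IsSmoothMulti R)
    (hQ : IsSmoothMulti Q) (hk : IsOfDegree k Q) (hRv : S.IsVanishing R)
    (hQs : S.IsSolderedMulti k Q) : S.IsVanishing (schouten R Q) := by
  intro y
  obtain ⟨h1, h2⟩ := (S.isSolderedMulti_iff hQ hk).1 hQs
  obtain ⟨K, hK, hKK, hKN⟩ := S.exists_chart_projection y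
  have hK0 : K (φ (S.incl y) (S.incl y)) = S.proj y :=
    hKN.self_of_nhds.trans (S.chartProj_self y)
  have hx := mem_extChartAt_target (I := 𝓘(ℝ, E)) (S.incl y)
  have hKd := hK.self_of_nhds.differentiableAt (by simp)
  rw [multiAt_schouten, ← hK0]
  refine map_flatSchouten_eq_zero hKd hKK (hR.differentiableAt hx) (hQ.differentiableAt hx)
    ?_ ?_ ?_ ?_
  · rw [hK0, ← multiAt_eq_chartMulti, hRv]
  -- ⋀K R is zero along `N`, so its tangential derivatives are zero.
  · intro v
    refine S.fderiv_eq_zero_of_eventually ?_ (hRv.eventually_map_eq_zero hKN) ?_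
    · exact (contDiffAt_map le_rfl hK.self_of_nhds (hR.contDiffAt hx)).differentiableAt (by simp)
    · rw [hK0]
      exact S.proj_mem_tangentAt y v
  · intro α hα
    rw [hK0, ← multiAt_eq_chartMulti]
    refine h1 y α fun v hv => ?_
    rw [← S.proj_of_mem_tangentAt hv, ← hK0, hα]
  -- The local field u - K u has the germ of a global normal field, to which the soldering of `Q`
  -- applies.
  · intro u
    obtain ⟨X, hX, hXu⟩ := S.exists_normal_vfield hK hKN u
    have h3 := h2 X hX y
    rw [multiAt_schouten, chartMulti_vfieldMulti, ← hK0] at h3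
    rw [← h3]
    congr 1
    refine flatSchouten_congr ?_ .rfl
    filter_upwards [hXu] with z hz
    rw [hz]

variable {S}

theorem IsVanishing.schouten_left {k l : ℕ} {R Q : MultiField E M} (hR : IsSmoothMulti R)
    (hl : IsOfDegree l R) (hQ : IsSmoothMulti Q) (hk : IsOfDegree k Q) (hRv : S.IsVanishing R)
    (hQs : S.IsSolderedMulti k Q) : S.IsVanishing (Soldered.schouten Q R) := by
  rw [schouten_skew hQ hR hk hl]
  exact ((hRv.schouten S hR hQ hk hQs).smul _).neg

/-- By the Leibniz rule [G, P ∧ Q] is a sum of multiples of [G, P] and [G, Q], and vanishing fields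
form an ideal. -/
theorem mul_mem_solderedMultis {p q : ℕ} {P Q : MultiField E M} (hP : P ∈ S.solderedMultis p)
    (hQ : Q ∈ S.solderedMultis q) : P * Q ∈ S.solderedMultis (p + q) := by
  obtain ⟨hP, hp, hPs⟩ := hP
  obtain ⟨hQ, hq, hQs⟩ := hQ
  have hd : IsOfDegree (p + q) (P * Q) := fun x => mul_mem_exteriorPower (hp x) (hq x)
  refine ⟨hP.mul hQ, hd, ?_⟩
  rw [S.isSolderedMulti_iff_vanishing hP hp] at hPs
  rw [S.isSolderedMulti_iff_vanishing hQ hq] at hQs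
  rw [S.isSolderedMulti_iff_vanishing (hP.mul hQ) hd]
  intro g G hG
  rw [schouten_mul hG.isSmoothMulti hP hQ hG.isOfDegree hp]
  exact ((hPs g G hG).mul_right Q).add (((hQs g G hG).mul_left P).smul _)

/-- By Jacobi, [G, [P, Q]] is [[G, P], Q] plus a sign times [P, [G, Q]]; each is the bracket of a
vanishing field with a soldered one. -/
theorem schouten_mem_solderedMultis {p q r : ℕ} (hr : p + q = r + 1) {P Q : MultiField E M}
    (hP : P ∈ S.solderedMultis p) (hQ : Q ∈ S.solderedMultis q) :
    schouten P Q ∈ S.solderedMultis r := by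
  obtain ⟨hP, hp, hPs⟩ := hP
  obtain ⟨hQ, hq, hQs⟩ := hQ
  have hd : IsOfDegree r (schouten P Q) := IsOfDegree.schouten hr hP hQ hp hq
  refine ⟨hP.schouten hQ, hd, ?_⟩
  have hPv := (S.isSolderedMulti_iff_vanishing hP hp).1 hPs
  have hQv := (S.isSolderedMulti_iff_vanishing hQ hq).1 hQs
  rw [S.isSolderedMulti_iff_vanishing (hP.schouten hQ) hd]
  intro g G hG
  have hGs := hG.isSmoothMulti
  have hGd := hG.isOfDegree
  rw [schouten_jacobi hGs hP hQ hGd hp]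
  refine ((hPv g G hG).schouten S (hGs.schouten hP) hQ hq hQs).add (IsVanishing.smul _ ?_)
  -- If `G` and `Q` are both functions, their bracket has no degree to live in, but it is zero.
  obtain hgq | ⟨s, hs⟩ : (g = 0 ∧ q = 0) ∨ ∃ s, g + q = s + 1 := by
    rcases Nat.eq_zero_or_pos (g + q) with h | h
    · exact Or.inl (by omega)
    · exact Or.inr ⟨g + q - 1, by omega⟩
  · obtain ⟨rfl, rfl⟩ := hgq
    rw [schouten_zero_zero hGd hq, ← zero_smul ℝ Q, schouten_smul_right 0 hP hQ, zero_smul]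
    intro y
    exact map_zero _
  · exact (hQv g G hG).schouten_left (hGs.schouten hQ) (IsOfDegree.schouten hs hGs hQ hGd hq) hP hp
      hPs

end NormalizedSubmanifold

end

section

/-! ### Cartan calculus on a vector space -/

section FlatForms

variable {E : Type*} [NormedAddCommGroup E] [NormedSpace ℝ E] {k : ℕ}

/-- The Lie derivative of a differential form on a vector space. -/
def flatFormLie (X : E → E) (κ : E → E [⋀^Fin k]→L[ℝ] ℝ) (y : E) (v : Fin k → E) : ℝ :=
  fderiv ℝ κ y (X y) v + ∑ i, κ y (Function.update v i (fderiv ℝ X y (v i)))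

theorem removeNth_succ_vecCons {α : Type*} (x : α) (v : Fin (k + 1) → α) (i : Fin (k + 1)) :
    i.succ.removeNth (Matrix.vecCons x v) = Matrix.vecCons x (i.removeNth v) := by
  funext j
  refine Fin.cases ?_ (fun j => ?_) j
  · simp [Fin.removeNth]
  · simp [Fin.removeNth]

theorem map_update_eq (f : E [⋀^Fin (k + 1)]→L[ℝ] ℝ) (v : Fin (k + 1) → E) (i : Fin (k + 1))
    (w : E) :
    f (Function.update v i w) = (-1 : ℤˣ) ^ i.val • f (Matrix.vecCons w (i.removeNth v)) := by
  rw [← Fin.insertNth_removeNth, ContinuousAlternatingMap.map_insertNth]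
  rcases Nat.even_or_odd i.val with h | h <;> simp [h.neg_one_pow]

theorem contDiff_curryLeft : ContDiff ℝ ∞
    (fun w : E [⋀^Fin (k + 1)]→L[ℝ] ℝ => ContinuousAlternatingMap.curryLeft w) :=
  LinearIsometry.contDiff (𝕜 := ℝ) (E := E [⋀^Fin (k + 1)]→L[ℝ] ℝ)
    (F := E →L[ℝ] E [⋀^Fin k]→L[ℝ] ℝ)
    (ContinuousAlternatingMap.curryLeftLI (𝕜 := ℝ) (E := E) (F := ℝ) (n := k))

theorem hasFDerivAt_curryLeft (w : E [⋀^Fin (k + 1)]→L[ℝ] ℝ) :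
    HasFDerivAt (fun w : E [⋀^Fin (k + 1)]→L[ℝ] ℝ => ContinuousAlternatingMap.curryLeft w)
      (ContinuousAlternatingMap.curryLeftLI (𝕜 := ℝ) (E := E) (F := ℝ)
        (n := k)).toContinuousLinearMap w :=
  ContinuousLinearMap.hasFDerivAt (𝕜 := ℝ) (E := E [⋀^Fin (k + 1)]→L[ℝ] ℝ)
    (F := E →L[ℝ] E [⋀^Fin k]→L[ℝ] ℝ)
    (ContinuousAlternatingMap.curryLeftLI (𝕜 := ℝ) (E := E) (F := ℝ)
    (n := k)).toContinuousLinearMap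

theorem fderiv_curryLeft_apply {κ : E → E [⋀^Fin (k + 1)]→L[ℝ] ℝ} {X : E → E} {y : E}
    (hκ : DifferentiableAt ℝ κ y) (hX : DifferentiableAt ℝ X y) (w : E) (u : Fin k → E) :
    fderiv ℝ (fun z => ContinuousAlternatingMap.curryLeft (κ z) (X z)) y w u =
      fderiv ℝ κ y w (Matrix.vecCons (X y) u) + κ y (Matrix.vecCons (fderiv ℝ X y w) u) := by
  have hC := HasFDerivAt.comp (𝕜 := ℝ) (E := E) (F := E [⋀^Fin (k + 1)]→L[ℝ] ℝ)
    (G := E →L[ℝ] E [⋀^Fin k]→L[ℝ] ℝ) y (hasFDerivAt_curryLeft (κ y)) hκ.hasFDerivAt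
  have h := (hC.clm_apply hX.hasFDerivAt).fderiv
  have h2 := congrArg (fun A => A w u) h
  refine h2.trans ?_
  exact add_comm _ _

theorem extDeriv_apply' (κ : E → E [⋀^Fin k]→L[ℝ] ℝ) (y : E) (v : Fin (k + 1) → E) :
    extDeriv κ y v = ∑ i, (-1 : ℤˣ) ^ i.val • fderiv ℝ κ y (v i) (i.removeNth v) := by
  rw [extDeriv, ContinuousAlternatingMap.alternatizeUncurryFin_apply]
  refine Finset.sum_congr rfl fun i _ => ?_
  rcases Nat.even_or_odd i.val with h | h <;> simp [h.neg_one_pow]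

theorem extDeriv_vecCons_zero (X : E → E) (κ : E → E [⋀^Fin 0]→L[ℝ] ℝ) (y : E) (v : Fin 0 → E) :
    extDeriv κ y (Matrix.vecCons (X y) v) = flatFormLie X κ y v := by
  rw [extDeriv_apply', flatFormLie, Fin.sum_univ_one, Fin.sum_univ_zero, add_zero]
  simp only [Fin.val_zero, pow_zero, one_smul, Matrix.cons_val_zero]
  exact congrArg (fderiv ℝ κ y (X y)) (Subsingleton.elim _ _)

/-- Cartan's formula. The derivative of `κ` in the direction of the zeroth slot is the transport
term; in the other slots the derivatives of `κ` cancel between the two summands, and the derivatives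
of `X` remain. -/
theorem extDeriv_vecCons_add {κ : E → E [⋀^Fin (k + 1)]→L[ℝ] ℝ} {X : E → E} {y : E}
    (hκ : DifferentiableAt ℝ κ y) (hX : DifferentiableAt ℝ X y) (v : Fin (k + 1) → E) :
    extDeriv κ y (Matrix.vecCons (X y) v) +
      extDeriv (fun z => ContinuousAlternatingMap.curryLeft (κ z) (X z)) y v =
      flatFormLie X κ y v := by
  rw [extDeriv_apply', extDeriv_apply', flatFormLie, Fin.sum_univ_succ, add_assoc,
    ← Finset.sum_add_distrib]
  congr 1
  · simp only [Fin.val_zero, pow_zero, one_smul, Matrix.cons_val_zero]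
    congr 1
  · refine Finset.sum_congr rfl fun i _ => ?_
    rw [fderiv_curryLeft_apply hκ hX, map_update_eq, removeNth_succ_vecCons, Matrix.cons_val_succ,
      Fin.val_succ, pow_succ, smul_add, mul_neg, mul_one, Units.neg_smul]
    abel

/-- Everything cancels except the derivative of the inserted field `Y` along `X` and the slot-zero
term with the derivative of `X` along `Y`; their difference is the Lie bracket. -/
theorem flatFormLie_curryLeft_sub {κ : E → E [⋀^Fin (k + 1)]→L[ℝ] ℝ} {X Y : E → E} {y : E}
    (hκ : DifferentiableAt ℝ κ y) (hY : DifferentiableAt ℝ Y y) (v : Fin k → E) :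
    flatFormLie X (fun z => ContinuousAlternatingMap.curryLeft (κ z) (Y z)) y v -
      flatFormLie X κ y (Matrix.vecCons (Y y) v) =
      κ y (Matrix.vecCons (VectorField.lieBracket ℝ X Y y) v) := by
  have h0 : κ y (Function.update (Matrix.vecCons (Y y) v) 0 (fderiv ℝ X y (Y y))) =
      κ y (Matrix.vecCons (fderiv ℝ X y (Y y)) v) :=
    congrArg (κ y) (Fin.update_cons_zero (α := fun _ => E) _ _ _)
  have h1 : ∀ i : Fin k, κ y (Function.update (Matrix.vecCons (Y y) v) i.succ
      (fderiv ℝ X y (v i))) =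
      κ y (Matrix.vecCons (Y y) (Function.update v i (fderiv ℝ X y (v i)))) := fun i =>
    congrArg (κ y) (Fin.cons_update (α := fun _ => E) _ _ _ _).symm
  have h2 : κ y (Matrix.vecCons (VectorField.lieBracket ℝ X Y y) v) =
      κ y (Matrix.vecCons (fderiv ℝ Y y (X y)) v) -
        κ y (Matrix.vecCons (fderiv ℝ X y (Y y)) v) := by
    simp only [VectorField.lieBracket, ← ContinuousAlternatingMap.curryLeft_apply_apply, map_sub]
    rfl
  rw [h2, flatFormLie, flatFormLie, fderiv_curryLeft_apply hκ hY, Fin.sum_univ_succ]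
  simp only [Matrix.cons_val_zero, Matrix.cons_val_succ, h0, h1,
    ContinuousAlternatingMap.curryLeft_apply_apply]
  ring

theorem vecCons_vecCons_add (f : E [⋀^Fin (k + 2)]→L[ℝ] ℝ) (a b : E) (v : Fin k → E) :
    f (Matrix.vecCons a (Matrix.vecCons b v)) + f (Matrix.vecCons b (Matrix.vecCons a v)) = 0 := by
  have h : f (Matrix.vecCons b (Matrix.vecCons a v) ∘ Equiv.swap 0 1) =
      -f (Matrix.vecCons b (Matrix.vecCons a v)) :=
    f.toAlternatingMap.map_swap _ (by simp)
  rw [← eq_neg_iff_add_eq_zero, ← h]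
  congr 1
  funext i
  refine Fin.cases ?_ (fun i => Fin.cases ?_ (fun i => ?_) i) i
  · simp
  · simp [Fin.succ_zero_eq_one]
  · rw [Function.comp_apply, Equiv.swap_apply_of_ne_of_ne]
    · rfl
    · simp
    · simp [Fin.ext_iff]

end FlatForms

/-! ### Differential forms on a manifold -/

section Forms

variable {E M : Type*} [NormedAddCommGroup E] [NormedSpace ℝ E] [FiniteDimensional ℝ E]
  [TopologicalSpace M] [ChartedSpace E M] [IsManifold 𝓘(ℝ, E) ∞ M] {k : ℕ}

local notation "φ" => extChartAt 𝓘(ℝ, E)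
local notation "τ" => tangentCoordChange 𝓘(ℝ, E)

theorem two_le_infty : minSmoothness ℝ 2 ≤ (∞ : WithTop ℕ∞) := by
  simpa using WithTop.coe_le_coe.2 (le_top : (2 : ℕ∞) ≤ ⊤)

theorem IsSmoothForm.contDiffAt {κ : FormField E M k} (h : IsSmoothForm κ) {x₀ : M} {z : E}
    (hz : z ∈ (φ x₀).target) : ContDiffAt ℝ ∞ (chartForm κ x₀) z :=
  (h x₀).contDiffAt ((isOpen_extChartAt_target x₀).mem_nhds hz)

theorem IsSmoothForm.differentiableAt {κ : FormField E M k} (h : IsSmoothForm κ) {x₀ : M} {z : E}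
    (hz : z ∈ (φ x₀).target) : DifferentiableAt ℝ (chartForm κ x₀) z :=
  (h.contDiffAt hz).differentiableAt (by simp)

theorem formAt_ext {κ κ' : FormField E M k} (h : ∀ x v, formAt κ x v = formAt κ' x v) : κ = κ' :=
  funext fun x => ContinuousAlternatingMap.ext (h x)

theorem formAt_formD (κ : FormField E M k) (x : M) :
    formAt (formD κ) x = extDeriv (chartForm κ x) (φ x x) := by
  change (extDeriv (chartForm κ x) (φ x x)).compContinuousLinearMap (chartDerivAt x x) = _
  rw [chartDerivAt_self]
  rfl

theorem formAt_formI (X : (x : M) → TangentSpace 𝓘(ℝ, E) x) (κ : FormField E M (k + 1)) (x : M)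
    (v : Fin k → E) : formAt (formI X κ) x v = formAt κ x (Matrix.vecCons (vecAt X x) v) := rfl

/-- At a point p the derivative is taken in the chart at p; naturality of d under the transition map
carries it to the chart at `x₀`. -/
theorem chartForm_formD {κ : FormField E M k} (hκ : IsSmoothForm κ) (x₀ : M) {z : E}
    (hz : z ∈ (φ x₀).target) : chartForm (formD κ) x₀ z = extDeriv (chartForm κ x₀) z := by
  set p := (φ x₀).symm z with hp
  have hps : p ∈ (φ x₀).source := (φ x₀).map_target hz
  have hpp := mem_extChartAt_source (I := 𝓘(ℝ, E)) p
  have hz' : φ x₀ p = z := (φ x₀).right_inv hz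
  have h1 : chartForm κ x₀ =ᶠ[𝓝 z] fun w => (chartForm κ p
      (chartTransition x₀ p w)).compContinuousLinearMap (fderiv ℝ (chartTransition x₀ p) w) := by
    filter_upwards [eventually_mem_target_and_source hz hpp] with w hw
      using chartForm_transition κ hw.1 hw.2
  have h2 : fderiv ℝ (chartTransition x₀ p) z = τ x₀ p p := by
    rw [← hz']; exact fderiv_chartTransition x₀ p p
  have h3 : chartTransition x₀ p z = φ p p := rfl
  have h4 : ContDiffAt ℝ ∞ (chartTransition x₀ p) z := by
    rw [← hz']; exact contDiffAt_chartTransition hps hpp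
  rw [h1.extDeriv.self_of_nhds, extDeriv_pullback (hκ.differentiableAt (by
    rw [h3]; exact mem_extChartAt_target p)) h4 two_le_infty, h2, h3, chartForm_eq _ x₀ hz,
    ← hp, formAt_formD]

theorem contDiffAt_extDeriv {κ : E → E [⋀^Fin k]→L[ℝ] ℝ} {z : E} (h : ContDiffAt ℝ ∞ κ z) :
    ContDiffAt ℝ ∞ (extDeriv κ) z := by
  let C : (E →L[ℝ] E [⋀^Fin k]→L[ℝ] ℝ) →L[ℝ] E [⋀^Fin (k + 1)]→L[ℝ] ℝ :=
    ContinuousAlternatingMap.alternatizeUncurryFinCLM ℝ E ℝ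
  have h1 : ContDiffAt ℝ ∞ (fderiv ℝ κ) z := h.fderiv_right (by simp)
  exact C.contDiff.contDiffAt.comp z h1

theorem IsSmoothForm.formD {κ : FormField E M k} (hκ : IsSmoothForm κ) :
    IsSmoothForm (formD κ) := fun x₀ _ hz =>
  ((contDiffAt_extDeriv (hκ.contDiffAt hz)).contDiffWithinAt).congr
    (fun _ hw => chartForm_formD hκ x₀ hw) (chartForm_formD hκ x₀ hz)

theorem IsSmoothForm.formI (X : VField E M) {κ : FormField E M (k + 1)} (hκ : IsSmoothForm κ) :
    IsSmoothForm (formI X κ) := fun x₀ z hz => by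
  have h0 : ContDiffAt ℝ ∞
      (fun z => ContinuousAlternatingMap.curryLeft (chartForm κ x₀ z)) z :=
    contDiff_curryLeft.contDiffAt.comp z (hκ.contDiffAt hz)
  have h1 : ContDiffAt ℝ ∞
      (fun z => ContinuousAlternatingMap.curryLeft (chartForm κ x₀ z) (chartVField X x₀ z)) z :=
    h0.clm_apply (X.contDiffAt_chart hz)
  exact h1.contDiffWithinAt.congr (fun w hw => chartForm_formI X κ x₀ hw)
    (chartForm_formI X κ x₀ hz)

theorem formD_formD {κ : FormField E M k} (hκ : IsSmoothForm κ) :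
    Soldered.formD (Soldered.formD κ) = 0 := formAt_ext fun x v => by
  have h1 : chartForm (Soldered.formD κ) x =ᶠ[𝓝 (φ x x)] extDeriv (chartForm κ x) := by
    filter_upwards [target_mem x] with w hw using chartForm_formD hκ x hw
  rw [formAt_formD, h1.extDeriv.self_of_nhds,
    extDeriv_extDeriv_apply (hκ.contDiffAt (mem_extChartAt_target x)) two_le_infty]
  rfl

theorem chartForm_formI_eventuallyEq (X : VField E M) (κ : FormField E M (k + 1)) (x : M) :
    chartForm (Soldered.formI X κ) x =ᶠ[𝓝 (φ x x)]
      fun z => ContinuousAlternatingMap.curryLeft (chartForm κ x z) (chartVField X x z) := by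
  filter_upwards [target_mem x] with w hw using chartForm_formI X κ x hw

theorem formAt_formLie (X : VField E M) {κ : FormField E M k} (hκ : IsSmoothForm κ) (x : M)
    (v : Fin k → E) : formAt (formLie X κ) x v =
      flatFormLie (chartVField X x) (chartForm κ x) (φ x x) v := by
  have hx := mem_extChartAt_target (I := 𝓘(ℝ, E)) x
  cases k with
  | zero =>
    have h : formAt (formLie X κ) x v =
      formAt (Soldered.formD κ) x (Matrix.vecCons (vecAt X x) v) := rfl
    rw [h, formAt_formD, vecAt_eq_chartVField, extDeriv_vecCons_zero]
  | succ k =>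
    have h : formAt (formLie X κ) x v =
      formAt (Soldered.formD κ) x (Matrix.vecCons (vecAt X x) v) +
        formAt (Soldered.formD (Soldered.formI X κ)) x v := rfl
    rw [h, formAt_formD, formAt_formD, vecAt_eq_chartVField,
      (chartForm_formI_eventuallyEq X κ x).extDeriv.self_of_nhds,
      extDeriv_vecCons_add (hκ.differentiableAt hx)
        ((X.contDiffAt_chart hx).differentiableAt (by simp))]

theorem formLie_formI (X Y : VField E M) {κ : FormField E M (k + 1)} (hκ : IsSmoothForm κ) :
    formLie X (Soldered.formI Y κ) - Soldered.formI Y (formLie X κ) =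
      Soldered.formI (⁅X, Y⁆ : VField E M) κ := formAt_ext fun x v => by
  have hx := mem_extChartAt_target (I := 𝓘(ℝ, E)) x
  have h : formAt (formLie X (Soldered.formI Y κ) - Soldered.formI Y (formLie X κ)) x v =
    formAt (formLie X (Soldered.formI Y κ)) x v -
      formAt (formLie X κ) x (Matrix.vecCons (vecAt Y x) v) := rfl
  have hf : flatFormLie (chartVField X x) (chartForm (Soldered.formI Y κ) x) (φ x x) v =
      flatFormLie (chartVField X x) (fun z => ContinuousAlternatingMap.curryLeft
        (chartForm κ x z) (chartVField Y x z)) (φ x x) v := by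
    rw [flatFormLie, flatFormLie, (chartForm_formI_eventuallyEq Y κ x).fderiv_eq,
      (chartForm_formI_eventuallyEq Y κ x).self_of_nhds]
  rw [h, formAt_formLie X (hκ.formI Y), formAt_formLie X hκ, hf, vecAt_eq_chartVField,
    flatFormLie_curryLeft_sub (hκ.differentiableAt hx)
      ((Y.contDiffAt_chart hx).differentiableAt (by simp)), formAt_formI, vecAt_bracket,
    formAt_eq_chartForm]

theorem formI_formI_add (X Y : (x : M) → TangentSpace 𝓘(ℝ, E) x) (κ : FormField E M (k + 2)) :
    formI X (formI Y κ) + formI Y (formI X κ) = 0 := formAt_ext fun x v =>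
  vecCons_vecCons_add (formAt κ x) (vecAt Y x) (vecAt X x) v

end Forms

/-! ### Soldered forms -/

namespace NormalizedSubmanifold

variable {E M F N : Type*} [NormedAddCommGroup E] [NormedSpace ℝ E] [FiniteDimensional ℝ E]
  [TopologicalSpace M] [ChartedSpace E M] [IsManifold 𝓘(ℝ, E) ∞ M]
  [NormedAddCommGroup F] [NormedSpace ℝ F] [FiniteDimensional ℝ F]
  [TopologicalSpace N] [ChartedSpace F N] [IsManifold 𝓘(ℝ, F) ∞ N]
  (S : NormalizedSubmanifold E M F N) {k : ℕ}

local notation "φ" => extChartAt 𝓘(ℝ, E)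
local notation "τ" => tangentCoordChange 𝓘(ℝ, E)

theorem formAt_pullback (κ : FormField E M k) (y : N) :
    formAt (S.pullback κ) y = (formAt κ (S.incl y)).compContinuousLinearMap (S.dInclAt y) := rfl

theorem chartForm_pullback (κ : FormField E M k) {y₀ y : N}
    (hy : y ∈ (extChartAt 𝓘(ℝ, F) y₀).source) (hy' : S.incl y ∈ (φ (S.incl y₀)).source) :
    chartForm (S.pullback κ) y₀ (extChartAt 𝓘(ℝ, F) y₀ y) =
      (chartForm κ (S.incl y₀) (S.inclChart y₀ (extChartAt 𝓘(ℝ, F) y₀ y))).compContinuousLinearMap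
        (fderiv ℝ (S.inclChart y₀) (extChartAt 𝓘(ℝ, F) y₀ y)) := by
  have hys := mem_extChartAt_source (I := 𝓘(ℝ, E)) (S.incl y)
  have h1 : S.inclChart y₀ (extChartAt 𝓘(ℝ, F) y₀ y) = φ (S.incl y₀) (S.incl y) := by
    rw [inclChart, (extChartAt 𝓘(ℝ, F) y₀).left_inv hy]
  rw [chartForm_eq _ y₀ ((extChartAt 𝓘(ℝ, F) y₀).map_source hy),
    (extChartAt 𝓘(ℝ, F) y₀).left_inv hy, formAt_pullback, h1,
    chartForm_eq _ _ ((φ (S.incl y₀)).map_source hy'), (φ (S.incl y₀)).left_inv hy',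
    S.fderiv_inclChart hy hy']
  have h2 : ∀ w, τ (S.incl y₀) (S.incl y) (S.incl y) (τ (S.incl y) (S.incl y₀) (S.incl y) w) = w :=
    fun w => by rw [tangentCoordChange_comp ⟨⟨hys, hy'⟩, hys⟩, tangentCoordChange_self hys]
  ext v
  refine congrArg (formAt κ (S.incl y)) (funext fun i => ?_)
  exact (h2 _).symm

theorem pullback_formD {κ : FormField E M k} (hκ : IsSmoothForm κ) :
    S.pullback (formD κ) = formD (S.pullback κ) := formAt_ext fun y₀ v => by
  have hs := mem_extChartAt_source (I := 𝓘(ℝ, F)) y₀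
  have hs' := mem_extChartAt_source (I := 𝓘(ℝ, E)) (S.incl y₀)
  have h1 : chartForm (S.pullback κ) y₀ =ᶠ[𝓝 (extChartAt 𝓘(ℝ, F) y₀ y₀)] fun u =>
      (chartForm κ (S.incl y₀) (S.inclChart y₀ u)).compContinuousLinearMap
        (fderiv ℝ (S.inclChart y₀) u) := by
    have hc := continuousAt_extChartAt_symm (I := 𝓘(ℝ, F)) y₀
    rw [ContinuousAt, extChartAt_to_inv] at hc
    filter_upwards [target_mem y₀, hc.eventually (S.eventually_mem_source y₀)] with u hu hu'
    have := S.chartForm_pullback κ hu'.1 hu'.2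
    rwa [(extChartAt 𝓘(ℝ, F) y₀).right_inv hu] at this
  have h2 : S.inclChart y₀ (extChartAt 𝓘(ℝ, F) y₀ y₀) = φ (S.incl y₀) (S.incl y₀) := by
    rw [inclChart, extChartAt_to_inv]
  have h3 : fderiv ℝ (S.inclChart y₀) (extChartAt 𝓘(ℝ, F) y₀ y₀) = S.dInclAt y₀ := by
    rw [S.fderiv_inclChart hs hs', tangentCoordChange_self' hs, tangentCoordChange_self' hs']
    rfl
  rw [formAt_formD, h1.extDeriv.self_of_nhds, extDeriv_pullback (hκ.differentiableAt (by
    rw [h2]; exact mem_extChartAt_target _)) (S.contDiffAt_inclChart hs hs') two_le_infty, h2, h3,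
    formAt_pullback, formAt_formD]

theorem formD_zero : formD (0 : FormField E M k) = 0 := by
  rw [← zero_smul ℝ (0 : FormField E M k), formD_smul, zero_smul]

/-- Since ι^* i(X)κ = 0 and ι^* commutes with d, the summand d i(X)κ of the Lie derivative pulls
back to zero. -/
theorem pullback_formI_formD {κ : FormField E M k} (hκ : IsSmoothForm κ) (h : S.IsSolderedForm κ)
    (X : VField E M) (hX : S.IsNormal X) : S.pullback (formI X (formD κ)) = 0 := by
  cases k with
  | zero => exact h X hX
  | succ k =>
    obtain ⟨h1, h2⟩ := h X hX
    have h3 : S.pullback (formLie X κ) =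
      S.pullback (formI X (formD κ)) + S.pullback (formD (formI X κ)) := rfl
    rw [h2, S.pullback_formD (hκ.formI X), h1, formD_zero, add_zero] at h3
    exact h3.symm

theorem formD_mem_solderedForms {κ : FormField E M k} (hκ : κ ∈ S.solderedForms k) :
    formD κ ∈ S.solderedForms (k + 1) := by
  obtain ⟨hκ, h⟩ := hκ
  refine ⟨hκ.formD, fun X hX => ?_⟩
  have h1 := S.pullback_formI_formD hκ h X hX
  refine ⟨h1, ?_⟩
  have h3 : S.pullback (formLie X (formD κ)) =
    S.pullback (formI X (formD (formD κ))) + S.pullback (formD (formI X (formD κ))) := rfl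
  -- As d² = 0, the Lie derivative of dκ is d i(X)dκ, whose pullback is d of zero.
  rw [h3, formD_formD hκ, S.pullback_formD (hκ.formD.formI X), h1, formD_zero, add_zero]
  rfl

theorem pullback_formI_eq_zero {Y : (x : M) → TangentSpace 𝓘(ℝ, E) x}
    (hY : ∀ y, vecAt Y (S.incl y) ∈ S.tangentAt y) {κ : FormField E M (k + 1)}
    (hκ : S.pullback κ = 0) : S.pullback (formI Y κ) = 0 := formAt_ext fun y v => by
  obtain ⟨w, hw⟩ := hY y
  have h1 : formAt (S.pullback κ) y (Matrix.vecCons w v) = 0 := by rw [hκ]; rfl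
  refine Eq.trans ?_ h1
  have hw' : vecAt Y (S.incl y) = S.dInclAt y w := hw.symm
  rw [formAt_pullback, formAt_pullback, ContinuousAlternatingMap.compContinuousLinearMap_apply,
    formAt_formI, hw', ContinuousAlternatingMap.compContinuousLinearMap_apply]
  refine congrArg (formAt κ (S.incl y)) (funext fun i => ?_)
  refine Fin.cases ?_ (fun i => ?_) i <;> rfl

theorem solderedMulti_one_tangent {Y : VField E M} (hY : vfieldMulti Y ∈ S.solderedMultis 1)
    (y : N) : vecAt Y (S.incl y) ∈ S.tangentAt y := by
  have h := ((S.isSolderedMulti_iff_annPow 1 _).1 hY.2.2).1 y 0 rfl 1 (one_mem_annPow _)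
  rw [map_one] at h
  obtain ⟨v, hv, hvY⟩ := h
  have h1 : v = vecAt Y (S.incl y) := (ExteriorAlgebra.ι_leftInverse (R := ℝ) (M := E)).injective hvY
  rwa [← h1]

/-- In degree one, condition (ii) says that p kills [X, Y], and the kernel of p is νN. -/
theorem solderedMulti_one_normal {Y : VField E M} (hY : vfieldMulti Y ∈ S.solderedMultis 1)
    {X : VField E M} (hX : S.IsNormal X) : S.IsNormal (⁅X, Y⁆ : VField E M) := fun y => by
  have h := ((S.isSolderedMulti_iff hY.1 hY.2.1).1 hY.2.2).2 X hX y
  rw [← vfieldMulti_bracket] at h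
  have h1 : ExteriorAlgebra.map (S.proj y).toLinearMap
    (multiAt (vfieldMulti (⁅X, Y⁆ : VField E M)) (S.incl y)) =
      ExteriorAlgebra.ι ℝ (S.proj y (vecAt (⁅X, Y⁆ : VField E M) (S.incl y))) :=
    ExteriorAlgebra.map_apply_ι _ _
  rw [h1] at h
  have h2 := (ExteriorAlgebra.ι_eq_zero_iff (R := ℝ) _).1 h
  exact S.proj_eq_zero_iff.1 h2

/-- L_X i(Y)κ = i(Y)L_X κ + i([X, Y])κ. The first term pulls back to zero because `Y` is tangent to
`N`, the second because [X, Y] is normal. The condition on i(X)i(Y)κ follows by anticommuting the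
contractions. -/
theorem formI_mem_solderedForms {Y : VField E M} (hY : vfieldMulti Y ∈ S.solderedMultis 1)
    {κ : FormField E M (k + 1)} (hκ : κ ∈ S.solderedForms (k + 1)) :
    formI Y κ ∈ S.solderedForms k := by
  obtain ⟨hκ, h⟩ := hκ
  have hT := S.solderedMulti_one_tangent hY
  have hL : ∀ X : VField E M, S.IsNormal X → S.pullback (formLie X (formI Y κ)) = 0 := by
    intro X hX
    obtain ⟨h1, h2⟩ := h X hX
    have h3 : S.pullback (formLie X (formI Y κ) - formI Y (formLie X κ)) =
      S.pullback (formLie X (formI Y κ)) - S.pullback (formI Y (formLie X κ)) := rfl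
    rw [formLie_formI X Y hκ, (h _ (S.solderedMulti_one_normal hY hX)).1,
      S.pullback_formI_eq_zero hT h2, sub_zero] at h3
    exact h3.symm
  refine ⟨hκ.formI Y, ?_⟩
  cases k with
  | zero => exact hL
  | succ k =>
    refine fun X hX => ⟨?_, hL X hX⟩
    have h3 : S.pullback (formI X (formI Y κ) + formI Y (formI X κ)) =
      S.pullback (formI X (formI Y κ)) + S.pullback (formI Y (formI X κ)) := rfl
    rw [formI_formI_add, S.pullback_formI_eq_zero hT (h X hX).1, add_zero] at h3
    exact h3.symm

end NormalizedSubmanifold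

end

section

namespace NormalizedSubmanifold

variable {E M F N : Type*} [NormedAddCommGroup E] [NormedSpace ℝ E] [FiniteDimensional ℝ E]
  [TopologicalSpace M] [ChartedSpace E M] [IsManifold 𝓘(ℝ, E) ∞ M] [T2Space M]
  [NormedAddCommGroup F] [NormedSpace ℝ F] [FiniteDimensional ℝ F]
  [TopologicalSpace N] [ChartedSpace F N] [IsManifold 𝓘(ℝ, F) ∞ N]
  (S : NormalizedSubmanifold E M F N)

/-! ### Soldered functions and soldered vector fields -/

/-- In degree zero both notions of soldering say that X(f) is zero on `N` for all normal X. This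
transfers the closure properties of multivector fields to functions. -/
theorem funMulti_mem_solderedMultis_iff {f : M → ℝ} (hf : ContMDiff 𝓘(ℝ, E) 𝓘(ℝ) ∞ f) :
    funMulti f ∈ S.solderedMultis 0 ↔ S.IsSolderedForm (funForm f) := by
  have hL : ∀ X : VField E M, multiLie X (funMulti f) =
      funMulti fun x => mfderiv 𝓘(ℝ, E) 𝓘(ℝ) f x (X x) := fun X => by
    rw [multiLie_eq_schouten X (isSmoothMulti_funMulti_iff.2 hf), schouten_vfieldMulti_funMulti X hf]
  rw [S.funForm_soldered_iff hf]
  constructor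
  · intro h X hX y
    have h1 := h.2.2.2 X hX y 1 (one_mem_annPow (V := E) (S.normalAt y))
    rw [hL, map_one] at h1
    exact (ExteriorAlgebra.algebraMap_leftInverse (R := ℝ) E).injective (h1.trans (map_zero _).symm)
  · intro h
    refine ⟨isSmoothMulti_funMulti_iff.2 hf, isOfDegree_funMulti f,
      fun y l hl => absurd hl (Nat.succ_ne_zero l).symm, fun X hX y a _ => ?_⟩
    rw [hL]
    have h1 : funMulti (E := E) (fun x => mfderiv 𝓘(ℝ, E) 𝓘(ℝ) f x (X x)) (S.incl y) = 0 :=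
      (congrArg (algebraMap ℝ (ExteriorAlgebra ℝ E)) (h X hX y)).trans (map_zero _)
    rw [h1, map_zero]

theorem funMulti_mem (f : S.solderedFunctions) :
    funMulti (f : C^∞⟮𝓘(ℝ, E), M; ℝ⟯) ∈ S.solderedMultis 0 :=
  (S.funMulti_mem_solderedMultis_iff f.1.contMDiff).2 f.2

/-- The Lie algebra `V^1(M, N, νN)` of soldered vector fields. -/
def solderedVFields : LieSubalgebra ℝ (VField E M) where
  carrier := {X | vfieldMulti X ∈ S.solderedMultis 1}
  zero_mem' := by
    have h : vfieldMulti (0 : VField E M) = 0 :=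
      funext fun x => map_zero (ExteriorAlgebra.ι ℝ (M := TangentSpace 𝓘(ℝ, E) x))
    change vfieldMulti (0 : VField E M) ∈ S.solderedMultis 1
    rw [h]
    exact Submodule.zero_mem _
  add_mem' := by
    intro X Y hX hY
    have h : vfieldMulti (X + Y : VField E M) = vfieldMulti X + vfieldMulti Y :=
      funext fun x => map_add (ExteriorAlgebra.ι ℝ (M := TangentSpace 𝓘(ℝ, E) x)) (X x) (Y x)
    change vfieldMulti (X + Y : VField E M) ∈ S.solderedMultis 1
    rw [h]
    exact Submodule.add_mem _ hX hY
  smul_mem' := by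
    intro c X hX
    have h : vfieldMulti (c • X : VField E M) = c • vfieldMulti X :=
      funext fun x => map_smul (ExteriorAlgebra.ι ℝ (M := TangentSpace 𝓘(ℝ, E) x)) c (X x)
    change vfieldMulti (c • X : VField E M) ∈ S.solderedMultis 1
    rw [h]
    exact Submodule.smul_mem _ c hX
  lie_mem' := by
    intro X Y hX hY
    change vfieldMulti (⁅X, Y⁆ : VField E M) ∈ S.solderedMultis 1
    rw [vfieldMulti_bracket]
    exact schouten_mem_solderedMultis rfl hX hY

theorem funMulti_injective : Function.Injective (funMulti (E := E) : (M → ℝ) → MultiField E M) :=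
  fun _ _ h => funext fun x =>
    (ExteriorAlgebra.algebraMap_leftInverse (R := ℝ) E).injective (congrFun h x)

theorem vfieldMulti_injective {X Y : VField E M} (h : vfieldMulti X = vfieldMulti Y) : X = Y := by
  ext x
  exact (ExteriorAlgebra.ι_leftInverse (R := ℝ) (M := E)).injective (congrFun h x)

/-- The product of a smooth function and a vector field. -/
def funSmul (f : C^∞⟮𝓘(ℝ, E), M; ℝ⟯) (X : VField E M) : VField E M :=
  ⟨fun x => (f x : ℝ) • X x, f.contMDiff.smul_section X.contMDiff⟩

theorem vfieldMulti_funSmul (f : C^∞⟮𝓘(ℝ, E), M; ℝ⟯) (X : VField E M) :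
    vfieldMulti (funSmul f X) = funMulti f * vfieldMulti X := by
  refine multiAt_ext fun x => ?_
  rw [multiAt_mul]
  change ExteriorAlgebra.ι ℝ ((f x : ℝ) • vecAt X x) =
    algebraMap ℝ (ExteriorAlgebra ℝ E) (f x) * ExteriorAlgebra.ι ℝ (vecAt X x)
  rw [map_smul, Algebra.smul_def]

instance : Module S.solderedFunctions S.solderedVFields where
  smul f X := ⟨funSmul f.1 X.1, by
    change vfieldMulti (funSmul f.1 X.1) ∈ S.solderedMultis 1
    rw [vfieldMulti_funSmul]
    exact mul_mem_solderedMultis (p := 0) (q := 1) (S.funMulti_mem f) X.2⟩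
  one_smul X := Subtype.ext (by ext x; exact one_smul ℝ (X.1 x))
  mul_smul f g X := Subtype.ext (by ext x; exact mul_smul (f.1 x) (g.1 x) (X.1 x))
  smul_zero f := Subtype.ext (by ext x; exact smul_zero (f.1 x))
  smul_add f X Y := Subtype.ext (by ext x; exact smul_add (f.1 x) (X.1 x) (Y.1 x))
  add_smul f g X := Subtype.ext (by ext x; exact add_smul (f.1 x) (g.1 x) (X.1 x))
  zero_smul X := Subtype.ext (by ext x; exact zero_smul ℝ (X.1 x))

theorem funMulti_mfderiv_mem (X : S.solderedVFields) (f : S.solderedFunctions) :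
    funMulti (fun x => mfderiv 𝓘(ℝ, E) 𝓘(ℝ) f.1 x (X.1 x)) ∈ S.solderedMultis 0 := by
  rw [← schouten_vfieldMulti_funMulti X.1 f.1.contMDiff]
  exact schouten_mem_solderedMultis (p := 1) (q := 0) rfl X.2 (S.funMulti_mem f)

/-- The action of soldered vector fields on soldered functions. -/
instance : Bracket S.solderedVFields S.solderedFunctions where
  bracket X f :=
    ⟨⟨fun x => mfderiv 𝓘(ℝ, E) 𝓘(ℝ) f.1 x (X.1 x),
      isSmoothMulti_funMulti_iff.1 (S.funMulti_mfderiv_mem X f).1⟩,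
      (S.funMulti_mem_solderedMultis_iff
        (isSmoothMulti_funMulti_iff.1 (S.funMulti_mfderiv_mem X f).1)).1
        (S.funMulti_mfderiv_mem X f)⟩

variable {S}

theorem solderedFunctions_ext {f g : S.solderedFunctions}
    (h : funMulti (E := E) f.1 = funMulti g.1) : f = g :=
  Subtype.ext (DFunLike.coe_injective (funMulti_injective h))

theorem solderedVFields_ext {X Y : S.solderedVFields}
    (h : vfieldMulti X.1 = vfieldMulti Y.1) : X = Y :=
  Subtype.ext (vfieldMulti_injective h)

theorem funMulti_bracket (X : S.solderedVFields) (f : S.solderedFunctions) :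
    funMulti (⁅X, f⁆ : S.solderedFunctions).1 = schouten (vfieldMulti X.1) (funMulti f.1) :=
  (schouten_vfieldMulti_funMulti X.1 f.1.contMDiff).symm

theorem vfieldMulti_coe_bracket (X Y : S.solderedVFields) :
    vfieldMulti (⁅X, Y⁆ : S.solderedVFields).1 = schouten (vfieldMulti X.1) (vfieldMulti Y.1) :=
  vfieldMulti_bracket X.1 Y.1

theorem vfieldMulti_coe_smul (f : S.solderedFunctions) (X : S.solderedVFields) :
    vfieldMulti (f • X).1 = funMulti f.1 * vfieldMulti X.1 :=
  vfieldMulti_funSmul f.1 X.1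

theorem vfieldMulti_coe_add (X Y : S.solderedVFields) :
    vfieldMulti (X + Y).1 = vfieldMulti X.1 + vfieldMulti Y.1 :=
  funext fun x => map_add (ExteriorAlgebra.ι ℝ (M := TangentSpace 𝓘(ℝ, E) x)) (X.1 x) (Y.1 x)

theorem funMulti_coe_add (f g : S.solderedFunctions) :
    funMulti (E := E) (f + g).1 = funMulti f.1 + funMulti g.1 :=
  funext fun x => map_add (algebraMap ℝ (ExteriorAlgebra ℝ (TangentSpace 𝓘(ℝ, E) x)))
    (f.1 x) (g.1 x)

theorem funMulti_coe_mul (f g : S.solderedFunctions) :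
    funMulti (E := E) (f * g).1 = funMulti f.1 * funMulti g.1 :=
  funext fun x => map_mul (algebraMap ℝ (ExteriorAlgebra ℝ (TangentSpace 𝓘(ℝ, E) x)))
    (f.1 x) (g.1 x)

theorem funMulti_coe_smul (c : ℝ) (f : S.solderedFunctions) :
    funMulti (E := E) (c • f).1 = c • funMulti f.1 :=
  multiAt_ext fun x => by
    rw [multiAt_smul]
    change algebraMap ℝ (ExteriorAlgebra ℝ E) (c * f.1 x) = c • algebraMap ℝ _ (f.1 x)
    rw [map_mul, Algebra.smul_def]

variable (S)

instance : LieRingModule S.solderedVFields S.solderedFunctions where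
  add_lie X Y f := solderedFunctions_ext <| by
    rw [funMulti_coe_add, funMulti_bracket, funMulti_bracket, funMulti_bracket,
      vfieldMulti_coe_add, schouten_add_left X.2.1 Y.2.1 (S.funMulti_mem f).1]
  lie_add X f g := solderedFunctions_ext <| by
    rw [funMulti_coe_add, funMulti_bracket, funMulti_bracket, funMulti_bracket,
      funMulti_coe_add, schouten_add_right X.2.1 (S.funMulti_mem f).1 (S.funMulti_mem g).1]
  leibniz_lie X Y f := solderedFunctions_ext <| by
    have h := schouten_jacobi X.2.1 Y.2.1 (S.funMulti_mem f).1 X.2.2.1 Y.2.2.1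
    -- The sign in the Jacobi identity for two fields of degree one is +1.
    norm_num at h
    rw [funMulti_coe_add]
    simp only [funMulti_bracket]
    rw [h, vfieldMulti_coe_bracket]

/-- Both Leibniz axioms are the graded Leibniz rule with a function as first factor. The remaining
axiom is linearity of the differential. -/
instance : LieRinehartRing S.solderedFunctions S.solderedVFields where
  lie_smul_eq_mul' f g X := by
    refine Subtype.ext (DFunLike.coe_injective (funext fun x => ?_))
    exact map_smul (mfderiv 𝓘(ℝ, E) 𝓘(ℝ) g.1 x) (f.1 x) (X.1 x)
  leibniz_mul_right' X f g := solderedFunctions_ext <| by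
    have h := schouten_mul X.2.1 (S.funMulti_mem f).1 (S.funMulti_mem g).1 X.2.2.1
      (S.funMulti_mem f).2.1
    norm_num at h
    rw [smul_eq_mul, funMulti_coe_add, funMulti_coe_mul, funMulti_coe_mul, funMulti_bracket,
      funMulti_bracket, funMulti_bracket, funMulti_coe_mul, h, add_comm]
  leibniz_smul_right' X Y f := solderedVFields_ext <| by
    have h := schouten_mul X.2.1 (S.funMulti_mem f).1 Y.2.1 X.2.2.1 (S.funMulti_mem f).2.1
    norm_num at h
    rw [vfieldMulti_coe_add, vfieldMulti_coe_smul, vfieldMulti_coe_smul, vfieldMulti_coe_bracket,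
      vfieldMulti_coe_bracket, funMulti_bracket, vfieldMulti_coe_smul, h, add_comm]

instance : LieRinehartAlgebra ℝ S.solderedFunctions S.solderedVFields where
  smul_assoc c f X := Subtype.ext (by ext x; exact mul_smul c (f.1 x) (X.1 x))
  smul_lie c X f := by
    refine Subtype.ext (DFunLike.coe_injective (funext fun x => ?_))
    exact map_smul (mfderiv 𝓘(ℝ, E) 𝓘(ℝ) f.1 x) c (X.1 x)
  lie_smul c X f := solderedFunctions_ext <| by
    rw [funMulti_bracket, funMulti_coe_smul, funMulti_coe_smul, funMulti_bracket,
      schouten_smul_right c X.2.1 (S.funMulti_mem f).1]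

theorem one_mem_solderedMultis : (1 : MultiField E M) ∈ S.solderedMultis 0 := by
  have h : funMulti (1 : S.solderedFunctions).1 = (1 : MultiField E M) :=
    funext fun x => map_one (algebraMap ℝ (ExteriorAlgebra ℝ (TangentSpace 𝓘(ℝ, E) x)))
  rw [← h]
  exact S.funMulti_mem 1

/-! ### The complex of soldered forms -/

/-- The complex of soldered forms over the Lie algebra of soldered vector fields. -/
def formComplex : ComplexOverLieAlgebra S.solderedVFields (fun k => S.solderedForms k) where
  d k :=
    { toFun κ := ⟨formD κ.1, S.formD_mem_solderedForms κ.2⟩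
      map_add' κ κ' := Subtype.ext <| funext fun x =>
        formD_add (κ.2.1.diffAt x) (κ'.2.1.diffAt x)
      map_smul' c κ := Subtype.ext (formD_smul c κ.1) }
  i k := LinearMap.mk₂ ℝ (fun X κ => ⟨formI X.1 κ.1, S.formI_mem_solderedForms X.2 κ.2⟩)
    (fun X Y κ => Subtype.ext <| funext fun x => map_add
      (ContinuousAlternatingMap.curryLeft (E := E) (κ.1 x)) (X.1 x) (Y.1 x))
    (fun c X κ => Subtype.ext <| funext fun x => map_smul
      (ContinuousAlternatingMap.curryLeft (E := E) (κ.1 x)) c (X.1 x))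
    (fun X κ κ' => rfl) (fun c X κ => rfl)
  d_d k κ := Subtype.ext (formD_formD κ.2.1)
  i_i k X Y κ := Subtype.ext (formI_formI_add X.1 Y.1 κ.1)
  lie_i k X Y κ := by
    refine Subtype.ext (Eq.trans ?_ (formLie_formI X.1 Y.1 κ.2.1))
    cases k <;> rfl

end NormalizedSubmanifold

end

section

/-! ### The Gerstenhaber algebra of soldered multivector fields -/

theorem iSupIndep_of_projections {ι V W : Type*} [AddCommGroup V] [Module ℝ V] [AddCommGroup W]
    [Module ℝ W] {p : ι → Submodule ℝ V} (π : ι → V →ₗ[ℝ] W)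
    (h1 : ∀ i, ∀ x ∈ p i, π i x = 0 → x = 0) (h2 : ∀ i j, i ≠ j → ∀ x ∈ p j, π i x = 0) :
    iSupIndep p := fun i => by
  rw [Submodule.disjoint_def]
  intro x hx hx'
  have h : (⨆ (j) (_ : j ≠ i), p j) ≤ LinearMap.ker (π i) :=
    iSup₂_le fun j hj y hy => h2 i j hj.symm y hy
  exact h1 i x hx (h hx')

section

variable {E M : Type*} [NormedAddCommGroup E] [NormedSpace ℝ E] [FiniteDimensional ℝ E]
  [TopologicalSpace M] [ChartedSpace E M] [IsManifold 𝓘(ℝ, E) ∞ M]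

/-- The component of degree `k` of a section of `⋀ TM`. -/
def degreeProj (k : ℕ) : MultiField E M →ₗ[ℝ] MultiField E M :=
  LinearMap.pi fun x => (GradedAlgebra.proj
    (fun k : ℕ => ⋀[ℝ]^k (TangentSpace 𝓘(ℝ, E) x)) k).comp (LinearMap.proj x)

theorem degreeProj_of_isOfDegree {k : ℕ} {Q : MultiField E M} (h : IsOfDegree k Q) :
    degreeProj k Q = Q :=
  funext fun x => DirectSum.decompose_of_mem_same
    (fun k : ℕ => ⋀[ℝ]^k (TangentSpace 𝓘(ℝ, E) x)) (h x)

theorem degreeProj_of_ne {k l : ℕ} (hkl : k ≠ l) {Q : MultiField E M} (h : IsOfDegree l Q) :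
    degreeProj k Q = 0 :=
  funext fun x => DirectSum.decompose_of_mem_ne
    (fun k : ℕ => ⋀[ℝ]^k (TangentSpace 𝓘(ℝ, E) x)) (h x) hkl.symm

theorem IsOfDegree.mul_comm {P Q : MultiField E M} {p q : ℕ} (hP : IsOfDegree p P)
    (hQ : IsOfDegree q Q) : P * Q = (-1 : ℝ) ^ (p * q) • (Q * P) :=
  funext fun x => mul_comm_of_mem (hP x) (hQ x)

end

namespace NormalizedSubmanifold

variable {E M F N : Type*} [NormedAddCommGroup E] [NormedSpace ℝ E] [FiniteDimensional ℝ E]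
  [TopologicalSpace M] [ChartedSpace E M] [IsManifold 𝓘(ℝ, E) ∞ M]
  [NormedAddCommGroup F] [NormedSpace ℝ F] [FiniteDimensional ℝ F]
  [TopologicalSpace N] [ChartedSpace F N] [IsManifold 𝓘(ℝ, F) ∞ N]
  {S : NormalizedSubmanifold E M F N}

theorem isSmoothMulti_of_mem_iSup {P : MultiField E M} (hP : P ∈ ⨆ k, S.solderedMultis k) :
    IsSmoothMulti P := by
  induction hP using Submodule.iSup_induction' with
  | mem k P hP => exact hP.1
  | zero => exact (S.solderedMultis 0).zero_mem.1
  | add P Q _ _ hP hQ => exact hP.add hQ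

variable [T2Space M]

theorem mul_mem_iSup {P Q : MultiField E M} (hP : P ∈ ⨆ k, S.solderedMultis k)
    (hQ : Q ∈ ⨆ k, S.solderedMultis k) : P * Q ∈ ⨆ k, S.solderedMultis k := by
  induction hP using Submodule.iSup_induction' with
  | zero => rw [zero_mul]; exact Submodule.zero_mem _
  | add P P' _ _ hP hP' => rw [add_mul]; exact Submodule.add_mem _ hP hP'
  | mem k P hP =>
    induction hQ using Submodule.iSup_induction' with
    | zero => rw [mul_zero]; exact Submodule.zero_mem _
    | add Q Q' _ _ hQ hQ' => rw [mul_add]; exact Submodule.add_mem _ hQ hQ'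
    | mem l Q hQ => exact Submodule.mem_iSup_of_mem (k + l) (mul_mem_solderedMultis hP hQ)

theorem schouten_mem_iSup {P Q : MultiField E M} (hP : P ∈ ⨆ k, S.solderedMultis k)
    (hQ : Q ∈ ⨆ k, S.solderedMultis k) : schouten P Q ∈ ⨆ k, S.solderedMultis k := by
  -- Additivity of the bracket is available for smooth fields, so smoothness accompanies the sums.
  have hQs := isSmoothMulti_of_mem_iSup hQ
  induction hP using Submodule.iSup_induction' with
  | zero =>
    have h := schouten_smul_left 0 (S.solderedMultis 0).zero_mem.1 hQs
    rw [zero_smul, zero_smul] at h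
    rw [h]
    exact Submodule.zero_mem _
  | add P P' h h' hP hP' =>
    rw [schouten_add_left (isSmoothMulti_of_mem_iSup h) (isSmoothMulti_of_mem_iSup h') hQs]
    exact Submodule.add_mem _ hP hP'
  | mem k P hP =>
    clear hQs
    induction hQ using Submodule.iSup_induction' with
    | zero =>
      have h := schouten_smul_right 0 hP.1 (S.solderedMultis 0).zero_mem.1
      rw [zero_smul, zero_smul] at h
      rw [h]
      exact Submodule.zero_mem _
    | add Q Q' h h' hQ hQ' =>
      rw [schouten_add_right hP.1 (isSmoothMulti_of_mem_iSup h) (isSmoothMulti_of_mem_iSup h')]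
      exact Submodule.add_mem _ hQ hQ'
    | mem l Q hQ =>
      -- In total degree zero the bracket is zero; otherwise it has degree `k + l - 1`.
      rcases Nat.eq_zero_or_pos (k + l) with h | h
      · obtain ⟨rfl, rfl⟩ := Nat.add_eq_zero_iff.1 h
        rw [schouten_zero_zero hP.2.1 hQ.2.1]
        exact Submodule.zero_mem _
      · exact Submodule.mem_iSup_of_mem (k + l - 1)
          (schouten_mem_solderedMultis (Nat.sub_add_cancel h).symm hP hQ)

variable (S)

/-- The algebra of soldered multivector fields. -/
def multiAlgebra : Subalgebra ℝ (MultiField E M) :=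
  (⨆ k, S.solderedMultis k).toSubalgebra
    (Submodule.mem_iSup_of_mem 0 S.one_mem_solderedMultis) fun _ _ => mul_mem_iSup

/-- The soldered `k`-vector fields as a subspace of the algebra of soldered multivector fields. -/
def multiGrade (k : ℕ) : Submodule ℝ S.multiAlgebra :=
  (S.solderedMultis k).comap S.multiAlgebra.val.toLinearMap

variable {S}

theorem isSmoothMulti_coe (P : S.multiAlgebra) : IsSmoothMulti P.1 :=
  isSmoothMulti_of_mem_iSup P.2

theorem multiGrade.isOfDegree {k : ℕ} {P : S.multiAlgebra} (hP : P ∈ S.multiGrade k) :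
    IsOfDegree k P.1 := hP.2.1

variable (S)

theorem map_multiGrade (k : ℕ) :
    (S.multiGrade k).map S.multiAlgebra.val.toLinearMap = S.solderedMultis k :=
  Submodule.map_comap_eq_of_le fun P hP => ⟨⟨P, Submodule.mem_iSup_of_mem k hP⟩, rfl⟩

/-- The pointwise degree components separate the summands, so the sum is direct, and it is
everything by the definition of the algebra. -/
theorem isInternal_multiGrade : DirectSum.IsInternal S.multiGrade := by
  refine DirectSum.isInternal_submodule_of_iSupIndep_of_iSup_eq_top ?_ ?_
  · refine iSupIndep_of_projections
      (fun k => (degreeProj k).comp S.multiAlgebra.val.toLinearMap) (fun k P hP h => ?_)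
      fun k l hkl P hP => degreeProj_of_ne hkl hP.2.1
    exact Subtype.ext ((degreeProj_of_isOfDegree hP.2.1).symm.trans h)
  · refine Submodule.map_injective_of_injective
      (f := S.multiAlgebra.val.toLinearMap) Subtype.val_injective ?_
    rw [Submodule.map_iSup]
    simp only [map_multiGrade]
    refine le_antisymm (fun P hP => ⟨⟨P, hP⟩, trivial, rfl⟩) ?_
    rintro _ ⟨P, -, rfl⟩
    exact P.2

instance : SetLike.GradedMonoid S.multiGrade where
  one_mem := S.one_mem_solderedMultis
  mul_mem _ _ _ _ hP hQ := mul_mem_solderedMultis hP hQ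

instance : GradedAlgebra S.multiGrade where
  toDecomposition := S.isInternal_multiGrade.chooseDecomposition

/-- The Gerstenhaber algebra of soldered multivector fields. -/
def multiGerstenhaber : GerstenhaberAlgebra S.multiAlgebra S.multiGrade where
  bracket := LinearMap.mk₂ ℝ (fun P Q => ⟨schouten P.1 Q.1, schouten_mem_iSup P.2 Q.2⟩)
    (fun P P' Q => Subtype.ext
      (schouten_add_left (isSmoothMulti_coe P) (isSmoothMulti_coe P') (isSmoothMulti_coe Q)))
    (fun c P Q => Subtype.ext (schouten_smul_left c (isSmoothMulti_coe P) (isSmoothMulti_coe Q)))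
    (fun P Q Q' => Subtype.ext
      (schouten_add_right (isSmoothMulti_coe P) (isSmoothMulti_coe Q) (isSmoothMulti_coe Q')))
    (fun c P Q => Subtype.ext (schouten_smul_right c (isSmoothMulti_coe P) (isSmoothMulti_coe Q)))
  mul_comm _ _ _ hP _ hQ := Subtype.ext
    ((multiGrade.isOfDegree hP).mul_comm (multiGrade.isOfDegree hQ))
  bracket_mem _ _ _ hr _ hP _ hQ := schouten_mem_solderedMultis hr hP hQ
  bracket_zero _ hP _ hQ := Subtype.ext
    (schouten_zero_zero (multiGrade.isOfDegree hP) (multiGrade.isOfDegree hQ))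
  skew _ _ P hP Q hQ := Subtype.ext (schouten_skew (isSmoothMulti_coe P) (isSmoothMulti_coe Q)
    (multiGrade.isOfDegree hP) (multiGrade.isOfDegree hQ))
  jacobi _ _ P hP Q hQ R := Subtype.ext (schouten_jacobi (isSmoothMulti_coe P)
    (isSmoothMulti_coe Q) (isSmoothMulti_coe R) (multiGrade.isOfDegree hP)
    (multiGrade.isOfDegree hQ))
  leibniz _ _ P hP Q hQ R := Subtype.ext (schouten_mul (isSmoothMulti_coe P)
    (isSmoothMulti_coe Q) (isSmoothMulti_coe R) (multiGrade.isOfDegree hP)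
    (multiGrade.isOfDegree hQ))

end NormalizedSubmanifold

end

end Soldered

end

theorem proposition1p1 {E M F N : Type*}
    [NormedAddCommGroup E] [NormedSpace ℝ E] [FiniteDimensional ℝ E]
    [TopologicalSpace M] [ChartedSpace E M] [IsManifold 𝓘(ℝ, E) ∞ M] [T2Space M]
    [NormedAddCommGroup F] [NormedSpace ℝ F] [FiniteDimensional ℝ F]
    [TopologicalSpace N] [ChartedSpace F N] [IsManifold 𝓘(ℝ, F) ∞ N]
    (S : Soldered.NormalizedSubmanifold E M F N) :
    ∃ L : LieSubalgebra ℝ (Soldered.VField E M),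
      (∀ X : Soldered.VField E M, X ∈ L ↔ Soldered.vfieldMulti X ∈ S.solderedMultis 1) ∧
      -- 1. the Lie-Rinehart algebra
      (∃ (_ : Module S.solderedFunctions L) (_ : LieRingModule L S.solderedFunctions)
          (_ : LieRinehartRing S.solderedFunctions L),
        LieRinehartAlgebra ℝ S.solderedFunctions L ∧
        (∀ (f : S.solderedFunctions) (X : L) (x : M),
          (f • X : L).1 x = (f.1 x : ℝ) • X.1 x) ∧
        (∀ (X : L) (f : S.solderedFunctions) (x : M),
          (⁅X, f⁆ : S.solderedFunctions).1 x = mfderiv 𝓘(ℝ, E) 𝓘(ℝ) f.1 x (X.1 x))) ∧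
      -- 2. the complex over the Lie algebra
      (∃ C : Soldered.ComplexOverLieAlgebra L (fun k => S.solderedForms k),
        (∀ (k : ℕ) (κ : S.solderedForms k), (C.d k κ).1 = Soldered.formD κ.1) ∧
        (∀ (k : ℕ) (X : L) (κ : S.solderedForms (k + 1)),
          (C.i k X κ).1 = Soldered.formI X.1 κ.1)) ∧
      -- 3. the Gerstenhaber algebra
      (∃ (A : Subalgebra ℝ (Soldered.MultiField E M)) (𝒜 : ℕ → Submodule ℝ A)
          (_ : GradedAlgebra 𝒜) (G : Soldered.GerstenhaberAlgebra A 𝒜),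
        A.toSubmodule = ⨆ k, S.solderedMultis k ∧
        (∀ k, (𝒜 k).map A.val.toLinearMap = S.solderedMultis k) ∧
        (∀ P Q : A, (G.bracket P Q).1 = Soldered.schouten P.1 Q.1)) :=
  ⟨S.solderedVFields, fun _ => Iff.rfl,
    ⟨inferInstance, inferInstance, inferInstance, inferInstance, fun _ _ _ => rfl,
      fun _ _ _ => rfl⟩,
    ⟨S.formComplex, fun _ _ => rfl, fun _ _ _ => rfl⟩,
    ⟨S.multiAlgebra, S.multiGrade, inferInstance, S.multiGerstenhaber,
      Submodule.toSubalgebra_toSubmodule _ _ _, S.map_multiGrade, fun _ _ => rfl⟩⟩
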